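/- Let $\{\xi_{ij}\}_{i,j\ge 1}$ be i.i.d. centred sub-Gaussian real random variables with unit variance on a probability space $(\Omega,\mathbb P)$, and let $\alpha\in(0,1)$, $\beta>0$, $R>0$. For $x\in\mathbb R^{N_1}$ consider the Hopfield energy $$H_{N_1,N_2}(x)=-\frac{1}{2(N_1+N_2)}\sum_{j=1}^{N_2}\Big(\sum_{i=1}^{N_1}\xi_{ij}x_i\Big)^2$$ and its restriction to pairs of distinct units $$H^{<}_{N_1,N_2}(x)=-\frac{1}{N_1+N_2}\sum_{j=1}^{N_2}\sum_{1\le i<k\le N_1}\xi_{ij}\xi_{kj}x_ix_k .$$ Let $\sigma_{N,R}$ be the uniform probability measure on the sphere of radius $R\sqrt N$ in $\mathbb R^N$, and put $$A_{N_1,N_2}=\frac1{N_1+N_2}\log\int \sigma_{N_1,R}(dx)\,e^{-\beta H_{N_1,N_2}(x)},\qquad A^{<}_{N_1,N_2}=\frac1{N_1+N_2}\log\int \sigma_{N_1,R}(dx)\,e^{-\beta H^{<}_{N_1,N_2}(x)} .$$ Let $\lambda_\pm=\big(1\pm\sqrt{\alpha/(1-\alpha)}\big)^2$ and let $\rho_{MP}(\cdot\,;\alpha)$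 be the Marchenko–Pastur law $$\rho_{MP}(d\lambda;\alpha)=\Big(2-\frac1\alpha\Big)^+\delta_0(d\lambda)+\frac{1-\alpha}{2\pi\alpha}\,\frac{\sqrt{(\lambda-\lambda_-)(\lambda_+-\lambda)}}{\lambda}\,1_{[\lambda_-,\lambda_+]}(\lambda)\,d\lambda .$$ Then for every $q$ with $2q\ge\beta(1-\alpha)\lambda_+$ the function $\lambda\mapsto\log(2q-\beta(1-\alpha)\lambda)$ is $\rho_{MP}(\cdot\,;\alpha)$-integrable, the minimum $$m=\min_{2q\ge\beta(1-\alpha)\lambda_+}\Big(qR^2-\frac12\int\log\big(2q-\beta(1-\alpha)\lambda\big)\,\rho_{MP}(d\lambda;\alpha)-\log R-\frac12\Big)$$ is attained, and $\mathbb P$-almost surely, as $N_1,N_2\to\infty$ with $N_1/(N_1+N_2)\to\alpha$, $$A_{N_1,N_2}\longrightarrow \alpha\, m\qquad\text{and}\qquad A^{<}_{N_1,N_2}\longrightarrow \alpha\Big(m-\frac{\beta(1-\alpha)R^2}{2}\Big).$$ -/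

import Mathlib

open MeasureTheory ProbabilityTheory Filter Topology Set
open scoped ENNReal NNReal

noncomputable section

namespace Hopfield

/-- The uniform probability measure `σ_{N,R}` on the sphere of radius `R √N` centred at `0` in
`ℝ^N`: the normalised surface measure of the unit sphere, pushed forward under the dilation
`u ↦ (R √N) u`. (For `N = 0` this sphere is empty and the measure is `0`.) -/
def sphericalPrior (N : ℕ) (R : ℝ) : Measure (EuclideanSpace ℝ (Fin N)) :=
  ((volume : Measure (EuclideanSpace ℝ (Fin N))).toSphere univ)⁻¹ •
    ((volume : Measure (EuclideanSpace ℝ (Fin N))).toSphere).map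
      (fun u : Metric.sphere (0 : EuclideanSpace ℝ (Fin N)) 1 =>
        (R * √(N : ℝ)) • (u : EuclideanSpace ℝ (Fin N)))

/-- The Hopfield energy as a quadratic form,
`- 1 / (2 (N₁ + N₂)) ∑_j (∑_i ξ_{ij} x_i)² = - ⟨x, Ξ Ξᵀ x⟩ / (2 (N₁ + N₂))`.
The weights `w i j` are those of an infinite array, of which the first `N₁` rows and `N₂` columns
are used. -/
def energy (w : ℕ → ℕ → ℝ) (N₁ N₂ : ℕ) (x : EuclideanSpace ℝ (Fin N₁)) : ℝ :=
  -(1 / (2 * ((N₁ : ℝ) + (N₂ : ℝ)))) *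
    ∑ j : Fin N₂, (∑ i : Fin N₁, w (i : ℕ) (j : ℕ) * x i) ^ 2

/-- The Hopfield energy restricted to pairs of distinct units,
`- 1 / (N₁ + N₂) ∑_j ∑_{i < k} ξ_{ij} ξ_{kj} x_i x_k`. -/
def pairEnergy (w : ℕ → ℕ → ℝ) (N₁ N₂ : ℕ) (x : EuclideanSpace ℝ (Fin N₁)) : ℝ :=
  -(1 / ((N₁ : ℝ) + (N₂ : ℝ))) *
    ∑ j : Fin N₂, ∑ k : Fin N₁, ∑ i ∈ Finset.Iio k,
      w (i : ℕ) (j : ℕ) * w (k : ℕ) (j : ℕ) * x i * x k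

/-- The partition function `∫ e^{-β H(x)} σ_{N₁,R}(dx)` of an energy `H` on `ℝ^{N₁}` with
spherical prior. -/
def partitionFunction (N₁ : ℕ) (β R : ℝ) (H : EuclideanSpace ℝ (Fin N₁) → ℝ) : ℝ :=
  ∫ x, Real.exp (-β * H x) ∂(sphericalPrior N₁ R)

/-- The free energy `(N₁ + N₂)⁻¹ log Z`. -/
def freeEnergy (N₁ N₂ : ℕ) (β R : ℝ) (H : EuclideanSpace ℝ (Fin N₁) → ℝ) : ℝ :=
  1 / ((N₁ : ℝ) + (N₂ : ℝ)) * Real.log (partitionFunction N₁ β R H)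

/-- The lower edge `λ₋ = (1 - √(α / (1 - α)))²`. -/
def lamMinus (α : ℝ) : ℝ := (1 - √(α / (1 - α))) ^ 2

/-- The upper edge `λ₊ = (1 + √(α / (1 - α)))²`. -/
def lamPlus (α : ℝ) : ℝ := (1 + √(α / (1 - α))) ^ 2

/-- The density of the absolutely continuous part of the Marchenko–Pastur law. -/
def mpDensity (α l : ℝ) : ℝ :=
  (Icc (lamMinus α) (lamPlus α)).indicator
    (fun t => (1 - α) / (2 * Real.pi * α) * (√((t - lamMinus α) * (lamPlus α - t)) / t)) l

/-- The Marchenko–Pastur law `ρ_MP(·; α)`, with its atom of mass `(2 - 1/α)⁺` at `0`. -/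
def marchenkoPastur (α : ℝ) : Measure ℝ :=
  ENNReal.ofReal (2 - 1 / α) • Measure.dirac 0 +
    volume.withDensity (fun l => ENNReal.ofReal (mpDensity α l))

/-- The function of `q` that is minimised. -/
def variational (α β R q : ℝ) : ℝ :=
  q * R ^ 2 - 1 / 2 * ∫ l, Real.log (2 * q - β * (1 - α) * l) ∂(marchenkoPastur α)
    - Real.log R - 1 / 2

/-- The constraint set `{q : 2 q ≥ β (1 - α) λ₊}`. -/
def feasible (α β : ℝ) : Set ℝ := {q | β * (1 - α) * lamPlus α ≤ 2 * q}

/-- The thermodynamic limit `N₁, N₂ → ∞` such that `N₁ / (N₁ + N₂) → α`. -/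
def highLoad (α : ℝ) : Filter (ℕ × ℕ) :=
  (atTop ×ˢ atTop) ⊓ comap (fun p : ℕ × ℕ => (p.1 : ℝ) / ((p.1 : ℝ) + (p.2 : ℝ))) (𝓝 α)

end Hopfield

end

/-! On the sphere the energy depends only on the spectrum of `Ξ Ξᵀ / T`, where `T = N₁ + N₂`. The
theorem therefore splits into an almost sure spectral limit and a deterministic asymptotic of
spherical integrals.

Spectral limit. For `v` above `topEdge α = (√α + √(1 - α))²` the trace of `(T v - Ξ Ξᵀ)⁻¹` tends to
`branch α v`, the smaller root `φ` of `α/φ + (1-α)/(1-φ) = v`; the edge is the minimum of the left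
side. The upper bound and positivity come from a barrier argument. Columns are subtracted one at a
time from `(n/φ) • 1`, and each time the matrix is shifted by slightly more than `1/(1-φ)`. By
Sherman–Morrison the trace of the inverse then stays below `φ + ε` up to martingale noise
(`barrier_failure_le`). The lower bound is a leave-one-out identity combined with convexity of
`x/(1-x)` (`Coercive.leave_one_out`). Both use only fourth moments of quadratic forms
(`EntryLaw.quadratic`), so the failure bounds are polynomial. Borel–Cantelli is applied along sizes
`(a^16, b^16)` only, and monotonicity of the trace in the two sizes and in `v` fills the gaps
(`BarrierBound.gram_mono`, `ae_spectralLimit`). Explicit integration identifies `branch α v / α`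
with the rescaled Stieltjes transform of the Marchenko–Pastur law (`stieltjes_marchenkoPastur`).
Integrating in `v` gives the logarithmic potentials (`SpectralLimit.tendsto_log`). The square-root
singularity of `branch` at the edge prevents the largest eigenvalue from staying below it
(`SpectralLimit.eventually_exists_le`).

Spherical integral. The uniform measure on the sphere is the radial projection of Lebesgue measure
on a ball, so in an eigenbasis the partition function is a ratio of `coneIntegral`s. Comparison with
the Gaussian weight `exp(-β/2 ∑ (v - μᵢ) yᵢ²)` bounds it above, for every `v` beyond the edge, by
the functional to be minimised. Conversely, this Gaussian concentrates where `|y|² ≈ n s` with `β s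
= L'(v)`. When `s < R²` the missing mass `R² - s` is put on one eigenvector near the edge. The two
bounds differ by a multiple of `(v - topEdge α)(R² - s)`, which can be made arbitrarily small in
both phases (`exists_nearly_saturated`).

Distinct pairs. Removing the diagonal subtracts a form whose coefficients `∑ⱼ ξᵢⱼ² / T` are
uniformly close to `1 - α`, hence almost a constant on the sphere. -/

noncomputable section

namespace Hopfield

/-! ### Fourth moments of linear and quadratic forms -/

/-- A measurable function with integrable fourth power. -/
def HasFourth {E : Type*} [MeasurableSpace E] (f : E → ℝ) (ν : Measure E) : Prop :=
  Measurable f ∧ Integrable (fun x => f x ^ 4) ν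

section
variable {E F : Type*} [MeasurableSpace E] [MeasurableSpace F] {ν : Measure E}

theorem add_pow_four_le (a b : ℝ) : (a + b) ^ 4 ≤ 8 * (a ^ 4 + b ^ 4) := by
  nlinarith [sq_nonneg (a ^ 2 - b ^ 2), sq_nonneg (a - b), sq_nonneg (a * b),
    mul_nonneg (sq_nonneg (a - b)) (sq_nonneg (a + b)), sq_nonneg ((a - b) ^ 2),
    mul_nonneg (sq_nonneg (a - b)) (sq_nonneg a), mul_nonneg (sq_nonneg (a - b)) (sq_nonneg b)]

theorem HasFourth.add {f g : E → ℝ} (hf : HasFourth f ν) (hg : HasFourth g ν) :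
    HasFourth (fun x => f x + g x) ν := by
  refine ⟨hf.1.add hg.1, ((hf.2.add hg.2).const_mul 8).mono'
    (((hf.1.add hg.1).pow_const 4).aestronglyMeasurable) ?_⟩
  refine ae_of_all _ fun x => ?_
  rw [Real.norm_of_nonneg (by positivity)]
  exact add_pow_four_le _ _

theorem HasFourth.const_mul {f : E → ℝ} (hf : HasFourth f ν) (c : ℝ) :
    HasFourth (fun x => c * f x) ν := by
  refine ⟨hf.1.const_mul c, ?_⟩
  simp only [mul_pow]
  exact hf.2.const_mul _

theorem HasFourth.const [IsFiniteMeasure ν] (c : ℝ) : HasFourth (fun _ : E => c) ν :=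
  ⟨measurable_const, integrable_const _⟩

theorem HasFourth.sub_const [IsFiniteMeasure ν] {f : E → ℝ} (hf : HasFourth f ν) (c : ℝ) :
    HasFourth (fun x => f x - c) ν := by
  simpa [sub_eq_add_neg] using hf.add (HasFourth.const (-c))

theorem HasFourth.integrable_sq [IsFiniteMeasure ν] {f : E → ℝ} (hf : HasFourth f ν) :
    Integrable (fun x => f x ^ 2) ν := by
  refine (hf.2.add (integrable_const 1)).mono' (hf.1.pow_const 2).aestronglyMeasurable ?_
  refine ae_of_all _ fun x => ?_
  rw [Real.norm_of_nonneg (by positivity)]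
  simp only [Pi.add_apply]
  nlinarith [sq_nonneg (f x ^ 2 - 1)]

theorem HasFourth.integrable [IsFiniteMeasure ν] {f : E → ℝ} (hf : HasFourth f ν) :
    Integrable f ν := by
  refine (hf.integrable_sq.add (integrable_const 1)).mono' hf.1.aestronglyMeasurable ?_
  refine ae_of_all _ fun x => ?_
  simp only [Pi.add_apply, Real.norm_eq_abs]
  nlinarith [sq_nonneg (|f x| - 1), sq_abs (f x)]

theorem HasFourth.integrable_cube_mul [IsFiniteMeasure ν] {f g : E → ℝ} (hf : HasFourth f ν)
    (hg : HasFourth g ν) : Integrable (fun x => f x ^ 3 * g x) ν := by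
  refine (hf.2.add hg.2).mono' ((hf.1.pow_const 3).mul hg.1).aestronglyMeasurable ?_
  refine ae_of_all _ fun x => ?_
  simp only [Pi.add_apply, Real.norm_eq_abs]
  rw [abs_le]
  generalize f x = a
  generalize g x = b
  have h1 : 0 ≤ (a ^ 2 - b ^ 2) ^ 2 := sq_nonneg _
  constructor <;> nlinarith [mul_nonneg (sq_nonneg a) (sq_nonneg (a - b)),
    mul_nonneg (sq_nonneg a) (sq_nonneg (a + b)), sq_nonneg (a ^ 2), sq_nonneg (b ^ 2)]

theorem HasFourth.sq_integral_sq_le [IsProbabilityMeasure ν] {f : E → ℝ} (hf : HasFourth f ν) :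
    (∫ x, f x ^ 2 ∂ν) ^ 2 ≤ ∫ x, f x ^ 4 ∂ν := by
  set t := ∫ x, f x ^ 2 ∂ν
  have h : ∫ x, (2 * t * f x ^ 2 - t ^ 2) ∂ν ≤ ∫ x, f x ^ 4 ∂ν := by
    refine integral_mono ((hf.integrable_sq.const_mul _).sub (integrable_const _)) hf.2 fun x => ?_
    simp only
    nlinarith [sq_nonneg (f x ^ 2 - t)]
  rw [integral_sub (hf.integrable_sq.const_mul _) (integrable_const _), integral_const_mul] at h
  simp at h
  nlinarith

theorem integral_sq_mul_sq_le {f g : E → ℝ} (hf : HasFourth f ν) (hg : HasFourth g ν)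
    {a b : ℝ} (ha : 0 ≤ a) (hb : 0 ≤ b) (hfa : ∫ x, f x ^ 4 ∂ν ≤ a ^ 2)
    (hgb : ∫ x, g x ^ 4 ∂ν ≤ b ^ 2) :
    Integrable (fun x => f x ^ 2 * g x ^ 2) ν ∧ ∫ x, f x ^ 2 * g x ^ 2 ∂ν ≤ a * b := by
  have hi : Integrable (fun x => f x ^ 2 * g x ^ 2) ν := by
    refine (hf.2.add hg.2).mono' ((hf.1.pow_const 2).mul (hg.1.pow_const 2)).aestronglyMeasurable ?_
    refine ae_of_all _ fun x => ?_
    rw [Real.norm_of_nonneg (by positivity)]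
    simp only [Pi.add_apply]
    nlinarith [sq_nonneg (f x ^ 2 - g x ^ 2), sq_nonneg (f x ^ 2), sq_nonneg (g x ^ 2)]
  refine ⟨hi, le_of_forall_pos_le_add fun e he => ?_⟩
  have key : ∀ s : ℝ, 0 < s → ∫ x, f x ^ 2 * g x ^ 2 ∂ν ≤ (s * a ^ 2 + s⁻¹ * b ^ 2) / 2 := by
    intro s hs
    have h : ∫ x, f x ^ 2 * g x ^ 2 ∂ν ≤ ∫ x, (s / 2 * f x ^ 4 + s⁻¹ / 2 * g x ^ 4) ∂ν := by
      refine integral_mono hi ((hf.2.const_mul _).add (hg.2.const_mul _)) fun x => ?_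
      simp only
      have h1 : 0 ≤ s⁻¹ * (s * f x ^ 2 - g x ^ 2) ^ 2 := by positivity
      have h2 : s⁻¹ * (s * f x ^ 2 - g x ^ 2) ^ 2
          = s * f x ^ 4 - 2 * (f x ^ 2 * g x ^ 2) + s⁻¹ * g x ^ 4 := by
        field_simp
        ring
      linarith
    rw [integral_add (hf.2.const_mul _) (hg.2.const_mul _), integral_const_mul,
      integral_const_mul] at h
    have h3 : s / 2 * ∫ x, f x ^ 4 ∂ν ≤ s / 2 * a ^ 2 := by gcongr
    have h4 : s⁻¹ / 2 * ∫ x, g x ^ 4 ∂ν ≤ s⁻¹ / 2 * b ^ 2 := by gcongr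
    linarith
  have : 0 < a + b + e := by linarith
  -- The optimal weight is `s = b / a`, which is meaningless when `a` or `b` vanishes. Moving both
  -- by `η` costs `η (a + b) / 2 ≤ e`.
  set η := e / (a + b + e) with hη
  have hη0 : 0 < η := by positivity
  have hη1 : η ≤ 1 := by rw [hη, div_le_one this]; linarith
  have h := key ((b + η) / (a + η)) (by positivity)
  have e1 : (b + η) / (a + η) * a ^ 2 ≤ (b + η) * a := by
    rw [div_mul_eq_mul_div, div_le_iff₀ (by positivity)]
    nlinarith [mul_nonneg (mul_nonneg (add_nonneg hb hη0.le) ha) hη0.le]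
  have e2 : ((b + η) / (a + η))⁻¹ * b ^ 2 ≤ (a + η) * b := by
    rw [inv_div, div_mul_eq_mul_div, div_le_iff₀ (by positivity)]
    nlinarith [mul_nonneg (mul_nonneg (add_nonneg ha hη0.le) hb) hη0.le]
  have e3 : η * (a + b + e) = e := by rw [hη]; field_simp
  nlinarith

theorem integral_add_four {f₁ f₂ f₃ f₄ : E → ℝ} (h₁ : Integrable f₁ ν) (h₂ : Integrable f₂ ν)
    (h₃ : Integrable f₃ ν) (h₄ : Integrable f₄ ν) :
    ∫ x, (f₁ x + f₂ x + f₃ x + f₄ x) ∂ν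
      = ∫ x, f₁ x ∂ν + ∫ x, f₂ x ∂ν + ∫ x, f₃ x ∂ν + ∫ x, f₄ x ∂ν := by
  have e₁ := integral_add ((h₁.add h₂).add h₃) h₄
  have e₂ := integral_add (h₁.add h₂) h₃
  have e₃ := integral_add h₁ h₂
  simp only [Pi.add_apply] at e₁ e₂ e₃
  rw [e₁, e₂, e₃]

/-- A martingale increment `g` adds at most four times its squared `L⁴` norm. -/
theorem integral_add_pow_four_le [IsFiniteMeasure ν] {f g : E → ℝ} (hf : HasFourth f ν)
    (hg : HasFourth g ν) (h0 : ∫ x, f x ^ 3 * g x ∂ν = 0)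
    {a b : ℝ} (ha : 0 ≤ a) (hb : 0 ≤ b) (hfa : ∫ x, f x ^ 4 ∂ν ≤ a ^ 2)
    (hgb : ∫ x, g x ^ 4 ∂ν ≤ b ^ 2) :
    ∫ x, (f x + g x) ^ 4 ∂ν ≤ (a + 4 * b) ^ 2 := by
  obtain ⟨hi, hle⟩ := integral_sq_mul_sq_le hf hg ha hb hfa hgb
  have h3 := hf.integrable_cube_mul hg
  -- In the binomial expansion `4 f g³ ≤ 2 f² g² + 2 g⁴`. After integration this gives `a² + 8ab +
  -- 3b² ≤ (a + 4b)²`.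
  have h : ∫ x, (f x + g x) ^ 4 ∂ν
      ≤ ∫ x, (f x ^ 4 + 4 * (f x ^ 3 * g x) + 8 * (f x ^ 2 * g x ^ 2) + 3 * g x ^ 4) ∂ν := by
    refine integral_mono (hf.add hg).2
      (((hf.2.add (h3.const_mul _)).add (hi.const_mul _)).add (hg.2.const_mul _)) fun x => ?_
    simp only
    nlinarith [mul_nonneg (sq_nonneg (g x)) (sq_nonneg (f x - g x))]
  have e : ∫ x, (f x ^ 4 + 4 * (f x ^ 3 * g x) + 8 * (f x ^ 2 * g x ^ 2) + 3 * g x ^ 4) ∂ν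
      = ∫ x, f x ^ 4 ∂ν + 4 * ∫ x, f x ^ 3 * g x ∂ν + 8 * ∫ x, f x ^ 2 * g x ^ 2 ∂ν
        + 3 * ∫ x, g x ^ 4 ∂ν := by
    simp only [← integral_const_mul]
    exact integral_add_four hf.2 (h3.const_mul _) (hi.const_mul _) (hg.2.const_mul _)
  rw [e, h0] at h
  nlinarith [sq_nonneg b]

theorem HasFourth.comp_fst {μ : Measure F} [IsProbabilityMeasure ν] [SFinite μ] {f : F → ℝ}
    (hf : HasFourth f μ) : HasFourth (fun p : F × E => f p.1) (μ.prod ν) :=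
  ⟨hf.1.comp measurable_fst, hf.2.comp_fst ν⟩

theorem HasFourth.comp_snd {μ : Measure F} [IsProbabilityMeasure μ] [SFinite ν] {f : E → ℝ}
    (hf : HasFourth f ν) : HasFourth (fun p : F × E => f p.2) (μ.prod ν) :=
  ⟨hf.1.comp measurable_snd, hf.2.comp_snd μ⟩

theorem HasFourth.mul_prod {μ : Measure F} [SFinite μ] [SFinite ν] {f : F → ℝ} {g : E → ℝ}
    (hf : HasFourth f μ) (hg : HasFourth g ν) :
    HasFourth (fun p : F × E => f p.1 * g p.2) (μ.prod ν) := by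
  refine ⟨(hf.1.comp measurable_fst).mul (hg.1.comp measurable_snd), ?_⟩
  simp only [mul_pow]
  exact hf.2.mul_prod hg.2

end

/-- The law of an entry of the pattern array: centred, of unit variance, with eight moments. -/
structure EntryLaw (μ : Measure ℝ) (m : ℝ) : Prop where
  one_le : 1 ≤ m
  hasFourth : HasFourth (fun x : ℝ => x) μ
  hasFourth_sq : HasFourth (fun x : ℝ => x ^ 2) μ
  mean : ∫ x, x ∂μ = 0
  var : ∫ x, x ^ 2 ∂μ = 1
  fourth : ∫ x, x ^ 4 ∂μ ≤ m ^ 2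
  eighth : ∫ x, (x ^ 2 - 1) ^ 4 ∂μ ≤ m ^ 2

/-! ### Linear forms, sums of squares and quadratic forms in independent entries. -/

section
variable {μ : Measure ℝ} [IsProbabilityMeasure μ] {m : ℝ}

theorem piFinSuccAbove_symm_eq_cons {n : ℕ} (p : ℝ × (Fin n → ℝ)) :
    (MeasurableEquiv.piFinSuccAbove (fun _ : Fin (n + 1) => ℝ) 0).symm p = Fin.cons p.1 p.2 := by
  funext i
  refine Fin.cases ?_ (fun j => ?_) i <;> simp [MeasurableEquiv.piFinSuccAbove_symm_apply]

theorem EntryLaw.pi_succ_integral {n : ℕ} (f : (Fin (n + 1) → ℝ) → ℝ) :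
    ∫ x, f x ∂(Measure.pi fun _ : Fin (n + 1) => μ)
      = ∫ p : ℝ × (Fin n → ℝ), f (Fin.cons p.1 p.2) ∂(μ.prod (Measure.pi fun _ => μ)) := by
  rw [← ((measurePreserving_piFinSuccAbove (fun _ : Fin (n + 1) => μ) 0).symm _).integral_comp']
  simp only [piFinSuccAbove_symm_eq_cons]

theorem EntryLaw.pi_succ_integrable {n : ℕ} (f : (Fin (n + 1) → ℝ) → ℝ) :
    Integrable f (Measure.pi fun _ : Fin (n + 1) => μ) ↔
      Integrable (fun p : ℝ × (Fin n → ℝ) => f (Fin.cons p.1 p.2))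
        (μ.prod (Measure.pi fun _ => μ)) := by
  rw [← ((measurePreserving_piFinSuccAbove (fun _ : Fin (n + 1) => μ) 0).symm
    _).integrable_comp_emb (MeasurableEquiv.measurableEmbedding _)]
  simp only [Function.comp_def, piFinSuccAbove_symm_eq_cons]

theorem EntryLaw.pi_succ_hasFourth {n : ℕ} {f : (Fin (n + 1) → ℝ) → ℝ} (hf : Measurable f) :
    HasFourth f (Measure.pi fun _ : Fin (n + 1) => μ) ↔
      HasFourth (fun p : ℝ × (Fin n → ℝ) => f (Fin.cons p.1 p.2))
        (μ.prod (Measure.pi fun _ => μ)) := by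
  have h : Measurable fun p : ℝ × (Fin n → ℝ) => (Fin.cons p.1 p.2 : Fin (n + 1) → ℝ) := by
    simp only [← piFinSuccAbove_symm_eq_cons]
    exact (MeasurableEquiv.piFinSuccAbove (fun _ : Fin (n + 1) => ℝ) 0).symm.measurable
  unfold HasFourth
  rw [pi_succ_integrable]
  exact ⟨fun h1 => ⟨hf.comp h, h1.2⟩, fun h1 => ⟨hf, h1.2⟩⟩

theorem EntryLaw.hasFourth_sq_sub (hμ : EntryLaw μ m) : HasFourth (fun x : ℝ => x ^ 2 - 1) μ :=
  hμ.hasFourth_sq.sub_const 1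

theorem EntryLaw.integral_sq_sub (hμ : EntryLaw μ m) : ∫ x, (x ^ 2 - 1) ∂μ = 0 := by
  rw [integral_sub hμ.hasFourth_sq.integrable (integrable_const _), hμ.var]
  simp

/-- Fourth moment of a linear form. -/
theorem EntryLaw.linear (hμ : EntryLaw μ m) : ∀ (n : ℕ) (b : Fin n → ℝ),
    HasFourth (fun x : Fin n → ℝ => ∑ i, b i * x i) (Measure.pi fun _ => μ) ∧
    ∫ x, (∑ i, b i * x i) ^ 4 ∂(Measure.pi fun _ => μ) ≤ (4 * m * ∑ i, b i ^ 2) ^ 2 := by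
  intro n
  induction n with
  | zero => intro b; simpa using HasFourth.const (0 : ℝ)
  | succ n ih =>
    intro b
    obtain ⟨ih1, ih2⟩ := ih fun i => b i.succ
    have hm := hμ.one_le
    have e : ∀ p : ℝ × (Fin n → ℝ),
        ∑ i, b i * (Fin.cons p.1 p.2 : Fin (n + 1) → ℝ) i
          = ∑ i : Fin n, b i.succ * p.2 i + b 0 * p.1 := by
      intro p
      rw [Fin.sum_univ_succ]
      simp [add_comm]
    rw [EntryLaw.pi_succ_hasFourth (by fun_prop), EntryLaw.pi_succ_integral]
    simp only [e]
    have hf : HasFourth (fun p : ℝ × (Fin n → ℝ) => ∑ i : Fin n, b i.succ * p.2 i)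
        (μ.prod (Measure.pi fun _ => μ)) := ih1.comp_snd
    have hg : HasFourth (fun p : ℝ × (Fin n → ℝ) => b 0 * p.1)
        (μ.prod (Measure.pi fun _ => μ)) := (hμ.hasFourth.comp_fst).const_mul _
    refine ⟨hf.add hg, ?_⟩
    -- The last coordinate contributes `4 b = 4 m (b 0)²`, exactly the missing term of `4 m ∑ b i ^
    -- 2`.
    have key := integral_add_pow_four_le hf hg (a := 4 * m * ∑ i : Fin n, b i.succ ^ 2)
      (b := m * b 0 ^ 2) ?_ (by positivity) (by positivity) ?_ ?_
    · refine key.trans (le_of_eq ?_)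
      rw [Fin.sum_univ_succ]
      ring
    · have := integral_prod_mul (μ := μ) (ν := Measure.pi fun _ : Fin n => μ) (fun x => b 0 * x)
        (fun x => (∑ i : Fin n, b i.succ * x i) ^ 3)
      simp only [mul_comm] at this ⊢
      rw [this]
      simp [integral_mul_const, hμ.mean]
    · rw [integral_fun_snd (fun x : Fin n → ℝ => (∑ i : Fin n, b i.succ * x i) ^ 4)]
      simpa using ih2
    · rw [integral_fun_fst (fun x => (b 0 * x) ^ 4)]
      simp only [mul_pow, integral_const_mul, probReal_univ, one_smul]
      nlinarith [hμ.fourth, sq_nonneg (b 0 ^ 2)]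

/-- Fourth moment of a centred sum of squares. -/
theorem EntryLaw.sum_sq (hμ : EntryLaw μ m) : ∀ (n : ℕ),
    HasFourth (fun x : Fin n → ℝ => ∑ i, (x i ^ 2 - 1)) (Measure.pi fun _ => μ) ∧
    ∫ x, (∑ i, (x i ^ 2 - 1)) ^ 4 ∂(Measure.pi fun _ : Fin n => μ) ≤ (4 * m * n) ^ 2 := by
  intro n
  induction n with
  | zero => simpa using HasFourth.const (0 : ℝ)
  | succ n ih =>
    obtain ⟨ih1, ih2⟩ := ih
    have hm := hμ.one_le
    have e : ∀ p : ℝ × (Fin n → ℝ),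
        ∑ i, ((Fin.cons p.1 p.2 : Fin (n + 1) → ℝ) i ^ 2 - 1)
          = ∑ i : Fin n, (p.2 i ^ 2 - 1) + (p.1 ^ 2 - 1) := by
      intro p
      rw [Fin.sum_univ_succ]
      simp only [Fin.cons_zero, Fin.cons_succ]
      ring
    rw [EntryLaw.pi_succ_hasFourth (by fun_prop), EntryLaw.pi_succ_integral]
    simp only [e]
    have hf : HasFourth (fun p : ℝ × (Fin n → ℝ) => ∑ i : Fin n, (p.2 i ^ 2 - 1))
        (μ.prod (Measure.pi fun _ => μ)) := ih1.comp_snd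
    have hg : HasFourth (fun p : ℝ × (Fin n → ℝ) => p.1 ^ 2 - 1)
        (μ.prod (Measure.pi fun _ => μ)) := hμ.hasFourth_sq_sub.comp_fst
    refine ⟨hf.add hg, ?_⟩
    have key := integral_add_pow_four_le hf hg (a := 4 * m * n)
      (b := m) ?_ (by positivity) (by positivity) ?_ ?_
    · refine key.trans (le_of_eq ?_)
      push_cast
      ring
    · have := integral_prod_mul (μ := μ) (ν := Measure.pi fun _ : Fin n => μ) (fun x => x ^ 2 - 1)
        (fun x => (∑ i : Fin n, (x i ^ 2 - 1)) ^ 3)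
      rw [hμ.integral_sq_sub, zero_mul] at this
      rw [← this]
      exact integral_congr_ae (ae_of_all _ fun p => mul_comm _ _)
    · rw [integral_fun_snd (fun x : Fin n → ℝ => (∑ i : Fin n, (x i ^ 2 - 1)) ^ 4)]
      simpa using ih2
    · rw [integral_fun_fst (fun x => (x ^ 2 - 1) ^ 4)]
      simpa using hμ.eighth

/-- Moments of a quadratic form. -/
theorem EntryLaw.quadratic (hμ : EntryLaw μ m) : ∀ (n : ℕ) (B : Fin n → Fin n → ℝ)
    (_ : ∀ i j, B i j = B j i),
    HasFourth (fun x : Fin n → ℝ => ∑ i, ∑ j, B i j * x i * x j - ∑ i, B i i)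
      (Measure.pi fun _ => μ) ∧
    ∫ x, (∑ i, ∑ j, B i j * x i * x j - ∑ i, B i i) ∂(Measure.pi fun _ => μ) = 0 ∧
    ∫ x, (∑ i, ∑ j, B i j * x i * x j - ∑ i, B i i) ^ 4 ∂(Measure.pi fun _ => μ)
      ≤ (400 * m ^ 2 * ∑ i, ∑ j, B i j ^ 2) ^ 2 := by
  intro n
  induction n with
  | zero => intro B _; simpa using HasFourth.const (0 : ℝ)
  | succ n ih =>
    intro B hB
    obtain ⟨ih1, ih0, ih2⟩ := ih (fun i j => B i.succ j.succ) (fun i j => hB _ _)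
    obtain ⟨l1, l2⟩ := hμ.linear n (fun i => 2 * B 0 i.succ)
    have hm := hμ.one_le
    set S : ℝ := ∑ i : Fin n, ∑ j : Fin n, B i.succ j.succ ^ 2 with hS
    set s : ℝ := ∑ i : Fin n, B 0 i.succ ^ 2 with hs
    set c : ℝ := B 0 0 with hc
    set g : (Fin n → ℝ) → ℝ := fun x =>
      ∑ i : Fin n, ∑ j : Fin n, B i.succ j.succ * x i * x j - ∑ i : Fin n, B i.succ i.succ with hg_def
    set L : (Fin n → ℝ) → ℝ := fun x => ∑ i : Fin n, 2 * B 0 i.succ * x i with hL_def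
    have hS0 : 0 ≤ S := by positivity
    have hs0 : 0 ≤ s := by positivity
    -- Exposing one more coordinate `x₀` adds `x₀ L + (x₀² - 1) c`, which has mean zero given the
    -- others. The form is thus built up as a martingale.
    have e : ∀ p : ℝ × (Fin n → ℝ),
        ∑ i, ∑ j, B i j * (Fin.cons p.1 p.2 : Fin (n + 1) → ℝ) i
            * (Fin.cons p.1 p.2 : Fin (n + 1) → ℝ) j - ∑ i, B i i
          = g p.2 + (p.1 * L p.2 + (p.1 ^ 2 - 1) * c) := by
      intro p
      simp only [Fin.sum_univ_succ, Fin.cons_zero, Fin.cons_succ, hg_def, hL_def,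
        Finset.sum_add_distrib, Finset.mul_sum]
      have h1 : ∑ i : Fin n, B i.succ 0 * p.2 i * p.1 = ∑ i : Fin n, B 0 i.succ * p.1 * p.2 i :=
        Finset.sum_congr rfl fun i _ => by rw [hB i.succ 0]; ring
      have h2 : ∑ i : Fin n, p.1 * (2 * B 0 i.succ * p.2 i)
          = 2 * ∑ i : Fin n, B 0 i.succ * p.1 * p.2 i := by
        rw [Finset.mul_sum]
        exact Finset.sum_congr rfl fun i _ => by ring
      rw [h1, h2]
      ring
    have eS : ∑ i, ∑ j, B i j ^ 2 = S + (2 * s + c ^ 2) := by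
      simp only [Fin.sum_univ_succ, Finset.sum_add_distrib]
      have h1 : ∑ i : Fin n, B i.succ 0 ^ 2 = s :=
        Finset.sum_congr rfl fun i _ => by rw [hB i.succ 0]
      rw [h1]
      ring
    rw [EntryLaw.pi_succ_hasFourth (by fun_prop), EntryLaw.pi_succ_integral,
      EntryLaw.pi_succ_integral]
    simp only [e, eS]
    have hf : HasFourth (fun p : ℝ × (Fin n → ℝ) => g p.2) (μ.prod (Measure.pi fun _ => μ)) :=
      ih1.comp_snd
    have hA : HasFourth (fun p : ℝ × (Fin n → ℝ) => p.1 * L p.2)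
        (μ.prod (Measure.pi fun _ => μ)) := hμ.hasFourth.mul_prod l1
    have hC : HasFourth (fun p : ℝ × (Fin n → ℝ) => (p.1 ^ 2 - 1) * c)
        (μ.prod (Measure.pi fun _ => μ)) :=
      hμ.hasFourth_sq_sub.mul_prod (HasFourth.const c)
    have hg := hA.add hC
    have iA0 : ∫ p : ℝ × (Fin n → ℝ), p.1 * L p.2 ∂(μ.prod (Measure.pi fun _ => μ)) = 0 := by
      rw [integral_prod_mul (μ := μ) (ν := Measure.pi fun _ : Fin n => μ) (fun x => x) L, hμ.mean,
        zero_mul]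
    have iC0 : ∫ p : ℝ × (Fin n → ℝ), (p.1 ^ 2 - 1) * c ∂(μ.prod (Measure.pi fun _ => μ)) = 0 := by
      rw [integral_prod_mul (μ := μ) (ν := Measure.pi fun _ : Fin n => μ) (fun x => x ^ 2 - 1)
        (fun _ => c), hμ.integral_sq_sub, zero_mul]
    refine ⟨hf.add hg, ?_, ?_⟩
    · rw [integral_add hf.integrable hg.integrable, integral_add hA.integrable hC.integrable,
        iA0, iC0, integral_fun_snd g, ih0]
      simp
    have bA : ∫ p : ℝ × (Fin n → ℝ), (p.1 * L p.2) ^ 4 ∂(μ.prod (Measure.pi fun _ => μ))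
        ≤ (16 * m ^ 2 * s) ^ 2 := by
      simp only [mul_pow]
      rw [integral_prod_mul (μ := μ) (ν := Measure.pi fun _ : Fin n => μ) (fun x => x ^ 4)
        (fun x => L x ^ 4)]
      have h4 : ∑ i : Fin n, (2 * B 0 i.succ) ^ 2 = 4 * s := by
        rw [hs, Finset.mul_sum]
        exact Finset.sum_congr rfl fun i _ => by ring
      rw [h4] at l2
      calc _ ≤ m ^ 2 * (4 * m * (4 * s)) ^ 2 :=
            mul_le_mul hμ.fourth l2 (integral_nonneg fun x => by positivity) (by positivity)
        _ = _ := by ring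
    have bC : ∫ p : ℝ × (Fin n → ℝ), ((p.1 ^ 2 - 1) * c) ^ 4 ∂(μ.prod (Measure.pi fun _ => μ))
        ≤ (m * c ^ 2) ^ 2 := by
      simp only [mul_pow]
      rw [integral_prod_mul (μ := μ) (ν := Measure.pi fun _ : Fin n => μ) (fun x => (x ^ 2 - 1) ^ 4)
        (fun x => c ^ 4)]
      simp only [integral_const, probReal_univ, one_smul]
      nlinarith [hμ.eighth, sq_nonneg (c ^ 2)]
    have bg : ∫ p : ℝ × (Fin n → ℝ), (p.1 * L p.2 + (p.1 ^ 2 - 1) * c) ^ 4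
        ∂(μ.prod (Measure.pi fun _ => μ)) ≤ (100 * m ^ 2 * (2 * s + c ^ 2)) ^ 2 := by
      have h := integral_mono hg.2 ((hA.2.add hC.2).const_mul 8)
        (fun p => add_pow_four_le _ _)
      refine h.trans ?_
      simp only [Pi.add_apply]
      rw [integral_const_mul, integral_add hA.2 hC.2]
      have h1 : m * c ^ 2 ≤ m ^ 2 * c ^ 2 := by
        have : m ≤ m ^ 2 := by nlinarith
        gcongr
      have h2 : (m * c ^ 2) ^ 2 ≤ (m ^ 2 * c ^ 2) ^ 2 := by gcongr
      have h3 : 0 ≤ m ^ 2 * s := by positivity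
      have h4 : 0 ≤ m ^ 2 * c ^ 2 := by positivity
      nlinarith [mul_nonneg h3 h4]
    -- The increment has squared `L⁴` norm at most `100 m² (2s + c²)`, and the factor four in the
    -- martingale inequality turns this into the constant `400`.
    have key := integral_add_pow_four_le hf hg (a := 400 * m ^ 2 * S)
      (b := 100 * m ^ 2 * (2 * s + c ^ 2)) ?_ (by positivity) (by positivity) ?_ bg
    · refine key.trans (le_of_eq ?_)
      ring
    · have i1 := integral_prod_mul (μ := μ) (ν := Measure.pi fun _ : Fin n => μ) (fun x => x)
        (fun x => g x ^ 3 * L x)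
      have i2 := integral_prod_mul (μ := μ) (ν := Measure.pi fun _ : Fin n => μ)
        (fun x => x ^ 2 - 1) (fun x => g x ^ 3 * c)
      rw [hμ.mean, zero_mul] at i1
      rw [hμ.integral_sq_sub, zero_mul] at i2
      have j1 := hf.integrable_cube_mul hA
      have j2 := hf.integrable_cube_mul hC
      simp only [mul_add]
      rw [integral_add j1 j2]
      have k1 : ∫ p : ℝ × (Fin n → ℝ), g p.2 ^ 3 * (p.1 * L p.2)
          ∂(μ.prod (Measure.pi fun _ => μ)) = 0 := by
        rw [← i1]
        exact integral_congr_ae (ae_of_all _ fun p => by ring)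
      have k2 : ∫ p : ℝ × (Fin n → ℝ), g p.2 ^ 3 * ((p.1 ^ 2 - 1) * c)
          ∂(μ.prod (Measure.pi fun _ => μ)) = 0 := by
        rw [← i2]
        exact integral_congr_ae (ae_of_all _ fun p => by ring)
      rw [k1, k2, add_zero]
    · rw [integral_fun_snd (fun x : Fin n → ℝ => g x ^ 4)]
      simpa using ih2

end

end Hopfield

end

noncomputable section

namespace Hopfield

/-! ### Resolvents of positive definite matrices -/

open Matrix

set_option linter.unusedSectionVars false

section
variable {ι : Type*} [Fintype ι] [DecidableEq ι]

theorem PosDef.quadForm_pos {M : Matrix ι ι ℝ} (hM : M.PosDef) {x : ι → ℝ} (hx : x ≠ 0) :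
    0 < x ⬝ᵥ M *ᵥ x := by
  simpa using hM.dotProduct_mulVec_pos hx

theorem PosSemidef.quadForm_nonneg {M : Matrix ι ι ℝ} (hM : M.PosSemidef) (x : ι → ℝ) :
    0 ≤ x ⬝ᵥ M *ᵥ x := by
  simpa using hM.dotProduct_mulVec_nonneg x

theorem PosDef.isSymm {M : Matrix ι ι ℝ} (hM : M.PosDef) : M.IsSymm := by
  have := hM.isHermitian
  rwa [Matrix.IsHermitian, Matrix.conjTranspose_eq_transpose_of_trivial] at this

theorem IsSymm.dotProduct_mulVec_comm {M : Matrix ι ι ℝ} (hM : M.IsSymm) (x y : ι → ℝ) :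
    x ⬝ᵥ M *ᵥ y = y ⬝ᵥ M *ᵥ x := by
  rw [dotProduct_mulVec, ← mulVec_transpose, hM.eq, dotProduct_comm]

theorem posDef_mul_inv {M : Matrix ι ι ℝ} (hM : M.PosDef) : M * M⁻¹ = 1 :=
  Matrix.mul_nonsing_inv _ ((Matrix.isUnit_iff_isUnit_det _).1 hM.isUnit)

theorem posDef_inv_mul {M : Matrix ι ι ℝ} (hM : M.PosDef) : M⁻¹ * M = 1 :=
  Matrix.nonsing_inv_mul _ ((Matrix.isUnit_iff_isUnit_det _).1 hM.isUnit)

/-- The quadratic form of the inverse as a Legendre transform. -/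
theorem PosDef.dual_le {M : Matrix ι ι ℝ} (hM : M.PosDef) (x b : ι → ℝ) :
    2 * (x ⬝ᵥ b) - x ⬝ᵥ M *ᵥ x ≤ b ⬝ᵥ M⁻¹ *ᵥ b := by
  have h := PosSemidef.quadForm_nonneg hM.posSemidef (x - M⁻¹ *ᵥ b)
  rw [mulVec_sub, mulVec_mulVec, posDef_mul_inv hM, one_mulVec, dotProduct_sub, sub_dotProduct,
    sub_dotProduct] at h
  have h1 : (M⁻¹ *ᵥ b) ⬝ᵥ M *ᵥ x = x ⬝ᵥ b := by
    rw [IsSymm.dotProduct_mulVec_comm (PosDef.isSymm hM), mulVec_mulVec, posDef_mul_inv hM, one_mulVec]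
  have h2 : (M⁻¹ *ᵥ b) ⬝ᵥ b = b ⬝ᵥ M⁻¹ *ᵥ b := dotProduct_comm _ _
  rw [h1, h2] at h
  linarith

/-- This is `PosDef.dual_le` along the line spanned by `x`, at the optimal multiple `c`. -/
theorem PosDef.cauchy_schwarz {M : Matrix ι ι ℝ} (hM : M.PosDef) (x r : ι → ℝ) :
    (x ⬝ᵥ r) ^ 2 ≤ (r ⬝ᵥ M⁻¹ *ᵥ r) * (x ⬝ᵥ M *ᵥ x) := by
  by_cases hx : x = 0
  · simp [hx]
  have hp := PosDef.quadForm_pos hM hx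
  set c := (x ⬝ᵥ r) / (x ⬝ᵥ M *ᵥ x)
  have h := PosDef.dual_le hM (c • x) r
  rw [smul_dotProduct, smul_dotProduct, mulVec_smul, dotProduct_smul] at h
  simp only [smul_eq_mul] at h
  have e : c * (x ⬝ᵥ M *ᵥ x) = x ⬝ᵥ r := div_mul_cancel₀ _ hp.ne'
  rw [e] at h
  have : c * (x ⬝ᵥ r) ≤ r ⬝ᵥ M⁻¹ *ᵥ r := by linarith
  calc (x ⬝ᵥ r) ^ 2 = c * (x ⬝ᵥ r) * (x ⬝ᵥ M *ᵥ x) := by rw [mul_right_comm, e, sq]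
    _ ≤ _ := by gcongr

theorem quadForm_vecMulVec (x r : ι → ℝ) : x ⬝ᵥ (vecMulVec r r) *ᵥ x = (x ⬝ᵥ r) ^ 2 := by
  rw [vecMulVec_mulVec]
  simp [dotProduct_comm r x, sq, dotProduct_smul]

theorem isHermitian_vecMulVec (r : ι → ℝ) : (vecMulVec r r).IsHermitian := by
  ext i j
  simp [vecMulVec_apply, mul_comm]

theorem PosDef.sub_vecMulVec {M : Matrix ι ι ℝ} (hM : M.PosDef) {r : ι → ℝ}
    (hr : r ⬝ᵥ M⁻¹ *ᵥ r < 1) : (M - vecMulVec r r).PosDef := by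
  refine PosDef.of_dotProduct_mulVec_pos (hM.isHermitian.sub (isHermitian_vecMulVec r)) fun {x} hx => ?_
  have hp := PosDef.quadForm_pos hM hx
  simp only [star_trivial]
  rw [sub_mulVec, dotProduct_sub, quadForm_vecMulVec]
  nlinarith [PosDef.cauchy_schwarz hM x r]

/-- Converse of `PosDef.sub_vecMulVec`. Testing positivity on `M⁻¹ r` gives `Q - Q² > 0` for `Q = r
⬝ᵥ M⁻¹ *ᵥ r`. -/
theorem PosDef.quadForm_lt_one {M : Matrix ι ι ℝ} (hM : M.PosDef) {r : ι → ℝ}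
    (h : (M - vecMulVec r r).PosDef) : r ⬝ᵥ M⁻¹ *ᵥ r < 1 := by
  by_cases hr : r = 0
  · simp [hr]
  have hx : M⁻¹ *ᵥ r ≠ 0 := by
    intro h0
    apply hr
    rw [← one_mulVec r, ← posDef_mul_inv hM, ← mulVec_mulVec, h0, mulVec_zero]
  have hp := PosDef.quadForm_pos h hx
  have hq := PosDef.quadForm_pos hM.inv hr
  rw [sub_mulVec, dotProduct_sub, quadForm_vecMulVec, mulVec_mulVec, posDef_mul_inv hM, one_mulVec,
    dotProduct_comm (M⁻¹ *ᵥ r) r] at hp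
  nlinarith

/-- Sherman–Morrison formula, checked by multiplying out. -/
theorem PosDef.inv_sub_vecMulVec {M : Matrix ι ι ℝ} (hM : M.PosDef) {r : ι → ℝ}
    (hr : r ⬝ᵥ M⁻¹ *ᵥ r < 1) :
    (M - vecMulVec r r)⁻¹
      = M⁻¹ + (1 - r ⬝ᵥ M⁻¹ *ᵥ r)⁻¹ • vecMulVec (M⁻¹ *ᵥ r) (M⁻¹ *ᵥ r) := by
  refine inv_eq_right_inv ?_
  have h1 : M * vecMulVec (M⁻¹ *ᵥ r) (M⁻¹ *ᵥ r) = vecMulVec r (M⁻¹ *ᵥ r) := by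
    rw [mul_vecMulVec, mulVec_mulVec, posDef_mul_inv hM, one_mulVec]
  have h2 : vecMulVec r r * M⁻¹ = vecMulVec r (M⁻¹ *ᵥ r) := by
    rw [vecMulVec_mul, ← mulVec_transpose, (PosDef.isSymm hM.inv).eq]
  have h3 : vecMulVec r r * vecMulVec (M⁻¹ *ᵥ r) (M⁻¹ *ᵥ r)
      = (r ⬝ᵥ M⁻¹ *ᵥ r) • vecMulVec r (M⁻¹ *ᵥ r) := by
    rw [vecMulVec_mul_vecMulVec, vecMulVec_smul]
  have h4 : 1 - r ⬝ᵥ M⁻¹ *ᵥ r ≠ 0 := by linarith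
  rw [sub_mul, mul_add, mul_add, mul_smul_comm, mul_smul_comm, h1, h2, h3, posDef_mul_inv hM]
  have : (1 - r ⬝ᵥ M⁻¹ *ᵥ r)⁻¹ - 1 - (1 - r ⬝ᵥ M⁻¹ *ᵥ r)⁻¹ * (r ⬝ᵥ M⁻¹ *ᵥ r) = 0 := by
    field_simp
    ring
  rw [smul_smul]
  calc _ = 1 + ((1 - r ⬝ᵥ M⁻¹ *ᵥ r)⁻¹ - 1 - (1 - r ⬝ᵥ M⁻¹ *ᵥ r)⁻¹ * (r ⬝ᵥ M⁻¹ *ᵥ r))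
          • vecMulVec r (M⁻¹ *ᵥ r) := by module
    _ = 1 := by rw [this, zero_smul, add_zero]

theorem quadForm_pow_inv {M : Matrix ι ι ℝ} (hM : M.PosDef) (r : ι → ℝ) (B : Matrix ι ι ℝ) :
    (M⁻¹ *ᵥ r) ⬝ᵥ B *ᵥ (M⁻¹ *ᵥ r) = r ⬝ᵥ (M⁻¹ * B * M⁻¹) *ᵥ r := by
  rw [← mulVec_mulVec, ← mulVec_mulVec, dotProduct_mulVec r M⁻¹, ← mulVec_transpose,
    (PosDef.isSymm hM.inv).eq]

theorem PosDef.trace_inv_sub_vecMulVec {M : Matrix ι ι ℝ} (hM : M.PosDef) {r : ι → ℝ}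
    (hr : r ⬝ᵥ M⁻¹ *ᵥ r < 1) :
    (M - vecMulVec r r)⁻¹.trace
      = M⁻¹.trace + (1 - r ⬝ᵥ M⁻¹ *ᵥ r)⁻¹ * (r ⬝ᵥ (M⁻¹ ^ 2) *ᵥ r) := by
  have h := quadForm_pow_inv hM r 1
  rw [one_mulVec, mul_one] at h
  rw [PosDef.inv_sub_vecMulVec hM hr, trace_add, trace_smul, trace_vecMulVec, sq, ← h]
  rfl

theorem PosDef.trace_inv_sq_sub_vecMulVec {M : Matrix ι ι ℝ} (hM : M.PosDef) {r : ι → ℝ}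
    (hr : r ⬝ᵥ M⁻¹ *ᵥ r < 1) :
    ((M - vecMulVec r r)⁻¹ ^ 2).trace
      = (M⁻¹ ^ 2).trace + 2 * (1 - r ⬝ᵥ M⁻¹ *ᵥ r)⁻¹ * (r ⬝ᵥ (M⁻¹ ^ 3) *ᵥ r)
        + ((1 - r ⬝ᵥ M⁻¹ *ᵥ r)⁻¹ * (r ⬝ᵥ (M⁻¹ ^ 2) *ᵥ r)) ^ 2 := by
  have h := quadForm_pow_inv hM r 1
  rw [one_mulVec, mul_one] at h
  have h' := quadForm_pow_inv hM r M⁻¹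
  rw [PosDef.inv_sub_vecMulVec hM hr]
  set c := (1 - r ⬝ᵥ M⁻¹ *ᵥ r)⁻¹
  set a := M⁻¹ *ᵥ r with ha
  set G := M⁻¹
  have e1 : (G + c • vecMulVec a a) ^ 2
      = G ^ 2 + c • (G * vecMulVec a a) + c • (vecMulVec a a * G)
        + (c * c) • (vecMulVec a a * vecMulVec a a) := by
    rw [sq, add_mul, mul_add, mul_add, mul_smul_comm, smul_mul_assoc, smul_mul_smul_comm, sq]
    abel
  have e2 : (G * vecMulVec a a).trace = a ⬝ᵥ G *ᵥ a := by
    rw [mul_vecMulVec, trace_vecMulVec, dotProduct_comm]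
  have e3 : (vecMulVec a a * G).trace = a ⬝ᵥ G *ᵥ a := by rw [trace_mul_comm, e2]
  have e4 : (vecMulVec a a * vecMulVec a a).trace = (a ⬝ᵥ a) ^ 2 := by
    rw [vecMulVec_mul_vecMulVec, trace_vecMulVec, dotProduct_smul, smul_eq_mul, sq]
  rw [e1, trace_add, trace_add, trace_add, trace_smul, trace_smul, trace_smul, e2, e3, e4, h, h',
    ← sq, ← pow_succ]
  simp only [smul_eq_mul]
  ring

/-- The traces of powers of the shifted inverse as sums over eigenvalues. -/
theorem PosDef.exists_eigenvalues {M : Matrix ι ι ℝ} (hM : M.PosDef) :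
    ∃ m : ι → ℝ, (∀ i, 0 < m i) ∧ ∀ d : ℝ, 0 ≤ d → ∀ p : ℕ,
      (((M + d • (1 : Matrix ι ι ℝ))⁻¹) ^ p).trace = ∑ i, ((m i + d)⁻¹) ^ p := by
  refine ⟨hM.isHermitian.eigenvalues, hM.eigenvalues_pos, fun d hd p => ?_⟩
  set m := hM.isHermitian.eigenvalues with hm
  have hsp := hM.isHermitian.spectral_theorem
  rw [Unitary.conjStarAlgAut_apply] at hsp
  set U : Matrix ι ι ℝ := (hM.isHermitian.eigenvectorUnitary : Matrix ι ι ℝ)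
  have hU1 : star U * U = 1 := Unitary.coe_star_mul_self _
  have hU2 : U * star U = 1 := Unitary.coe_mul_star_self _
  have e1 : M + d • (1 : Matrix ι ι ℝ) = U * diagonal (fun i => m i + d) * star U := by
    have : diagonal (fun i => m i + d) = diagonal m + d • (1 : Matrix ι ι ℝ) := by
      rw [smul_one_eq_diagonal, diagonal_add]
    rw [this, mul_add, add_mul, mul_smul_comm, mul_one, smul_mul_assoc, hU2]
    congr 1
  have hne : ∀ i, m i + d ≠ 0 := fun i => by
    have := hM.eigenvalues_pos i
    positivity
  have e2 : (M + d • (1 : Matrix ι ι ℝ))⁻¹ = U * diagonal (fun i => (m i + d)⁻¹) * star U := by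
    refine inv_eq_right_inv ?_
    rw [e1]
    calc _ = U * diagonal (fun i => m i + d) * (star U * U) * diagonal (fun i => (m i + d)⁻¹)
          * star U := by simp only [mul_assoc]
      _ = 1 := by
        rw [hU1, mul_one, mul_assoc U, diagonal_mul_diagonal]
        simp [hne, hU2]
  have e3 : ((M + d • (1 : Matrix ι ι ℝ))⁻¹) ^ p
      = U * diagonal (fun i => ((m i + d)⁻¹) ^ p) * star U := by
    rw [e2]
    induction p with
    | zero => simp [hU2]
    | succ p ih =>
      rw [pow_succ, ih]
      calc _ = U * diagonal (fun i => ((m i + d)⁻¹) ^ p) * (star U * U)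
            * diagonal (fun i => (m i + d)⁻¹) * star U := by simp only [mul_assoc]
        _ = _ := by
          rw [hU1, mul_one, mul_assoc U, diagonal_mul_diagonal]
          simp only [pow_succ]
  rw [e3, trace_mul_cycle, hU1, one_mul, trace_diagonal]

theorem PosDef.add_smul_one {M : Matrix ι ι ℝ} (hM : M.PosDef) {d : ℝ} (hd : 0 ≤ d) :
    (M + d • (1 : Matrix ι ι ℝ)).PosDef :=
  hM.add_posSemidef (PosSemidef.one.smul hd)

/-- Comparison of the traces of the powers of `M⁻¹` and `(M + d)⁻¹`. -/
theorem PosDef.trace_shift {M : Matrix ι ι ℝ} (hM : M.PosDef) {d : ℝ} (hd : 0 ≤ d) :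
    let H := (M + d • (1 : Matrix ι ι ℝ))⁻¹
    H.trace ≤ M⁻¹.trace - d * (H ^ 2).trace ∧
    (H ^ 2).trace ≤ (M⁻¹ ^ 2).trace - 2 * d * (H ^ 3).trace ∧
    (H ^ 4).trace ≤ √((H ^ 2).trace) * (H ^ 3).trace ∧
    (H ^ 4).trace ≤ (H ^ 2).trace ^ 2 ∧
    0 ≤ H.trace ∧ 0 ≤ (H ^ 2).trace ∧ 0 ≤ (H ^ 3).trace := by
  intro H
  obtain ⟨m, hm, h⟩ := PosDef.exists_eigenvalues hM
  have e0 : ∀ p, (M⁻¹ ^ p).trace = ∑ i, ((m i)⁻¹) ^ p := fun p => by simpa using h 0 le_rfl p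
  have e1 : ∀ p, (H ^ p).trace = ∑ i, ((m i + d)⁻¹) ^ p := h d hd
  have f1 := e1 1
  have f0 := e0 1
  rw [pow_one] at f1 f0
  have hp : ∀ i, 0 < (m i + d)⁻¹ := fun i => by have := hm i; positivity
  -- The resolvent identity on each eigenvalue; every claim below is a scalar inequality summed over
  -- the spectrum.
  have hg : ∀ i, (m i)⁻¹ = (m i + d)⁻¹ + d * ((m i + d)⁻¹ * (m i)⁻¹) := fun i => by
    have := hm i
    field_simp
  have hle : ∀ i, (m i + d)⁻¹ ≤ (m i)⁻¹ := fun i => by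
    have := hm i
    gcongr
    linarith
  refine ⟨?_, ?_, ?_, ?_, ?_, ?_, ?_⟩
  · rw [f1, f0, e1, Finset.mul_sum, ← Finset.sum_sub_distrib]
    refine Finset.sum_le_sum fun i _ => ?_
    have := hg i
    have h2 : d * ((m i + d)⁻¹) ^ 2 ≤ d * ((m i + d)⁻¹ * (m i)⁻¹) := by
      rw [sq]
      exact mul_le_mul_of_nonneg_left (mul_le_mul_of_nonneg_left (hle i) (hp i).le) hd
    simp only [pow_one]
    linarith
  · rw [e1, e1, e0, Finset.mul_sum, ← Finset.sum_sub_distrib]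
    refine Finset.sum_le_sum fun i _ => ?_
    have hpi := hp i
    have h2 : d * ((m i + d)⁻¹) ^ 2 ≤ d * ((m i + d)⁻¹ * (m i)⁻¹) := by
      rw [sq]
      exact mul_le_mul_of_nonneg_left (mul_le_mul_of_nonneg_left (hle i) (hp i).le) hd
    have h3 : (m i + d)⁻¹ + d * ((m i + d)⁻¹) ^ 2 ≤ (m i)⁻¹ := by rw [hg i]; gcongr 
    have h4 : ((m i + d)⁻¹ + d * ((m i + d)⁻¹) ^ 2) ^ 2 ≤ ((m i)⁻¹) ^ 2 := by gcongr
    nlinarith [sq_nonneg (d * ((m i + d)⁻¹) ^ 2)]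
  · rw [e1 4, e1 3, Finset.mul_sum]
    refine Finset.sum_le_sum fun i _ => ?_
    have hpi := hp i
    have : (m i + d)⁻¹ ≤ √((H ^ 2).trace) := by
      refine Real.le_sqrt_of_sq_le ?_
      rw [e1]
      exact Finset.single_le_sum (f := fun i => ((m i + d)⁻¹) ^ 2) (fun j _ => by positivity)
        (Finset.mem_univ i)
    calc _ = (m i + d)⁻¹ * ((m i + d)⁻¹) ^ 3 := by ring
      _ ≤ _ := by gcongr
  · rw [e1 4, e1 2, sq, Finset.sum_mul]
    refine Finset.sum_le_sum fun i _ => ?_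
    have : ((m i + d)⁻¹) ^ 2 ≤ ∑ j, ((m j + d)⁻¹) ^ 2 :=
      Finset.single_le_sum (f := fun i => ((m i + d)⁻¹) ^ 2) (fun j _ => by positivity)
        (Finset.mem_univ i)
    calc _ = ((m i + d)⁻¹) ^ 2 * ((m i + d)⁻¹) ^ 2 := by ring
      _ ≤ _ := by gcongr
  · rw [f1]; exact Finset.sum_nonneg fun i _ => by have := hp i; positivity
  · rw [e1]; positivity
  · rw [e1]; exact Finset.sum_nonneg fun i _ => by have := hp i; positivity

/-- Reduces trace comparisons to quadratic forms at basis vectors, where the variational formula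
`PosDef.dual_le` applies. -/
theorem trace_inv_diag (M : Matrix ι ι ℝ) :
    M.trace = ∑ i, (Pi.single i 1 : ι → ℝ) ⬝ᵥ M *ᵥ (Pi.single i 1) := by
  simp [Matrix.trace]

/-- The trace of the inverse is antitone. -/
theorem PosDef.trace_inv_le {M P : Matrix ι ι ℝ} (hM : M.PosDef) (hP : P.PosDef)
    (h : (P - M).PosSemidef) : P⁻¹.trace ≤ M⁻¹.trace := by
  rw [trace_inv_diag P⁻¹, trace_inv_diag M⁻¹]
  refine Finset.sum_le_sum fun i _ => ?_
  set b : ι → ℝ := Pi.single i 1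
  -- The maximiser of the dual problem for `P` is used as a trial vector in the one for `M`.
  have h1 := PosDef.dual_le hM (P⁻¹ *ᵥ b) b
  have h2 := PosSemidef.quadForm_nonneg h (P⁻¹ *ᵥ b)
  rw [sub_mulVec, dotProduct_sub, mulVec_mulVec, posDef_mul_inv hP, one_mulVec] at h2
  rw [dotProduct_comm b]
  linarith

/-- Passing to a principal submatrix decreases the trace of the inverse. -/
theorem PosDef.trace_inv_submatrix_le {κ : Type*} [Fintype κ] [DecidableEq κ] {M : Matrix ι ι ℝ}
    (hM : M.PosDef) {e : κ → ι} (he : Function.Injective e) :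
    (M.submatrix e e)⁻¹.trace ≤ M⁻¹.trace := by
  have hS : (M.submatrix e e).PosDef := hM.submatrix he
  set E : Matrix κ ι ℝ := (1 : Matrix ι ι ℝ).submatrix e id with hE
  have hsub : M.submatrix e e = E * M * Eᵀ := by
    ext i j
    simp [hE, Matrix.mul_apply, Matrix.one_apply]
  have hq : ∀ x : κ → ℝ, x ⬝ᵥ (M.submatrix e e) *ᵥ x = (x ᵥ* E) ⬝ᵥ M *ᵥ (x ᵥ* E) := by
    intro x
    rw [hsub, ← mulVec_mulVec, ← mulVec_mulVec, dotProduct_mulVec x E, mulVec_transpose]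
  have hb : ∀ (x : κ → ℝ) (i : κ), (x ᵥ* E) ⬝ᵥ Pi.single (e i) 1 = x ⬝ᵥ Pi.single i 1 := by
    intro x i
    simp only [dotProduct_single, mul_one]
    rw [hE]
    simp [Matrix.vecMul, dotProduct, Matrix.one_apply, he.eq_iff]
  rw [trace_inv_diag (M.submatrix e e)⁻¹, trace_inv_diag M⁻¹]
  have step : ∀ i : κ, (Pi.single i 1 : κ → ℝ) ⬝ᵥ (M.submatrix e e)⁻¹ *ᵥ (Pi.single i 1)
      ≤ (Pi.single (e i) 1 : ι → ℝ) ⬝ᵥ M⁻¹ *ᵥ (Pi.single (e i) 1) := by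
    intro i
    set b : κ → ℝ := Pi.single i 1
    -- The maximiser for the submatrix, extended by zero, is a trial vector for the full matrix.
    have h1 := PosDef.dual_le hM (((M.submatrix e e)⁻¹ *ᵥ b) ᵥ* E) (Pi.single (e i) 1)
    rw [hb, ← hq, mulVec_mulVec, posDef_mul_inv hS, one_mulVec] at h1
    rw [dotProduct_comm b]
    linarith
  refine (Finset.sum_le_sum fun i _ => step i).trans ?_
  rw [← Finset.sum_image (s := Finset.univ) (g := e)
    (f := fun j => (Pi.single j 1 : ι → ℝ) ⬝ᵥ M⁻¹ *ᵥ (Pi.single j 1)) (fun a _ b _ h => he h)]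
  refine Finset.sum_le_sum_of_subset_of_nonneg (Finset.subset_univ _) fun i _ _ => ?_
  exact PosSemidef.quadForm_nonneg hM.inv.posSemidef _

end

/-- The law of a random vector whose quadratic forms have the first two moments of independent
standardised entries, with fourth moments bounded by `K`. -/
structure QuadLaw {n : ℕ} (ν : Measure (Fin n → ℝ)) (K : ℝ) : Prop where
  hasFourth : ∀ B : Matrix (Fin n) (Fin n) ℝ, B.IsSymm →
    HasFourth (fun r => r ⬝ᵥ B *ᵥ r - B.trace) ν
  mean : ∀ B : Matrix (Fin n) (Fin n) ℝ, B.IsSymm → ∫ r, (r ⬝ᵥ B *ᵥ r - B.trace) ∂ν = 0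
  sq : ∀ B : Matrix (Fin n) (Fin n) ℝ, B.IsSymm →
    ∫ r, (r ⬝ᵥ B *ᵥ r - B.trace) ^ 2 ∂ν ≤ K * (B ^ 2).trace
  fourth : ∀ B : Matrix (Fin n) (Fin n) ℝ, B.IsSymm →
    ∫ r, (r ⬝ᵥ B *ᵥ r - B.trace) ^ 4 ∂ν ≤ K * (B ^ 2).trace ^ 2

theorem EntryLaw.quadLaw {μ : Measure ℝ} [IsProbabilityMeasure μ] {m : ℝ} (hμ : EntryLaw μ m)
    (n : ℕ) : QuadLaw (Measure.pi fun _ : Fin n => μ) ((400 * m ^ 2) ^ 2) := by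
  have e : ∀ (B : Matrix (Fin n) (Fin n) ℝ) (r : Fin n → ℝ),
      r ⬝ᵥ B *ᵥ r - B.trace = ∑ i, ∑ j, B i j * r i * r j - ∑ i, B i i := by
    intro B r
    simp only [dotProduct, mulVec, Finset.mul_sum, Matrix.trace, Matrix.diag]
    congr 1
    exact Finset.sum_congr rfl fun i _ => Finset.sum_congr rfl fun j _ => by ring
  have et : ∀ B : Matrix (Fin n) (Fin n) ℝ, B.IsSymm → (B ^ 2).trace = ∑ i, ∑ j, B i j ^ 2 := by
    intro B hB
    simp only [sq B, Matrix.trace, Matrix.diag, Matrix.mul_apply]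
    exact Finset.sum_congr rfl fun i _ => Finset.sum_congr rfl fun j _ => by rw [sq, hB.apply i j]
  have hm := hμ.one_le
  have h4 : ∀ B : Matrix (Fin n) (Fin n) ℝ, B.IsSymm →
      ∫ r, (r ⬝ᵥ B *ᵥ r - B.trace) ^ 4 ∂(Measure.pi fun _ : Fin n => μ)
        ≤ (400 * m ^ 2 * (B ^ 2).trace) ^ 2 := by
    intro B hB
    rw [et B hB]
    simp only [e]
    exact (hμ.quadratic n B fun i j => hB.apply j i).2.2
  have h1 : ∀ B : Matrix (Fin n) (Fin n) ℝ, B.IsSymm →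
      HasFourth (fun r => r ⬝ᵥ B *ᵥ r - B.trace) (Measure.pi fun _ : Fin n => μ) := by
    intro B hB
    simp only [e]
    exact (hμ.quadratic n B fun i j => hB.apply j i).1
  refine ⟨h1, fun B hB => ?_, fun B hB => ?_, fun B hB => ?_⟩
  · simp only [e]
    exact (hμ.quadratic n B fun i j => hB.apply j i).2.1
  · have ht : 0 ≤ (B ^ 2).trace := by rw [et B hB]; positivity
    -- The second moment comes from the fourth by Jensen, with constant `400 m²`. This is at least
    -- one, so its square serves both bounds.
    have h := ((h1 B hB).sq_integral_sq_le).trans (h4 B hB)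
    have h' := abs_le_of_sq_le_sq h (by positivity)
    refine (le_of_abs_le h').trans ?_
    have : (400 * m ^ 2) ≤ (400 * m ^ 2) ^ 2 := le_self_pow₀ (by nlinarith) two_ne_zero
    gcongr
  · refine (h4 B hB).trans (le_of_eq ?_)
    ring

end Hopfield

end

noncomputable section

namespace Hopfield

/-! ### The barrier argument for the upper edge -/

open Matrix

set_option linter.unusedSectionVars false

/-- `M` is positive definite and its inverse has trace at most `c`. -/
def BarrierBound {ι : Type*} [Fintype ι] [DecidableEq ι] (c : ℝ) (M : Matrix ι ι ℝ) : Prop :=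
  M.PosDef ∧ M⁻¹.trace ≤ c

section
variable {ι : Type*} [Fintype ι] [DecidableEq ι]

/-- The trace of `M⁻¹` dominates its norm. This turns a trace bound into a quantitative lower bound
on `M`, a closed condition. -/
theorem PosDef.dotProduct_self_le {M : Matrix ι ι ℝ} (hM : M.PosDef) (x : ι → ℝ) :
    x ⬝ᵥ x ≤ M⁻¹.trace * (x ⬝ᵥ M *ᵥ x) := by
  rw [trace_inv_diag M⁻¹, Finset.sum_mul]
  refine Finset.sum_le_sum fun i _ => ?_
  have h := PosDef.cauchy_schwarz hM x (Pi.single i 1)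
  rwa [dotProduct_single, mul_one, sq] at h

/-- Inversion is discontinuous at singular matrices, but `det⁻¹ • adjugate` is measurable everywhere
and agrees with the conventional inverse. -/
theorem measurable_trace_inv {E : Type*} [MeasurableSpace E] {f : E → Matrix ι ι ℝ}
    (hf : ∀ i j, Measurable fun x => f x i j) : Measurable fun x => (f x)⁻¹.trace := by
  have h1 : Measurable fun A : ι → ι → ℝ => (Matrix.of A).det :=
    (Continuous.matrix_det (by fun_prop)).measurable
  have h2 : Measurable fun A : ι → ι → ℝ => (Matrix.of A).adjugate.trace :=
    (Continuous.matrix_trace (Continuous.matrix_adjugate (by fun_prop))).measurable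
  have h3 : Measurable fun x => (fun i j => f x i j : ι → ι → ℝ) :=
    measurable_pi_lambda _ fun i => measurable_pi_lambda _ fun j => hf i j
  have e : (fun x => (f x)⁻¹.trace)
      = fun x => (Matrix.of (fun i j => f x i j)).det⁻¹
        * (Matrix.of (fun i j => f x i j)).adjugate.trace := by
    funext x
    rw [Matrix.inv_def, trace_smul, Ring.inverse_eq_inv']
    rfl
  rw [e]
  exact (h1.comp h3).inv.mul (h2.comp h3)

/-- The condition ranges over uncountably many `v`, so measurability is obtained from closedness in
the matrix entries. -/
theorem measurableSet_forall_quadForm {E : Type*} [MeasurableSpace E] {f : E → Matrix ι ι ℝ}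
    (hf : ∀ i j, Measurable fun x => f x i j) (c : ℝ) :
    MeasurableSet {x | (f x).IsHermitian ∧ ∀ v : ι → ℝ, v ⬝ᵥ v ≤ c * (v ⬝ᵥ f x *ᵥ v)} := by
  have h3 : Measurable fun x => (fun i j => f x i j : ι → ι → ℝ) :=
    measurable_pi_lambda _ fun i => measurable_pi_lambda _ fun j => hf i j
  have hc : IsClosed {A : ι → ι → ℝ | (Matrix.of A).IsHermitian ∧
      ∀ v : ι → ℝ, v ⬝ᵥ v ≤ c * (v ⬝ᵥ Matrix.of A *ᵥ v)} := by
    have e : {A : ι → ι → ℝ | (Matrix.of A).IsHermitian ∧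
        ∀ v : ι → ℝ, v ⬝ᵥ v ≤ c * (v ⬝ᵥ Matrix.of A *ᵥ v)}
        = (⋂ (i) (j), {A : ι → ι → ℝ | A j i = A i j})
          ∩ ⋂ v : ι → ℝ, {A | v ⬝ᵥ v ≤ c * (v ⬝ᵥ Matrix.of A *ᵥ v)} := by
      ext A
      rw [mem_inter_iff, mem_ofPred_eq, Matrix.IsHermitian.ext_iff]
      simp
    rw [e]
    refine (isClosed_iInter fun i => isClosed_iInter fun j =>
      isClosed_eq (by fun_prop) (by fun_prop)).inter (isClosed_iInter fun v => ?_)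
    refine isClosed_le continuous_const (continuous_const.mul ?_)
    exact continuous_const.dotProduct 
      (Continuous.matrix_mulVec (A := fun A : ι → ι → ℝ => Matrix.of A) continuous_id continuous_const)
  exact h3 hc.measurableSet

/-- In the presence of the trace bound, positive definiteness is equivalent to the closed condition
of `measurableSet_forall_quadForm`. -/
theorem measurableSet_barrierBound {E : Type*} [MeasurableSpace E] {f : E → Matrix ι ι ℝ}
    (hf : ∀ i j, Measurable fun x => f x i j) {c : ℝ} (hc : 0 < c) :
    MeasurableSet {x | BarrierBound c (f x)} := by
  have e : {x | BarrierBound c (f x)}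
      = {x | (f x).IsHermitian ∧ ∀ v : ι → ℝ, v ⬝ᵥ v ≤ c * (v ⬝ᵥ f x *ᵥ v)}
        ∩ {x | (f x)⁻¹.trace ≤ c} := by
    ext x
    constructor
    · rintro ⟨h1, h2⟩
      refine ⟨⟨h1.isHermitian, fun v => (PosDef.dotProduct_self_le h1 v).trans ?_⟩, h2⟩
      exact mul_le_mul_of_nonneg_right h2 (PosSemidef.quadForm_nonneg h1.posSemidef v)
    · rintro ⟨⟨h1, h2⟩, h3⟩
      refine ⟨PosDef.of_dotProduct_mulVec_pos h1 fun {v} hv => ?_, h3⟩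
      have h4 : 0 < v ⬝ᵥ v := by
        simpa using (dotProduct_star_self_pos_iff (v := v)).2 hv
      have h5 := h2 v
      simp only [star_trivial]
      by_contra hcon
      nlinarith
  rw [e]
  exact (measurableSet_forall_quadForm hf c).inter
    (measurableSet_le (measurable_trace_inv hf) measurable_const)

end

/-- The constants of the barrier argument. -/
structure BarrierData (φ ε κ δ K y₀ y₁ : ℝ) : Prop where
  φ_pos : 0 < φ
  ε_pos : 0 < ε
  lt_one : φ + 2 * ε < 1
  -- Bounds the Sherman–Morrison factor `(1 - Q)⁻¹` as long as `Q ≤ φ + 2ε`; the shift `δ` exceeds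
  -- it by the factor `1 + ε`.
  κ_eq : κ = (1 - (φ + 2 * ε))⁻¹
  δ_eq : δ = (1 + ε) * κ
  K_nonneg : 0 ≤ K
  y₀_pos : 0 < y₀
  -- A ceiling for `tr M⁻²`, whose allowed growth is `exp (κ² s)`; on surviving paths the
  -- accumulated `s` never exceeds `(φ + ε) / (ε κ)`.
  y₁_eq : y₁ = y₀ * Real.exp (κ ^ 2 * ((φ + ε) / (ε * κ)))
  small : κ * K * √y₁ ≤ 2 * ε

/-- The error committed in one step of the barrier argument. -/
def barrierError (ε κ K y₁ : ℝ) : ℝ := (κ ^ 2 / ε ^ 2 + 1 / ε ^ 4) * (K * y₁ ^ 2)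

/-- The deterministic estimate behind one step of the barrier argument. -/
theorem barrier_step_integral {φ ε κ δ K y₀ y₁ : ℝ} (hd : BarrierData φ ε κ δ K y₀ y₁)
    {Y t₂ t₃ t₄ s D v w C : ℝ} (h1 : t₂ ≤ Y - 2 * δ * t₃) (h2 : t₄ ≤ √t₂ * t₃) (h3 : t₄ ≤ t₂ ^ 2)
    (ht2 : 0 ≤ t₂) (ht3 : 0 ≤ t₃) (hY : Y ≤ y₁) (hv : v ≤ K * t₄) (hw : w ≤ K * t₂ ^ 2) :
    D ^ 2 / ε ^ 2 + κ ^ 2 * v / ε ^ 2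
      + (t₂ + 2 * κ * t₃ + κ ^ 2 * (t₂ ^ 2 + v)) * (Real.exp (-(κ ^ 2 * (s + t₂))) / y₀) + C
      + w / ε ^ 4
      ≤ D ^ 2 / ε ^ 2 + Y * Real.exp (-(κ ^ 2 * s)) / y₀ + C + barrierError ε κ K y₁ := by
  have hε := hd.ε_pos
  have hK := hd.K_nonneg
  have hy := hd.y₀_pos
  have hκ : 0 < κ := by
    rw [hd.κ_eq]
    have := hd.lt_one
    exact inv_pos.2 (by linarith)
  have hδ : 0 < δ := by rw [hd.δ_eq]; positivity
  have htY : t₂ ≤ Y := by nlinarith [mul_nonneg hδ.le ht3]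
  have hty : t₂ ≤ y₁ := htY.trans hY
  have hv' : v ≤ K * y₁ ^ 2 := hv.trans (by gcongr; exact h3.trans (by gcongr))
  have hw' : w ≤ K * y₁ ^ 2 := hw.trans (by gcongr)
  have e1 : κ ^ 2 * v / ε ^ 2 + w / ε ^ 4 ≤ barrierError ε κ K y₁ := by
    unfold barrierError
    have a1 : κ ^ 2 * v / ε ^ 2 ≤ κ ^ 2 * (K * y₁ ^ 2) / ε ^ 2 := by gcongr
    have a2 : w / ε ^ 4 ≤ (K * y₁ ^ 2) / ε ^ 4 := by gcongr
    calc _ ≤ κ ^ 2 * (K * y₁ ^ 2) / ε ^ 2 + (K * y₁ ^ 2) / ε ^ 4 := add_le_add a1 a2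
      _ = _ := by ring
  -- Up to the growth factor, `tr M⁻²` is a supermartingale. The shift gains `2δ t₃ = 2κ t₃ + 2εκ
  -- t₃`, which pays for the drift and, through `small`, for the variance `κ² v`. The remaining `κ²
  -- t₂²` is absorbed by `exp (κ² t₂)`.
  have e2 : t₂ + 2 * κ * t₃ + κ ^ 2 * (t₂ ^ 2 + v) ≤ Y * Real.exp (κ ^ 2 * t₂) := by
    have b1 : v ≤ K * (√y₁ * t₃) := hv.trans (by gcongr; exact h2.trans (by gcongr))
    have b2 : κ ^ 2 * v ≤ κ * (2 * ε) * t₃ := by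
      calc κ ^ 2 * v ≤ κ ^ 2 * (K * (√y₁ * t₃)) := by gcongr
        _ = κ * (κ * K * √y₁) * t₃ := by ring
        _ ≤ _ := mul_le_mul_of_nonneg_right (mul_le_mul_of_nonneg_left hd.small hκ.le) ht3
    have b3 : κ ^ 2 * t₂ + 1 ≤ Real.exp (κ ^ 2 * t₂) := Real.add_one_le_exp _
    have b4 : 0 ≤ Y := ht2.trans htY
    have b5 : κ ^ 2 * t₂ ^ 2 ≤ κ ^ 2 * t₂ * Y := by
      rw [sq t₂, ← mul_assoc]; gcongr
    have b6 : Y * (κ ^ 2 * t₂ + 1) ≤ Y * Real.exp (κ ^ 2 * t₂) := by gcongr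
    rw [hd.δ_eq] at h1
    nlinarith
  have e3 : (t₂ + 2 * κ * t₃ + κ ^ 2 * (t₂ ^ 2 + v)) * (Real.exp (-(κ ^ 2 * (s + t₂))) / y₀)
      ≤ Y * Real.exp (-(κ ^ 2 * s)) / y₀ := by
    calc _ ≤ Y * Real.exp (κ ^ 2 * t₂) * (Real.exp (-(κ ^ 2 * (s + t₂))) / y₀) := by gcongr
      _ = Y * (Real.exp (κ ^ 2 * t₂) * Real.exp (-(κ ^ 2 * (s + t₂)))) / y₀ := by ring
      _ = _ := by rw [← Real.exp_add]; ring_nf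
  linarith

/-- One step of the barrier: either the quadratic form deviates or the potentials are updated. -/
theorem barrier_update {n : ℕ} {φ ε κ δ K y₀ y₁ : ℝ} (hd : BarrierData φ ε κ δ K y₀ y₁)
    {M : Matrix (Fin n) (Fin n) ℝ} (hM : M.PosDef) (r : Fin n → ℝ) {D s : ℝ}
    (hX : M⁻¹.trace ≤ φ + D - ε * κ * s) :
    let H := (M + δ • (1 : Matrix (Fin n) (Fin n) ℝ))⁻¹
    r ⬝ᵥ H *ᵥ r ≤ φ + 2 * ε →
      (M + δ • 1 - vecMulVec r r).PosDef ∧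
      (M + δ • 1 - vecMulVec r r)⁻¹.trace
        ≤ φ + (D + κ * (r ⬝ᵥ (H ^ 2) *ᵥ r - (H ^ 2).trace)) - ε * κ * (s + (H ^ 2).trace) ∧
      ((M + δ • 1 - vecMulVec r r)⁻¹ ^ 2).trace
        ≤ (H ^ 2).trace + 2 * κ * (r ⬝ᵥ (H ^ 3) *ᵥ r) + κ ^ 2 * (r ⬝ᵥ (H ^ 2) *ᵥ r) ^ 2 := by
  intro H hq
  have hlt := hd.lt_one
  have hκ : 0 < κ := by rw [hd.κ_eq]; exact inv_pos.2 (by linarith)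
  have hδ : 0 ≤ δ := by rw [hd.δ_eq]; have := hd.ε_pos; positivity
  have hP := PosDef.add_smul_one hM hδ
  have hq1 : r ⬝ᵥ H *ᵥ r < 1 := by linarith
  obtain ⟨t1, t2, -, -, -, t6, t7⟩ := PosDef.trace_shift hM hδ
  have hc : (1 - r ⬝ᵥ H *ᵥ r)⁻¹ ≤ κ := by
    rw [hd.κ_eq]
    exact inv_anti₀ (by linarith) (by linarith)
  have hc0 : 0 ≤ (1 - r ⬝ᵥ H *ᵥ r)⁻¹ := inv_nonneg.2 (by linarith)
  have hq2 : 0 ≤ r ⬝ᵥ (H ^ 2) *ᵥ r := PosSemidef.quadForm_nonneg (hP.inv.posSemidef.pow 2) r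
  have hq3 : 0 ≤ r ⬝ᵥ (H ^ 3) *ᵥ r := PosSemidef.quadForm_nonneg (hP.inv.posSemidef.pow 3) r
  refine ⟨PosDef.sub_vecMulVec hP hq1, ?_, ?_⟩
  · rw [PosDef.trace_inv_sub_vecMulVec hP hq1]
    have a1 : (1 - r ⬝ᵥ H *ᵥ r)⁻¹ * (r ⬝ᵥ (H ^ 2) *ᵥ r) ≤ κ * (r ⬝ᵥ (H ^ 2) *ᵥ r) := by gcongr
    -- The part `κ tr H²` of the shift cancels the mean of the rank-one increase and leaves a
    -- centred term in `D`. The surplus `ε κ tr H²` is the drain recorded by `s`.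
    have a2 : δ * (H ^ 2).trace = κ * (H ^ 2).trace + ε * κ * (H ^ 2).trace := by
      rw [hd.δ_eq]; ring
    change H.trace + (1 - r ⬝ᵥ H *ᵥ r)⁻¹ * (r ⬝ᵥ (H ^ 2) *ᵥ r) ≤ _
    linarith
  · rw [PosDef.trace_inv_sq_sub_vecMulVec hP hq1]
    change (H ^ 2).trace + 2 * (1 - r ⬝ᵥ H *ᵥ r)⁻¹ * (r ⬝ᵥ (H ^ 3) *ᵥ r)
        + ((1 - r ⬝ᵥ H *ᵥ r)⁻¹ * (r ⬝ᵥ (H ^ 2) *ᵥ r)) ^ 2 ≤ _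
    rw [← mul_pow]
    gcongr

/-- The failure probability of the barrier is controlled by its potentials. -/
theorem barrier_failure_le {n : ℕ} {ν : Measure (Fin n → ℝ)} [IsProbabilityMeasure ν]
    {φ ε κ δ K y₀ y₁ : ℝ} (hd : BarrierData φ ε κ δ K y₀ y₁) (hν : QuadLaw ν K) :
    ∀ (m : ℕ) (M : Matrix (Fin n) (Fin n) ℝ) (D s : ℝ), M.PosDef → 0 ≤ s →
      M⁻¹.trace ≤ φ + D - ε * κ * s →
      (Measure.pi fun _ : Fin m => ν) {r | ¬ BarrierBound (φ + ε)
          (M + ((m : ℝ) * δ) • (1 : Matrix (Fin n) (Fin n) ℝ) - ∑ j, vecMulVec (r j) (r j))}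
        ≤ ENNReal.ofReal (D ^ 2 / ε ^ 2 + (M⁻¹ ^ 2).trace * Real.exp (-(κ ^ 2 * s)) / y₀
            + m * barrierError ε κ K y₁) := by
  have hε := hd.ε_pos
  have hφ := hd.φ_pos
  have hK := hd.K_nonneg
  have hy := hd.y₀_pos
  have hlt := hd.lt_one
  have hκ : 0 < κ := by rw [hd.κ_eq]; exact inv_pos.2 (by linarith)
  have hδ : 0 ≤ δ := by rw [hd.δ_eq]; positivity
  have hE0 : 0 ≤ barrierError ε κ K y₁ := by unfold barrierError; positivity
  -- Induction on the number of columns still to come, for arbitrary current data: `D` collects the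
  -- centred fluctuations of the trace and `s` the sum of the `tr H²`. The bound is Chebyshev for
  -- `D`, Markov for the weighted `tr M⁻²`, and one `barrierError` per remaining column.
  intro m
  induction m with
  | zero =>
    intro M D s hM hs hX
    obtain ⟨-, -, -, -, -, t6, -⟩ := PosDef.trace_shift hM le_rfl
    rw [zero_smul, add_zero] at t6
    by_cases hcase : D ^ 2 ≤ ε ^ 2
    · have hD := (abs_le_of_sq_le_sq hcase hε.le)
      have hD' := (abs_le.1 hD).2
      have : {r : Fin 0 → Fin n → ℝ | ¬ BarrierBound (φ + ε)
          (M + (((0 : ℕ) : ℝ) * δ) • (1 : Matrix (Fin n) (Fin n) ℝ)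
            - ∑ j, vecMulVec (r j) (r j))} = ∅ := by
        ext r
        simp only [CharP.cast_eq_zero, zero_mul, zero_smul, add_zero, Finset.univ_eq_empty,
          Finset.sum_empty, sub_zero, mem_ofPred_eq, mem_empty_iff_false, iff_false, not_not]
        refine ⟨hM, ?_⟩
        have : 0 ≤ ε * κ * s := by positivity
        linarith
      rw [this]
      simp
    · refine prob_le_one.trans ?_
      rw [← ENNReal.ofReal_one]
      refine ENNReal.ofReal_le_ofReal ?_
      have a1 : 1 ≤ D ^ 2 / ε ^ 2 := by rw [le_div_iff₀ (by positivity)]; linarith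
      have a2 : 0 ≤ (M⁻¹ ^ 2).trace * Real.exp (-(κ ^ 2 * s)) / y₀ := by positivity
      push_cast
      linarith
  | succ m ih =>
    intro M D s hM hs hX
    obtain ⟨t1, t2, t3, t4, t5, t6, t7⟩ := PosDef.trace_shift hM hδ
    obtain ⟨-, -, -, -, t50, t60, -⟩ := PosDef.trace_shift hM le_rfl
    rw [zero_smul, add_zero] at t60 t50
    set Y := (M⁻¹ ^ 2).trace with hY
    set H := (M + δ • (1 : Matrix (Fin n) (Fin n) ℝ))⁻¹ with hH
    have hP := PosDef.add_smul_one hM hδ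
    -- If the claimed bound is at least one there is nothing to prove. Otherwise `D`, `s` and `Y`
    -- are all under control, which replaces a stopping time.
    by_cases hcase : 1 ≤ D ^ 2 / ε ^ 2 + Y * Real.exp (-(κ ^ 2 * s)) / y₀
    · refine prob_le_one.trans ?_
      rw [← ENNReal.ofReal_one]
      refine ENNReal.ofReal_le_ofReal ?_
      have : 0 ≤ ((m + 1 : ℕ) : ℝ) * barrierError ε κ K y₁ := by positivity
      linarith
    push Not at hcase
    have c1 : 0 ≤ Y * Real.exp (-(κ ^ 2 * s)) / y₀ := by positivity
    have c2 : 0 ≤ D ^ 2 / ε ^ 2 := by positivity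
    have hD : D ≤ ε := by
      have : D ^ 2 / ε ^ 2 < 1 := by linarith
      rw [div_lt_one (by positivity)] at this
      exact (abs_le.1 (abs_le_of_sq_le_sq this.le hε.le)).2
    -- The trace of `M⁻¹` is nonnegative, so the total drain cannot exceed `φ + D ≤ φ + ε`.
    have hsB : s ≤ (φ + ε) / (ε * κ) := by
      rw [le_div_iff₀ (by positivity)]
      linarith
    have hYy : Y ≤ y₁ := by
      have h1 : Y * Real.exp (-(κ ^ 2 * s)) / y₀ < 1 := by linarith
      rw [div_lt_one hy, Real.exp_neg, ← div_eq_mul_inv, div_lt_iff₀ (Real.exp_pos _)] at h1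
      rw [hd.y₁_eq]
      refine h1.le.trans ?_
      gcongr
    have hXe : H.trace ≤ φ + ε := by
      have a1 : 0 ≤ δ * (H ^ 2).trace := by positivity
      have a2 : 0 ≤ ε * κ * s := by positivity
      linarith
    set d₁ : (Fin n → ℝ) → ℝ := fun r => r ⬝ᵥ H *ᵥ r - H.trace with hd1
    set d₂ : (Fin n → ℝ) → ℝ := fun r => r ⬝ᵥ (H ^ 2) *ᵥ r - (H ^ 2).trace with hd2
    set d₃ : (Fin n → ℝ) → ℝ := fun r => r ⬝ᵥ (H ^ 3) *ᵥ r - (H ^ 3).trace with hd3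
    have hs1 : H.IsSymm := PosDef.isSymm hP.inv
    have hs2 : (H ^ 2).IsSymm := by
      rw [Matrix.IsSymm, transpose_pow, hs1.eq]
    have hs3 : (H ^ 3).IsSymm := by
      rw [Matrix.IsSymm, transpose_pow, hs1.eq]
    have f1 : HasFourth d₁ ν := hν.hasFourth H hs1
    have f2 : HasFourth d₂ ν := hν.hasFourth (H ^ 2) hs2
    have f3 : HasFourth d₃ ν := hν.hasFourth (H ^ 3) hs3
    set E : ℝ := Real.exp (-(κ ^ 2 * (s + (H ^ 2).trace))) / y₀ with hE
    have hEpos : 0 < E := by positivity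
    -- A bound for the failure probability given the next column. If the quadratic form exceeds `φ +
    -- 2ε`, the update is unavailable, but then `d₁ ≥ ε` and the last term alone is at least one.
    set F : (Fin n → ℝ) → ℝ := fun r => (D + κ * d₂ r) ^ 2 / ε ^ 2
      + ((H ^ 2).trace + 2 * κ * ((H ^ 3).trace + d₃ r) + κ ^ 2 * ((H ^ 2).trace + d₂ r) ^ 2) * E
      + m * barrierError ε κ K y₁ + d₁ r ^ 4 / ε ^ 4 with hF
    have hpos : ∀ r, 0 ≤ ((H ^ 2).trace + 2 * κ * ((H ^ 3).trace + d₃ r)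
        + κ ^ 2 * ((H ^ 2).trace + d₂ r) ^ 2) := by
      intro r
      have hq3 : 0 ≤ r ⬝ᵥ (H ^ 3) *ᵥ r := PosSemidef.quadForm_nonneg (hP.inv.posSemidef.pow 3) r
      have : (H ^ 3).trace + d₃ r = r ⬝ᵥ (H ^ 3) *ᵥ r := by simp [hd3]
      rw [this]
      positivity
    have hslice : ∀ r₀ : Fin n → ℝ, (Measure.pi fun _ : Fin m => ν)
        {r | ¬ BarrierBound (φ + ε) ((M + δ • 1 - vecMulVec r₀ r₀)
          + ((m : ℝ) * δ) • (1 : Matrix (Fin n) (Fin n) ℝ) - ∑ j, vecMulVec (r j) (r j))}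
        ≤ ENNReal.ofReal (F r₀) := by
      intro r₀
      have hp1 : 0 ≤ (D + κ * d₂ r₀) ^ 2 / ε ^ 2 := by positivity
      have hp2 := mul_nonneg (hpos r₀) hEpos.le
      have hp3 : 0 ≤ m * barrierError ε κ K y₁ := by positivity
      have hp4 : 0 ≤ d₁ r₀ ^ 4 / ε ^ 4 := by positivity
      by_cases hq : r₀ ⬝ᵥ H *ᵥ r₀ ≤ φ + 2 * ε
      · obtain ⟨u1, u2, u3⟩ := barrier_update hd hM r₀ hX hq
        refine (ih _ _ _ u1 (by positivity) u2).trans (ENNReal.ofReal_le_ofReal ?_)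
        have v1 : (H ^ 2).trace + d₂ r₀ = r₀ ⬝ᵥ (H ^ 2) *ᵥ r₀ := by simp [hd2]
        have v2 : (H ^ 3).trace + d₃ r₀ = r₀ ⬝ᵥ (H ^ 3) *ᵥ r₀ := by simp [hd3]
        have v3 : ((M + δ • 1 - vecMulVec r₀ r₀)⁻¹ ^ 2).trace
              * Real.exp (-(κ ^ 2 * (s + (H ^ 2).trace))) / y₀
            ≤ ((H ^ 2).trace + 2 * κ * ((H ^ 3).trace + d₃ r₀)
                + κ ^ 2 * ((H ^ 2).trace + d₂ r₀) ^ 2) * E := by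
          rw [v1, v2, hE, mul_div_assoc]
          gcongr
        simp only [hF]
        have v4 : (D + κ * (r₀ ⬝ᵥ H ^ 2 *ᵥ r₀ - (H ^ 2).trace)) = D + κ * d₂ r₀ := rfl
        rw [v4]
        linarith
      · refine prob_le_one.trans ?_
        rw [← ENNReal.ofReal_one]
        refine ENNReal.ofReal_le_ofReal ?_
        push Not at hq
        have : ε ≤ d₁ r₀ := by simp only [hd1]; linarith
        have : 1 ≤ d₁ r₀ ^ 4 / ε ^ 4 := by
          rw [le_div_iff₀ (by positivity), one_mul]
          gcongr
        simp only [hF]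
        linarith
    have hmeas : MeasurableSet {r : Fin (m + 1) → Fin n → ℝ | ¬ BarrierBound (φ + ε)
        (M + (((m + 1 : ℕ) : ℝ) * δ) • (1 : Matrix (Fin n) (Fin n) ℝ)
          - ∑ j, vecMulVec (r j) (r j))} := by
      refine (measurableSet_barrierBound (fun i j => ?_) (by positivity)).compl
      simp only [Matrix.sub_apply, Matrix.sum_apply, vecMulVec_apply]
      fun_prop
    have hmp := (measurePreserving_piFinSuccAbove (fun _ : Fin (m + 1) => ν) 0).symm
    rw [← hmp.measure_preimage hmeas.nullMeasurableSet,
      Measure.prod_apply (hmp.measurable hmeas)]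
    have hsl : ∀ r₀ : Fin n → ℝ, (Prod.mk r₀ ⁻¹' ((MeasurableEquiv.piFinSuccAbove
        (fun _ : Fin (m + 1) => Fin n → ℝ) 0).symm ⁻¹' {r : Fin (m + 1) → Fin n → ℝ |
        ¬ BarrierBound (φ + ε) (M + (((m + 1 : ℕ) : ℝ) * δ) • (1 : Matrix (Fin n) (Fin n) ℝ)
          - ∑ j, vecMulVec (r j) (r j))}))
        = {r | ¬ BarrierBound (φ + ε) ((M + δ • 1 - vecMulVec r₀ r₀)
          + ((m : ℝ) * δ) • (1 : Matrix (Fin n) (Fin n) ℝ) - ∑ j, vecMulVec (r j) (r j))} := by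
      intro r₀
      ext r
      simp only [mem_preimage, mem_ofPred_eq]
      have : M + (((m + 1 : ℕ) : ℝ) * δ) • (1 : Matrix (Fin n) (Fin n) ℝ)
          - ∑ j, vecMulVec ((MeasurableEquiv.piFinSuccAbove
            (fun _ : Fin (m + 1) => Fin n → ℝ) 0).symm (r₀, r) j)
            ((MeasurableEquiv.piFinSuccAbove
            (fun _ : Fin (m + 1) => Fin n → ℝ) 0).symm (r₀, r) j)
          = (M + δ • 1 - vecMulVec r₀ r₀)
          + ((m : ℝ) * δ) • (1 : Matrix (Fin n) (Fin n) ℝ) - ∑ j, vecMulVec (r j) (r j) := by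
        rw [Fin.sum_univ_succ]
        simp only [MeasurableEquiv.piFinSuccAbove_symm_apply, Fin.insertNthEquiv_zero,
          Fin.consEquiv_apply, Fin.cons_zero, Fin.cons_succ]
        push_cast
        rw [add_mul, one_mul, add_smul]
        abel
      rw [this]
    simp only [hsl]
    refine (lintegral_mono hslice).trans ?_
    have i2 : Integrable (fun r => (D + κ * d₂ r) ^ 2 / ε ^ 2) ν := by
      have : HasFourth (fun r => D + κ * d₂ r) ν := (HasFourth.const D).add (f2.const_mul κ)
      exact this.integrable_sq.div_const _
    have i3 : Integrable (fun r => (H ^ 2).trace + 2 * κ * ((H ^ 3).trace + d₃ r)) ν :=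
      (integrable_const _).add (((integrable_const _).add f3.integrable).const_mul _)
    have i4 : Integrable (fun r => κ ^ 2 * ((H ^ 2).trace + d₂ r) ^ 2) ν := by
      have : HasFourth (fun r => (H ^ 2).trace + d₂ r) ν := (HasFourth.const _).add f2
      exact this.integrable_sq.const_mul _
    have i5 : Integrable (fun r => d₁ r ^ 4 / ε ^ 4) ν := f1.2.div_const _
    have iF : Integrable F ν := (((i2.add ((i3.add i4).mul_const E)).add (integrable_const _)).add i5)
    rw [← ofReal_integral_eq_lintegral_ofReal iF (ae_of_all _ fun r => by
      have := mul_nonneg (hpos r) hEpos.le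
      simp only [hF, Pi.zero_apply]
      positivity)]
    refine ENNReal.ofReal_le_ofReal ?_
    have m2 : ∫ r, d₂ r ∂ν = 0 := hν.mean _ hs2
    have m3 : ∫ r, d₃ r ∂ν = 0 := hν.mean _ hs3
    have key := barrier_step_integral hd (D := D) (s := s) (C := m * barrierError ε κ K y₁)
      t2 t3 t4 t6 t7 hYy (v := ∫ r, d₂ r ^ 2 ∂ν) (w := ∫ r, d₁ r ^ 4 ∂ν) ?_ (hν.fourth H hs1)
    · refine le_trans (le_of_eq ?_) (key.trans (le_of_eq ?_))
      · have eF : ∀ r, F r = (D ^ 2 / ε ^ 2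
            + ((H ^ 2).trace + 2 * κ * (H ^ 3).trace + κ ^ 2 * (H ^ 2).trace ^ 2) * E
            + m * barrierError ε κ K y₁)
            + ((2 * D * κ / ε ^ 2 + 2 * κ ^ 2 * (H ^ 2).trace * E) * d₂ r + 2 * κ * E * d₃ r)
            + (κ ^ 2 / ε ^ 2 + κ ^ 2 * E) * d₂ r ^ 2 + (1 / ε ^ 4) * d₁ r ^ 4 := by
          intro r
          simp only [hF]
          ring
        have j1 := f2.integrable.const_mul (2 * D * κ / ε ^ 2 + 2 * κ ^ 2 * (H ^ 2).trace * E)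
        have j2 := f3.integrable.const_mul (2 * κ * E)
        have j3 : ∫ r, ((2 * D * κ / ε ^ 2 + 2 * κ ^ 2 * (H ^ 2).trace * E) * d₂ r
            + 2 * κ * E * d₃ r) ∂ν = 0 := by
          rw [integral_add j1 j2, integral_const_mul, integral_const_mul, m2, m3]
          simp
        have j4 : Integrable (fun r => (2 * D * κ / ε ^ 2 + 2 * κ ^ 2 * (H ^ 2).trace * E) * d₂ r
            + 2 * κ * E * d₃ r) ν := j1.add j2
        simp only [eF]
        rw [integral_add_four (integrable_const _) j4 (f2.integrable_sq.const_mul _)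
          (f1.2.const_mul _), j3, integral_const_mul, integral_const_mul]
        simp only [integral_const, probReal_univ, one_smul]
        ring
      · push_cast
        ring
    · refine (hν.sq _ hs2).trans (le_of_eq ?_)
      rw [← pow_mul]

end Hopfield

end

noncomputable section

namespace Hopfield

/-! ### The leave-one-out argument for the lower bound on the resolvent -/

open Matrix

set_option linter.unusedSectionVars false

/-- `M` is symmetric with `|v|² ≤ c ⟨v, M v⟩`. -/
def Coercive {ι : Type*} [Fintype ι] (c : ℝ) (M : Matrix ι ι ℝ) : Prop :=
  M.IsHermitian ∧ ∀ v : ι → ℝ, v ⬝ᵥ v ≤ c * (v ⬝ᵥ M *ᵥ v)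

section
variable {ι : Type*} [Fintype ι] [DecidableEq ι] {c : ℝ} {M : Matrix ι ι ℝ}

theorem Coercive.posDef (hc : 0 < c) (hM : Coercive c M) : M.PosDef := by
  refine PosDef.of_dotProduct_mulVec_pos hM.1 fun {v} hv => ?_
  have h4 : 0 < v ⬝ᵥ v := by
    simpa using (dotProduct_star_self_pos_iff (v := v)).2 hv
  have h5 := hM.2 v
  simp only [star_trivial]
  by_contra hcon
  nlinarith

theorem Coercive.add_vecMulVec (hc : 0 < c) (hM : Coercive c M) (r : ι → ℝ) :
    Coercive c (M + vecMulVec r r) := by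
  refine ⟨hM.1.add (isHermitian_vecMulVec r), fun v => (hM.2 v).trans ?_⟩
  rw [add_mulVec, dotProduct_add, quadForm_vecMulVec]
  gcongr
  nlinarith [sq_nonneg (v ⬝ᵥ r)]

/-- Coercivity tested on `M⁻¹ r`. -/
theorem Coercive.quadForm_inv_sq_le (hc : 0 < c) (hM : Coercive c M) (r : ι → ℝ) :
    r ⬝ᵥ (M⁻¹ ^ 2) *ᵥ r ≤ c * (r ⬝ᵥ M⁻¹ *ᵥ r) := by
  have hP := hM.posDef hc
  have h := quadForm_pow_inv hP r 1
  rw [one_mulVec, mul_one, ← sq] at h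
  rw [← h]
  refine (hM.2 _).trans (le_of_eq ?_)
  rw [mulVec_mulVec, posDef_mul_inv hP, one_mulVec, dotProduct_comm]

/-- Coercivity at `M⁻¹ r` bounds `|M⁻¹ r|²` by `c` times the form; expanding `|M⁻¹ r - c r|² ≥ 0`
then gives the claim. -/
theorem Coercive.quadForm_inv_le (hc : 0 < c) (hM : Coercive c M) (r : ι → ℝ) :
    r ⬝ᵥ M⁻¹ *ᵥ r ≤ c * (r ⬝ᵥ r) := by
  have hP := hM.posDef hc
  have h1 := hM.2 (M⁻¹ *ᵥ r)
  rw [mulVec_mulVec, posDef_mul_inv hP, one_mulVec, dotProduct_comm _ r] at h1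
  have h2 : 0 ≤ (M⁻¹ *ᵥ r - c • r) ⬝ᵥ (M⁻¹ *ᵥ r - c • r) := by
    simpa using dotProduct_star_self_nonneg (M⁻¹ *ᵥ r - c • r)
  simp only [sub_dotProduct, dotProduct_sub, smul_dotProduct, dotProduct_smul, smul_eq_mul] at h2
  rw [dotProduct_comm (M⁻¹ *ᵥ r) r] at h2
  have h3 : c * (r ⬝ᵥ M⁻¹ *ᵥ r) ≤ c * (c * (r ⬝ᵥ r)) := by linarith
  exact le_of_mul_le_mul_left h3 hc

theorem Coercive.trace_inv_le (hc : 0 < c) (hM : Coercive c M) :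
    M⁻¹.trace ≤ c * Fintype.card ι := by
  rw [trace_inv_diag M⁻¹]
  calc _ ≤ ∑ i : ι, c * ((Pi.single i 1 : ι → ℝ) ⬝ᵥ Pi.single i 1) :=
        Finset.sum_le_sum fun i _ => hM.quadForm_inv_le hc _
    _ = _ := by simp [mul_comm]

theorem Coercive.trace_inv_sq_le (hc : 0 < c) (hM : Coercive c M) :
    (M⁻¹ ^ 2).trace ≤ c ^ 2 * Fintype.card ι := by
  have h : (M⁻¹ ^ 2).trace ≤ c * M⁻¹.trace := by
    rw [trace_inv_diag M⁻¹, trace_inv_diag (M⁻¹ ^ 2), Finset.mul_sum]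
    exact Finset.sum_le_sum fun i _ => hM.quadForm_inv_sq_le hc _
  have := hM.trace_inv_le hc
  nlinarith

/-- The leave-one-out inequality for the trace of a resolvent. -/
theorem Coercive.leave_one_out {N : ℕ} (hc : 0 < c) (r : Fin N → ι → ℝ) {u φ : ℝ}
    (hφ1 : φ < 1) (hu : 0 ≤ u)
    (hM : Coercive c (u • (1 : Matrix ι ι ℝ) - ∑ j, vecMulVec (r j) (r j))) :
    let M := u • (1 : Matrix ι ι ℝ) - ∑ j, vecMulVec (r j) (r j)
    N * φ / (1 - φ) + (N * (M⁻¹.trace - φ) - c * (u * (c * Fintype.card ι))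
        - ∑ j, |r j ⬝ᵥ (M + vecMulVec (r j) (r j))⁻¹ *ᵥ r j
            - (M + vecMulVec (r j) (r j))⁻¹.trace|) / (1 - φ) ^ 2
      ≤ u * M⁻¹.trace - Fintype.card ι := by
  intro M
  have hP := hM.posDef hc
  have hs : 0 < 1 - φ := by linarith
  set Q : Fin N → ℝ := fun j => r j ⬝ᵥ (M + vecMulVec (r j) (r j))⁻¹ *ᵥ r j with hQ
  set X : Fin N → ℝ := fun j => (M + vecMulVec (r j) (r j))⁻¹.trace with hX
  have hCj : ∀ j, Coercive c (M + vecMulVec (r j) (r j)) := fun j => hM.add_vecMulVec hc (r j)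
  have hPj : ∀ j, (M + vecMulVec (r j) (r j)).PosDef := fun j => (hCj j).posDef hc
  have esub : ∀ j, (M + vecMulVec (r j) (r j)) - vecMulVec (r j) (r j) = M := fun j => by abel
  have hQ1 : ∀ j, Q j < 1 := fun j =>
    PosDef.quadForm_lt_one (hPj j) (by rw [esub]; exact hP)
  have hQ0 : ∀ j, 0 ≤ Q j := fun j => PosSemidef.quadForm_nonneg (hPj j).inv.posSemidef _
  -- Sherman–Morrison expresses the form in the full resolvent through `Q j`, the form in a
  -- resolvent that does not involve the column `r j`.
  have hq : ∀ j, r j ⬝ᵥ M⁻¹ *ᵥ r j = Q j / (1 - Q j) := by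
    intro j
    have h := PosDef.inv_sub_vecMulVec (hPj j) (hQ1 j)
    rw [esub] at h
    rw [h, add_mulVec, dotProduct_add, smul_mulVec, dotProduct_smul, quadForm_vecMulVec]
    have h1 := hQ1 j
    have : 1 - Q j ≠ 0 := by linarith
    simp only [smul_eq_mul]
    change Q j + (1 - Q j)⁻¹ * (Q j) ^ 2 = _
    field_simp
    ring
  have hXj : ∀ j, M⁻¹.trace - X j ≤ c * (Q j / (1 - Q j)) := by
    intro j
    have h := PosDef.trace_inv_sub_vecMulVec (hPj j) (hQ1 j)
    rw [esub] at h
    have h1 := hQ1 j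
    have h2 := (hCj j).quadForm_inv_sq_le hc (r j)
    have h3 : 0 ≤ (1 - Q j)⁻¹ := inv_nonneg.2 (by linarith)
    have h4 : (1 - Q j)⁻¹ * (r j ⬝ᵥ (M + vecMulVec (r j) (r j))⁻¹ ^ 2 *ᵥ r j)
        ≤ (1 - Q j)⁻¹ * (c * Q j) := by gcongr
    rw [h]
    change X j + (1 - Q j)⁻¹ * (r j ⬝ᵥ (M + vecMulVec (r j) (r j))⁻¹ ^ 2 *ᵥ r j) - X j ≤ _
    rw [div_eq_mul_inv]
    linarith
  -- The trace of `M⁻¹ (u - M)`, computed column by column.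
  have hsum : ∑ j, Q j / (1 - Q j) = u * M⁻¹.trace - Fintype.card ι := by
    have e1 : ∑ j, r j ⬝ᵥ M⁻¹ *ᵥ r j = (M⁻¹ * ∑ j, vecMulVec (r j) (r j)).trace := by
      rw [Matrix.mul_sum, trace_sum]
      refine Finset.sum_congr rfl fun j _ => ?_
      rw [mul_vecMulVec, trace_vecMulVec, dotProduct_comm]
    have e2 : ∑ j, vecMulVec (r j) (r j) = u • (1 : Matrix ι ι ℝ) - M := by
      simp only [M]; abel
    rw [e2, mul_sub, posDef_inv_mul hP, mul_smul_comm, mul_one, trace_sub, trace_smul,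
      trace_one] at e1
    rw [← Finset.sum_congr rfl fun j _ => hq j, e1]
    rfl
  -- The convex function `x / (1 - x)` lies above its tangent at `φ`. This linearises the sum, so
  -- only first-order errors `Q j - X j` remain.
  have hjensen : ∀ j, φ / (1 - φ) + (Q j - φ) / (1 - φ) ^ 2 ≤ Q j / (1 - Q j) := by
    intro j
    have h1 : 0 < 1 - Q j := by linarith [hQ1 j]
    rw [← sub_nonneg]
    have : Q j / (1 - Q j) - (φ / (1 - φ) + (Q j - φ) / (1 - φ) ^ 2)
        = (Q j - φ) ^ 2 / ((1 - Q j) * (1 - φ) ^ 2) := by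
      field_simp
      ring
    rw [this]
    positivity
  have hJ := Finset.sum_le_sum fun j (_ : j ∈ Finset.univ) => hjensen j
  have hsplit : ∑ j, (φ / (1 - φ) + (Q j - φ) / (1 - φ) ^ 2)
      = ∑ _j : Fin N, φ / (1 - φ) + (∑ j, Q j - ∑ _j : Fin N, φ) / (1 - φ) ^ 2 := by
    rw [Finset.sum_add_distrib, ← Finset.sum_sub_distrib, Finset.sum_div]
  rw [hsum, hsplit] at hJ
  simp only [Finset.sum_const, Finset.card_univ, Fintype.card_fin, nsmul_eq_mul] at hJ
  have hE : ∑ j, X j - ∑ j, |Q j - X j| ≤ ∑ j, Q j := by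
    rw [← Finset.sum_sub_distrib]
    exact Finset.sum_le_sum fun j _ => by linarith [neg_abs_le (Q j - X j)]
  -- Replacing each leave-one-out trace by the full one costs in total at most `c ∑ Q/(1-Q)`, which
  -- the trace identity controls.
  have hXs : N * M⁻¹.trace - ∑ j, X j ≤ c * (u * (c * Fintype.card ι)) := by
    have h := Finset.sum_le_sum fun j (_ : j ∈ Finset.univ) => hXj j
    rw [Finset.sum_sub_distrib, ← Finset.mul_sum, hsum] at h
    simp only [Finset.sum_const, Finset.card_univ, Fintype.card_fin, nsmul_eq_mul] at h
    refine h.trans ?_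
    have h1 := hM.trace_inv_le hc
    have h2 : u * M⁻¹.trace ≤ u * (c * Fintype.card ι) := by gcongr
    have h3 : (0 : ℝ) ≤ Fintype.card ι := by positivity
    gcongr
    linarith
  refine le_trans ?_ hJ
  rw [mul_div_assoc]
  refine add_le_add le_rfl (div_le_div_of_nonneg_right ?_ (by positivity))
  change N * (M⁻¹.trace - φ) - c * (u * (c * Fintype.card ι)) - ∑ j, |Q j - X j| ≤ _
  linarith

theorem measurable_matrix_mulVec_quad {E : Type*} [MeasurableSpace E] {f : E → Matrix ι ι ℝ}
    {g : E → ι → ℝ} (hf : ∀ i j, Measurable fun x => f x i j) (hg : ∀ i, Measurable fun x => g x i) :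
    Measurable fun x => g x ⬝ᵥ (f x) *ᵥ g x := by
  simp only [dotProduct, mulVec]
  fun_prop

theorem measurable_inv_apply {E : Type*} [MeasurableSpace E] {f : E → Matrix ι ι ℝ}
    (hf : ∀ i j, Measurable fun x => f x i j) (i j : ι) : Measurable fun x => (f x)⁻¹ i j := by
  have h1 : Measurable fun A : ι → ι → ℝ => (Matrix.of A).det :=
    (Continuous.matrix_det (by fun_prop)).measurable
  have h2 : Measurable fun A : ι → ι → ℝ => (Matrix.of A).adjugate i j :=
    ((Continuous.matrix_adjugate (by fun_prop)).matrix_elem i j).measurable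
  have h3 : Measurable fun x => (fun i j => f x i j : ι → ι → ℝ) :=
    measurable_pi_lambda _ fun i => measurable_pi_lambda _ fun j => hf i j
  have e : (fun x => (f x)⁻¹ i j)
      = fun x => (Matrix.of (fun i j => f x i j)).det⁻¹
        * (Matrix.of (fun i j => f x i j)).adjugate i j := by
    funext x
    rw [Matrix.inv_def, Ring.inverse_eq_inv', Matrix.smul_apply]
    rfl
  rw [e]
  exact (h1.comp h3).inv.mul (h2.comp h3)

end

/-! ### Failure probabilities for the two resolvent bounds. -/

open Classical in
/-- The truncated squared deviation of a leave-one-out quadratic form. -/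
def looError {n : ℕ} (c : ℝ) (M : Matrix (Fin n) (Fin n) ℝ) (r : Fin n → ℝ) : ℝ≥0∞ :=
  if Coercive c M then ENNReal.ofReal ((r ⬝ᵥ M⁻¹ *ᵥ r - M⁻¹.trace) ^ 2) else 0

theorem lintegral_looError_le {n : ℕ} {ν : Measure (Fin n → ℝ)} [IsProbabilityMeasure ν] {K c : ℝ}
    (hK : 0 ≤ K) (hc : 0 < c) (hν : QuadLaw ν K) (M : Matrix (Fin n) (Fin n) ℝ) :
    ∫⁻ r, looError c M r ∂ν ≤ ENNReal.ofReal (K * (c ^ 2 * n)) := by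
  unfold looError
  split_ifs with h
  · have hP := h.posDef hc
    have hs : M⁻¹.IsSymm := PosDef.isSymm hP.inv
    rw [← ofReal_integral_eq_lintegral_ofReal (hν.hasFourth _ hs).integrable_sq
      (ae_of_all _ fun r => sq_nonneg _)]
    refine ENNReal.ofReal_le_ofReal ((hν.sq _ hs).trans ?_)
    have := h.trace_inv_sq_le hc
    rw [Fintype.card_fin] at this
    gcongr
  · simp

theorem measurable_looError {n : ℕ} {E : Type*} [MeasurableSpace E] {c : ℝ}
    {f : E → Matrix (Fin n) (Fin n) ℝ} {g : E → Fin n → ℝ}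
    (hf : ∀ i j, Measurable fun x => f x i j) (hg : ∀ i, Measurable fun x => g x i) :
    Measurable fun x => looError c (f x) (g x) := by
  unfold looError
  refine Measurable.ite (measurableSet_forall_quadForm hf c) ?_ measurable_const
  refine ENNReal.measurable_ofReal.comp (Measurable.pow_const (Measurable.sub ?_ ?_) 2)
  · exact measurable_matrix_mulVec_quad (measurable_inv_apply hf) hg
  · exact measurable_trace_inv hf

/-- Adding back `vecMulVec (r j) (r j)` removes column `j` from the sum, so the matrix is
independent of `r j`. The integral over `r j` is taken first, with the other columns fixed. -/
theorem lintegral_looError_pi_le {n N : ℕ} {ν : Measure (Fin n → ℝ)} [IsProbabilityMeasure ν]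
    {K c : ℝ} (hK : 0 ≤ K) (hc : 0 < c) (hν : QuadLaw ν K) (u : ℝ) (j : Fin N) :
    ∫⁻ r, looError c (u • (1 : Matrix (Fin n) (Fin n) ℝ) - ∑ i, vecMulVec (r i) (r i)
        + vecMulVec (r j) (r j)) (r j) ∂(Measure.pi fun _ : Fin N => ν)
      ≤ ENNReal.ofReal (K * (c ^ 2 * n)) := by
  obtain ⟨N, rfl⟩ : ∃ N', N = N' + 1 := Nat.exists_eq_succ_of_ne_zero (by have := j.2; omega)
  have hmp := (measurePreserving_piFinSuccAbove (fun _ : Fin (N + 1) => ν) j).symm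
  have hm : ∀ i k, Measurable fun r : Fin (N + 1) → Fin n → ℝ =>
      (u • (1 : Matrix (Fin n) (Fin n) ℝ) - ∑ i, vecMulVec (r i) (r i)
        + vecMulVec (r j) (r j)) i k := by
    intro i k
    simp only [Matrix.add_apply, Matrix.sub_apply, Matrix.sum_apply, vecMulVec_apply]
    fun_prop
  have hmeas : Measurable fun r : Fin (N + 1) → Fin n → ℝ =>
      looError c (u • (1 : Matrix (Fin n) (Fin n) ℝ) - ∑ i, vecMulVec (r i) (r i)
        + vecMulVec (r j) (r j)) (r j) := measurable_looError hm (by fun_prop)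
  rw [← hmp.lintegral_comp hmeas]
  refine (lintegral_prod_symm' _ (hmeas.comp hmp.measurable)).trans_le ?_
  simp only [Function.comp_def]
  have hval : ∀ (r₀ : Fin n → ℝ) (r : Fin N → Fin n → ℝ),
      looError c (u • (1 : Matrix (Fin n) (Fin n) ℝ)
        - ∑ i, vecMulVec ((MeasurableEquiv.piFinSuccAbove
            (fun _ : Fin (N + 1) => Fin n → ℝ) j).symm (r₀, r) i)
            ((MeasurableEquiv.piFinSuccAbove
            (fun _ : Fin (N + 1) => Fin n → ℝ) j).symm (r₀, r) i)
        + vecMulVec ((MeasurableEquiv.piFinSuccAbove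
            (fun _ : Fin (N + 1) => Fin n → ℝ) j).symm (r₀, r) j)
            ((MeasurableEquiv.piFinSuccAbove
            (fun _ : Fin (N + 1) => Fin n → ℝ) j).symm (r₀, r) j))
            ((MeasurableEquiv.piFinSuccAbove
            (fun _ : Fin (N + 1) => Fin n → ℝ) j).symm (r₀, r) j)
      = looError c (u • (1 : Matrix (Fin n) (Fin n) ℝ) - ∑ i, vecMulVec (r i) (r i)) r₀ := by
    intro r₀ r
    rw [Fin.sum_univ_succAbove _ j]
    simp only [MeasurableEquiv.piFinSuccAbove_symm_apply, Fin.insertNthEquiv_apply,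
      Fin.insertNth_apply_same, Fin.insertNth_apply_succAbove]
    congr 1
    abel
  simp only [hval]
  refine (lintegral_mono fun r => lintegral_looError_le hK hc hν _).trans ?_
  simp

/-- With high probability, the trace of the resolvent is not too small. -/
theorem resolvent_lower_failure_le {n N : ℕ} {ν : Measure (Fin n → ℝ)} [IsProbabilityMeasure ν]
    {K c φ η W : ℝ} (hK : 0 ≤ K) (hc : 0 < c) (hν : QuadLaw ν K) (hφ : 0 < φ) (hφ1 : φ < 1)
    (hn : 0 < n) (hW : 0 < W)
    (hW' : W = η * (n / φ - N * φ / (1 - φ) ^ 2) * (1 - φ) ^ 2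
      - c * ((n / φ + N / (1 - φ)) * (c * n)))
    (hg : 0 < (n : ℝ) / φ - N * φ / (1 - φ) ^ 2) :
    (Measure.pi fun _ : Fin N => ν) {r |
        Coercive c (((n : ℝ) / φ + N / (1 - φ)) • (1 : Matrix (Fin n) (Fin n) ℝ)
          - ∑ j, vecMulVec (r j) (r j)) ∧
        (((n : ℝ) / φ + N / (1 - φ)) • (1 : Matrix (Fin n) (Fin n) ℝ)
          - ∑ j, vecMulVec (r j) (r j))⁻¹.trace < φ - η}
      ≤ ENNReal.ofReal (N ^ 2 * (K * (c ^ 2 * n)) / W ^ 2) := by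
  have hs : 0 < 1 - φ := by linarith
  set u : ℝ := (n : ℝ) / φ + N / (1 - φ) with hu
  have hu0 : 0 ≤ u := by positivity
  set A : (Fin N → Fin n → ℝ) → Matrix (Fin n) (Fin n) ℝ := fun r =>
    u • (1 : Matrix (Fin n) (Fin n) ℝ) - ∑ j, vecMulVec (r j) (r j) with hA
  set S : (Fin N → Fin n → ℝ) → ℝ≥0∞ := fun r =>
    ∑ j, looError c (A r + vecMulVec (r j) (r j)) (r j) with hS
  have hm : ∀ j : Fin N, Measurable fun r : Fin N → Fin n → ℝ =>
      looError c (A r + vecMulVec (r j) (r j)) (r j) := by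
    intro j
    refine measurable_looError (fun i k => ?_) (by fun_prop)
    simp only [hA, Matrix.add_apply, Matrix.sub_apply, Matrix.sum_apply, vecMulVec_apply]
    fun_prop
  have hsub : {r | Coercive c (A r) ∧ (A r)⁻¹.trace < φ - η}
      ⊆ {r | ENNReal.ofReal (W ^ 2) ≤ N * S r} := by
    rintro r ⟨h1, h2⟩
    have key := h1.leave_one_out hc r hφ1 hu0
    simp only at key
    set E : ℝ := ∑ j, |r j ⬝ᵥ (A r + vecMulVec (r j) (r j))⁻¹ *ᵥ r j
      - (A r + vecMulVec (r j) (r j))⁻¹.trace| with hE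
    rw [Fintype.card_fin] at key
    change N * φ / (1 - φ) + (N * ((A r)⁻¹.trace - φ) - c * (u * (c * n)) - E) / (1 - φ) ^ 2
      ≤ u * (A r)⁻¹.trace - n at key
    set X := (A r)⁻¹.trace
    have hWE : W ≤ E := by
      -- The parameter `u = n/φ + N/(1-φ)` makes the leave-one-out inequality an identity at trace
      -- `φ` when there are no errors. Its slope in the trace is `-g < 0`, so a deficit `η` forces
      -- the error sum above `W`.
      have e1 : u * φ - n = N * φ / (1 - φ) := by rw [hu]; field_simp; ring
      have e2 : u - N / (1 - φ) ^ 2 = n / φ - N * φ / (1 - φ) ^ 2 := by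
        rw [hu]; field_simp; ring
      set g := (n : ℝ) / φ - N * φ / (1 - φ) ^ 2 with hg'
      have e3 : (N * (X - φ) - c * (u * (c * n)) - E) / (1 - φ) ^ 2
          = N / (1 - φ) ^ 2 * (X - φ) - (c * (u * (c * n)) + E) / (1 - φ) ^ 2 := by
        field_simp; ring
      rw [e3] at key
      have e4 : -(c * (u * (c * n)) + E) / (1 - φ) ^ 2 ≤ (X - φ) * g := by
        rw [← e2, neg_div]
        linarith
      have e5 : (X - φ) * g ≤ -η * g := by
        refine mul_le_mul_of_nonneg_right ?_ hg.le
        linarith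
      have e6 := e4.trans e5
      rw [div_le_iff₀ (by positivity)] at e6
      rw [hW']
      linarith
    have hCj : ∀ j, Coercive c (A r + vecMulVec (r j) (r j)) := fun j => h1.add_vecMulVec hc (r j)
    have hSr : S r = ENNReal.ofReal (∑ j, (r j ⬝ᵥ (A r + vecMulVec (r j) (r j))⁻¹ *ᵥ r j
      - (A r + vecMulVec (r j) (r j))⁻¹.trace) ^ 2) := by
      rw [ENNReal.ofReal_sum_of_nonneg fun _ _ => sq_nonneg _]
      refine Finset.sum_congr rfl fun j _ => ?_
      rw [looError, if_pos (hCj j)]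
    have hcs := sq_sum_le_card_mul_sum_sq (s := (Finset.univ : Finset (Fin N)))
      (f := fun j => |r j ⬝ᵥ (A r + vecMulVec (r j) (r j))⁻¹ *ᵥ r j
      - (A r + vecMulVec (r j) (r j))⁻¹.trace|)
    simp only [sq_abs, Finset.card_univ, Fintype.card_fin] at hcs
    change ENNReal.ofReal (W ^ 2) ≤ N * S r
    rw [hSr, ← ENNReal.ofReal_natCast N, ← ENNReal.ofReal_mul (by positivity)]
    refine ENNReal.ofReal_le_ofReal (le_trans ?_ hcs)
    gcongr
  refine (measure_mono hsub).trans ?_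
  have hSm : Measurable fun r => (N : ℝ≥0∞) * S r :=
    (Finset.measurable_sum _ fun j _ => hm j).const_mul _
  refine (meas_ge_le_lintegral_div hSm.aemeasurable (by simpa using hW.ne')
    ENNReal.ofReal_ne_top).trans ?_
  rw [ENNReal.ofReal_div_of_pos (by positivity)]
  gcongr
  rw [lintegral_const_mul _ (Finset.measurable_sum _ fun j _ => hm j),
    lintegral_finsetSum _ fun j _ => hm j]
  calc _ ≤ (N : ℝ≥0∞) * ∑ j : Fin N, ENNReal.ofReal (K * (c ^ 2 * n)) := by
        gcongr with j
        exact lintegral_looError_pi_le hK hc hν u j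
    _ = _ := by
        simp only [Finset.sum_const, Finset.card_univ, Fintype.card_fin, nsmul_eq_mul]
        rw [← ENNReal.ofReal_natCast N, ← ENNReal.ofReal_mul (by positivity),
          ← ENNReal.ofReal_mul (by positivity)]
        congr 1
        ring

/-- With high probability, the barrier started from a multiple of the identity survives. -/
theorem resolvent_upper_failure_le {n N : ℕ} {ν : Measure (Fin n → ℝ)} [IsProbabilityMeasure ν]
    {φ ε κ δ K y₀ y₁ : ℝ} (hd : BarrierData φ ε κ δ K y₀ y₁) (hν : QuadLaw ν K) (hn : 0 < n) :
    (Measure.pi fun _ : Fin N => ν) {r | ¬ BarrierBound (φ + ε)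
        (((n : ℝ) / φ + N * δ) • (1 : Matrix (Fin n) (Fin n) ℝ) - ∑ j, vecMulVec (r j) (r j))}
      ≤ ENNReal.ofReal (φ ^ 2 / (n * y₀) + N * barrierError ε κ K y₁) := by
  have hφ := hd.φ_pos
  have hn' : (0 : ℝ) < n := by exact_mod_cast hn
  have hP : (((n : ℝ) / φ) • (1 : Matrix (Fin n) (Fin n) ℝ)).PosDef :=
    PosDef.one.smul (by positivity)
  have hinv : (((n : ℝ) / φ) • (1 : Matrix (Fin n) (Fin n) ℝ))⁻¹
      = (φ / n) • (1 : Matrix (Fin n) (Fin n) ℝ) := by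
    refine inv_eq_right_inv ?_
    rw [smul_mul_smul_comm, one_mul,
      show (n : ℝ) / φ * (φ / n) = 1 by field_simp, one_smul]
  have h := barrier_failure_le hd hν N (((n : ℝ) / φ) • 1) 0 0 hP le_rfl (by
    rw [hinv, trace_smul, trace_one, Fintype.card_fin, smul_eq_mul]
    field_simp
    simp)
  rw [hinv, smul_pow, one_pow, trace_smul, trace_one, Fintype.card_fin, smul_eq_mul,
    ← add_smul] at h
  refine h.trans (ENNReal.ofReal_le_ofReal (le_of_eq ?_))
  simp only [ne_eq, OfNat.ofNat_ne_zero, not_false_eq_true, zero_pow, zero_div, mul_zero, neg_zero,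
    Real.exp_zero, mul_one, zero_add]
  field_simp

end Hopfield

end

noncomputable section

namespace Hopfield

/-! ### The law of the pattern matrix -/

section
variable {Ω : Type*} [MeasurableSpace Ω] {P : Measure Ω} [IsProbabilityMeasure P]
  {ξ : ℕ → ℕ → Ω → ℝ}

theorem exists_entryLaw_of_subgaussian {X : Ω → ℝ} (hX : Measurable X) (hmean : ∫ ω, X ω ∂P = 0)
    (hvar : ∫ ω, X ω ^ 2 ∂P = 1) {c : ℝ≥0} (hsub : HasSubgaussianMGF X c P) :
    ∃ m, EntryLaw (P.map X) m := by
  have hint : ∀ k : ℕ, Integrable (fun ω => X ω ^ k) P := by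
    intro k
    rcases Nat.eq_zero_or_pos k with rfl | hk
    · simp
    refine MemLp.integrable_norm_pow (p := k) (f := X) ?_ hk.ne' |>.mono (by fun_prop) (by simp)
    exact hsub.memLp k
  have hmap : ∀ f : ℝ → ℝ, Measurable f → Integrable (fun ω => f (X ω)) P →
      Integrable f (P.map X) := fun f hf h =>
    (integrable_map_measure hf.aestronglyMeasurable hX.aemeasurable).2 h
  have hval : ∀ f : ℝ → ℝ, Measurable f → ∫ x, f x ∂(P.map X) = ∫ ω, f (X ω) ∂P := fun f hf =>
    integral_map hX.aemeasurable hf.aestronglyMeasurable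
  obtain ⟨m, hm⟩ : ∃ m : ℝ, 1 ≤ m ∧ ∫ x, x ^ 4 ∂(P.map X) ≤ m ^ 2 ∧
      ∫ x, (x ^ 2 - 1) ^ 4 ∂(P.map X) ≤ m ^ 2 := by
    set a := ∫ x, x ^ 4 ∂(P.map X)
    set b := ∫ x, (x ^ 2 - 1) ^ 4 ∂(P.map X)
    have hm1 : 1 ≤ max 1 (max a b) := le_max_left _ _
    have hsq : max 1 (max a b) ≤ max 1 (max a b) ^ 2 := by nlinarith
    exact ⟨max 1 (max a b), hm1,
      ((le_max_left a b).trans (le_max_right _ _)).trans hsq,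
      ((le_max_right a b).trans (le_max_right _ _)).trans hsq⟩
  refine ⟨m, hm.1, ⟨measurable_id, hmap _ (by fun_prop) (hint 4)⟩,
    ⟨by fun_prop, hmap _ (by fun_prop) ?_⟩, ?_, ?_, hm.2.1, hm.2.2⟩
  · simp_rw [← pow_mul]
    exact hint 8
  · rw [hval (fun x => x) measurable_id, ← hmean]
  · rw [hval _ (by fun_prop), ← hvar]

variable (hmeas : ∀ i j, Measurable (ξ i j)) (hindep : iIndepFun (fun p : ℕ × ℕ => ξ p.1 p.2) P)
  (hident : ∀ i j, IdentDistrib (ξ i j) (ξ 0 0) P P)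
include hmeas hindep hident

theorem map_columns_eq_pi (n N : ℕ) :
    P.map (fun ω (j : Fin N) (i : Fin n) => ξ i j ω)
      = Measure.pi fun _ : Fin N => Measure.pi fun _ : Fin n => P.map (ξ 0 0) := by
  have : IsProbabilityMeasure (P.map (ξ 0 0)) :=
    Measure.isProbabilityMeasure_map (hmeas 0 0).aemeasurable
  have h1 : P.map (fun (ω : Ω) (p : Fin N × Fin n) => ξ p.2 p.1 ω)
      = Measure.pi fun _ : Fin N × Fin n => P.map (ξ 0 0) := by
    have hinj : Function.Injective (fun p : Fin N × Fin n => ((p.2 : ℕ), (p.1 : ℕ))) := by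
      rintro ⟨a, b⟩ ⟨c, d⟩ h
      simp only [Prod.mk.injEq, Fin.val_inj] at h
      simp [h]
    have h := (hindep.precomp hinj).map_fun_eq_pi_map
      (fun p : Fin N × Fin n => (hmeas ((p.2 : ℕ), (p.1 : ℕ)).1 ((p.2 : ℕ), (p.1 : ℕ)).2).aemeasurable)
    simp only at h
    rw [h]
    congr 1
    funext p
    exact (hident _ _).map_eq
  have h2 := Measure.infinitePi_map_curry (fun (_ : Fin N) (_ : Fin n) => P.map (ξ 0 0))
  simp only [Measure.infinitePi_eq_pi] at h2
  rw [← h2, ← h1, Measure.map_map (by fun_prop) (by fun_prop)]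
  rfl

omit [IsProbabilityMeasure P] in
theorem map_row_eq_pi (i N : ℕ) :
    P.map (fun ω (j : Fin N) => ξ i j ω) = Measure.pi fun _ : Fin N => P.map (ξ 0 0) := by
  have hinj : Function.Injective (fun j : Fin N => (i, (j : ℕ))) := by
    intro a b h
    simpa [Fin.val_inj] using h
  have h := (hindep.precomp hinj).map_fun_eq_pi_map
    (fun j : Fin N => (hmeas (i, (j : ℕ)).1 (i, (j : ℕ)).2).aemeasurable)
  simp only at h
  rw [h]
  congr 1
  funext p
  exact (hident _ _).map_eq

/-- An inequality suffices for upper bounds and holds for arbitrary, possibly non-measurable, `S`.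
-/
theorem columns_mem_le (n N : ℕ) (S : Set (Fin N → Fin n → ℝ)) :
    P {ω | (fun (j : Fin N) (i : Fin n) => ξ i j ω) ∈ S}
      ≤ (Measure.pi fun _ : Fin N => Measure.pi fun _ : Fin n => P.map (ξ 0 0)) S := by
  rw [← map_columns_eq_pi hmeas hindep hident]
  exact Measure.le_map_apply (by fun_prop) S

end

/-! ### Borel–Cantelli along a sparse lattice of system sizes -/

/-- The largest `a` with `a ^ 16 ≤ n`. -/
def root16 (n : ℕ) : ℕ := ⌊(n : ℝ) ^ (1 / 16 : ℝ)⌋₊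

theorem rpow_pow_sixteen (n : ℕ) : ((n : ℝ) ^ (1 / 16 : ℝ)) ^ 16 = n := by
  rw [← Real.rpow_natCast, ← Real.rpow_mul n.cast_nonneg]
  norm_num

theorem root16_pow_le (n : ℕ) : root16 n ^ 16 ≤ n := by
  have h := Nat.floor_le (Real.rpow_nonneg (Nat.cast_nonneg n) (1 / 16 : ℝ))
  have h2 := pow_le_pow_left₀ (Nat.cast_nonneg _) h 16
  rw [rpow_pow_sixteen] at h2
  exact_mod_cast h2

theorem le_root16_succ_pow (n : ℕ) : n ≤ (root16 n + 1) ^ 16 := by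
  have h := (Nat.lt_floor_add_one ((n : ℝ) ^ (1 / 16 : ℝ))).le
  have h2 := pow_le_pow_left₀ (Real.rpow_nonneg (Nat.cast_nonneg n) _) h 16
  rw [rpow_pow_sixteen] at h2
  exact_mod_cast h2

theorem tendsto_rpow_sixteenth : Tendsto (fun n : ℕ => (n : ℝ) ^ (1 / 16 : ℝ)) atTop atTop :=
  (tendsto_rpow_atTop (by norm_num)).comp tendsto_natCast_atTop_atTop

theorem tendsto_root16 : Tendsto root16 atTop atTop :=
  tendsto_nat_floor_atTop.comp tendsto_rpow_sixteenth

/-- The lattice points just below (`e = 0`) and just above (`e = 1`) a size are asymptotically equal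
to it, so interpolation loses nothing in the limit. -/
theorem tendsto_root16_add_pow_div (e : ℕ) :
    Tendsto (fun n : ℕ => (((root16 n + e) ^ 16 : ℕ) : ℝ) / n) atTop (𝓝 1) := by
  have h1 : Tendsto (fun n : ℕ => (root16 n : ℝ) / (n : ℝ) ^ (1 / 16 : ℝ)) atTop (𝓝 1) :=
    (tendsto_nat_floor_div_atTop (R := ℝ)).comp tendsto_rpow_sixteenth
  have h2 : Tendsto (fun n : ℕ => (e : ℝ) / (n : ℝ) ^ (1 / 16 : ℝ)) atTop (𝓝 0) :=
    tendsto_rpow_sixteenth.const_div_atTop _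
  have h3 := (h1.add h2).pow 16
  simp only [add_zero, one_pow] at h3
  refine h3.congr fun n => ?_
  rw [← add_div, div_pow, rpow_pow_sixteen]
  push_cast
  rfl

variable {α : ℝ}

theorem highLoad_tendsto_fst : Tendsto Prod.fst (highLoad α) atTop :=
  tendsto_fst.mono_left inf_le_left

theorem highLoad_tendsto_snd : Tendsto Prod.snd (highLoad α) atTop :=
  tendsto_snd.mono_left inf_le_left

theorem highLoad_tendsto_ratio :
    Tendsto (fun p : ℕ × ℕ => (p.1 : ℝ) / ((p.1 : ℝ) + p.2)) (highLoad α) (𝓝 α) :=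
  tendsto_comap.mono_left inf_le_right

theorem highLoad_eventually_pos : ∀ᶠ p : ℕ × ℕ in highLoad α, 0 < p.1 ∧ 0 < p.2 :=
  (highLoad_tendsto_fst.eventually_gt_atTop 0).and (highLoad_tendsto_snd.eventually_gt_atTop 0)

theorem highLoad_tendsto_ratio' :
    Tendsto (fun p : ℕ × ℕ => (p.2 : ℝ) / ((p.1 : ℝ) + p.2)) (highLoad α) (𝓝 (1 - α)) := by
  refine (highLoad_tendsto_ratio.const_sub 1).congr' ?_
  filter_upwards [highLoad_eventually_pos] with p hp
  have h : (0 : ℝ) < p.1 := by exact_mod_cast hp.1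
  field_simp
  ring

theorem highLoad_tendsto_lattice (e : ℕ) :
    Tendsto (fun p : ℕ × ℕ => (((root16 p.1 + e) ^ 16 : ℕ) : ℝ) / ((p.1 : ℝ) + p.2))
      (highLoad α) (𝓝 α) := by
  have h := ((tendsto_root16_add_pow_div e).comp highLoad_tendsto_fst).mul
    (highLoad_tendsto_ratio (α := α))
  rw [one_mul] at h
  refine h.congr' ?_
  filter_upwards [highLoad_eventually_pos] with p hp
  have h : (0 : ℝ) < p.1 := by exact_mod_cast hp.1
  simp only [Function.comp]
  field_simp

theorem highLoad_tendsto_lattice' (e : ℕ) :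
    Tendsto (fun p : ℕ × ℕ => (((root16 p.2 + e) ^ 16 : ℕ) : ℝ) / ((p.1 : ℝ) + p.2))
      (highLoad α) (𝓝 (1 - α)) := by
  have h := ((tendsto_root16_add_pow_div e).comp highLoad_tendsto_snd).mul
    (highLoad_tendsto_ratio' (α := α))
  rw [one_mul] at h
  refine h.congr' ?_
  filter_upwards [highLoad_eventually_pos] with p hp
  have h : (0 : ℝ) < p.2 := by exact_mod_cast hp.2
  simp only [Function.comp]
  field_simp

/-- Borel–Cantelli over pairs. In the admissible region `b` is at most a multiple of `a`, so `C /
a⁴` is dominated by a multiple of `1 / ((a+1)² (b+1)²)`, which is summable. The high-load limit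
eventually lies in that region because `(1 - α) / α < L`. -/
theorem ae_eventually_notMem_lattice {Ω : Type*} [MeasurableSpace Ω] {P : Measure Ω}
    [IsProbabilityMeasure P] (hα0 : 0 < α) {L C : ℝ} (hL : (1 - α) / α < L)
    {a₀ : ℕ} (E : ℕ → ℕ → Set Ω)
    (hE : ∀ a b : ℕ, a₀ ≤ a → 0 < a → (((b ^ 16 : ℕ) : ℝ)) ≤ L * ((a ^ 16 : ℕ) : ℝ) →
      P (E a b) ≤ ENNReal.ofReal (C / (a : ℝ) ^ 4)) (e₁ e₂ : ℕ) :
    ∀ᵐ ω ∂P, ∀ᶠ p in highLoad α, ω ∉ E (root16 p.1 + e₁) (root16 p.2 + e₂) := by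
  classical
  set M := max 1 L with hM
  have hM1 : 1 ≤ M := le_max_left _ _
  have hLM : L ≤ M := le_max_right _ _
  set F : ℕ × ℕ → Set Ω := fun p =>
    if a₀ ≤ p.1 ∧ 0 < p.1 ∧ (((p.2 ^ 16 : ℕ) : ℝ)) ≤ L * ((p.1 ^ 16 : ℕ) : ℝ) then E p.1 p.2 else ∅
    with hF
  set g : ℕ → ℝ := fun a => 1 / ((a : ℝ) + 1) ^ 2
  have hg0 : ∀ a, 0 ≤ g a := fun a => by positivity
  have hg : Summable g := by
    have := (summable_nat_add_iff 1).2 (Real.summable_one_div_nat_pow.2 one_lt_two)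
    simpa [g] using this
  have hsum : Summable fun p : ℕ × ℕ => |C| * (4 * (M + 1) ^ 2) * (g p.1 * g p.2) :=
    (hg.mul_of_nonneg hg hg0 hg0).mul_left _
  have hbound : ∀ p, P (F p) ≤ ENNReal.ofReal (|C| * (4 * (M + 1) ^ 2) * (g p.1 * g p.2)) := by
    intro p
    simp only [hF]
    split_ifs with h
    · refine (hE _ _ h.1 h.2.1 h.2.2).trans (ENNReal.ofReal_le_ofReal ?_)
      have ha : (1 : ℝ) ≤ p.1 := by exact_mod_cast h.2.1
      have hb : (p.2 : ℝ) ≤ M * p.1 := by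
        refine le_of_pow_le_pow_left₀ (n := 16) (by norm_num) (by positivity) ?_
        have h3 := h.2.2
        push_cast at h3
        refine h3.trans ?_
        rw [mul_pow]
        gcongr
        exact hLM.trans (le_self_pow₀ hM1 (by norm_num))
      have h5 : (p.1 : ℝ) + 1 ≤ 2 * p.1 := by linarith
      have h6 : (p.2 : ℝ) + 1 ≤ (M + 1) * p.1 := by nlinarith
      have h7 : (((p.1 : ℝ) + 1) * (p.2 + 1)) ^ 2 ≤ (4 * (M + 1) ^ 2) * (p.1 : ℝ) ^ 4 := by
        calc (((p.1 : ℝ) + 1) * (p.2 + 1)) ^ 2 ≤ ((2 * p.1) * ((M + 1) * p.1)) ^ 2 := by gcongr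
          _ = _ := by ring
      calc C / (p.1 : ℝ) ^ 4 ≤ |C| / (p.1 : ℝ) ^ 4 := by gcongr; exact le_abs_self C
        _ ≤ |C| * (4 * (M + 1) ^ 2) / (((p.1 : ℝ) + 1) * (p.2 + 1)) ^ 2 := by
            rw [div_le_div_iff₀ (by positivity) (by positivity), mul_assoc]
            gcongr
        _ = _ := by simp only [g]; field_simp
    · simp
  have hfin : ∑' p, P (F p) ≠ ∞ := by
    refine ne_top_of_le_ne_top ?_ (ENNReal.tsum_le_tsum hbound)
    rw [← ENNReal.ofReal_tsum_of_nonneg (fun p => ?_) hsum]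
    · exact ENNReal.ofReal_ne_top
    · have := hg0 p.1; have := hg0 p.2; positivity
  filter_upwards [ae_finite_setOfPred_mem hfin] with ω hω
  have htend : Tendsto (fun p : ℕ × ℕ => (root16 p.1 + e₁, root16 p.2 + e₂)) (highLoad α)
      cofinite := by
    have h1 : Tendsto (fun p : ℕ × ℕ => (root16 p.1 + e₁, root16 p.2 + e₂)) (highLoad α)
        (atTop ×ˢ atTop) :=
      (tendsto_atTop_mono (fun p => Nat.le_add_right _ e₁)
        (tendsto_root16.comp highLoad_tendsto_fst)).prodMk
      (tendsto_atTop_mono (fun p => Nat.le_add_right _ e₂)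
        (tendsto_root16.comp highLoad_tendsto_snd))
    refine h1.mono_right ?_
    rw [prod_atTop_atTop_eq]
    exact atTop_le_cofinite
  have hev : ∀ᶠ p in highLoad α,
      (((root16 p.2 + e₂) ^ 16 : ℕ) : ℝ) ≤ L * ((root16 p.1 + e₁) ^ 16 : ℕ) := by
    have h1 := (highLoad_tendsto_lattice' (α := α) e₂)
    have h2 := (highLoad_tendsto_lattice (α := α) e₁).const_mul L
    have h3 : 1 - α < L * α := by rwa [div_lt_iff₀ hα0] at hL
    filter_upwards [h1.eventually_lt h2 h3, highLoad_eventually_pos] with p hp hpos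
    have h : (0 : ℝ) < (p.1 : ℝ) + p.2 := by
      have : (0 : ℝ) < p.1 := by exact_mod_cast hpos.1
      positivity
    rw [← mul_div_assoc, div_lt_div_iff_of_pos_right h] at hp
    exact hp.le
  filter_upwards [htend.eventually hω.compl_mem_cofinite, hev,
    (tendsto_root16.comp highLoad_tendsto_fst).eventually_ge_atTop (a₀ + 1)] with p h1 h2 h3 hmem
  apply h1
  simp only [Function.comp] at h3
  simp only [hF]
  rw [if_pos ⟨by omega, by omega, h2⟩]
  exact hmem

end Hopfield

end

noncomputable section

namespace Hopfield

/-! ### Almost sure bounds on the resolvent of the Gram matrix -/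

open Matrix

/-- The Gram matrix `Ξ Ξᵀ` of the first `n` rows and `N` columns of an array. -/
def gram (w : ℕ → ℕ → ℝ) (n N : ℕ) : Matrix (Fin n) (Fin n) ℝ :=
  ∑ j : Fin N, vecMulVec (fun i : Fin n => w i j) (fun i : Fin n => w i j)

section
variable {w : ℕ → ℕ → ℝ} {n n' N N' : ℕ} {c u u' : ℝ}

theorem quadForm_gram (w : ℕ → ℕ → ℝ) (n N : ℕ) (x : Fin n → ℝ) :
    x ⬝ᵥ gram w n N *ᵥ x = ∑ j ∈ Finset.range N, (x ⬝ᵥ fun i : Fin n => w i j) ^ 2 := by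
  rw [gram, sum_mulVec, dotProduct_sum, ← Fin.sum_univ_eq_sum_range
    (fun j => (x ⬝ᵥ fun i : Fin n => w i j) ^ 2)]
  exact Finset.sum_congr rfl fun j _ => quadForm_vecMulVec _ _

theorem isHermitian_gram (w : ℕ → ℕ → ℝ) (n N : ℕ) : (gram w n N).IsHermitian := by
  rw [gram, IsHermitian, conjTranspose_sum]
  exact Finset.sum_congr rfl fun j _ => isHermitian_vecMulVec _

theorem isHermitian_smul_one_sub_gram (w : ℕ → ℕ → ℝ) (n N : ℕ) (u : ℝ) :
    (u • (1 : Matrix (Fin n) (Fin n) ℝ) - gram w n N).IsHermitian :=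
  (isHermitian_one.smul (IsSelfAdjoint.all u)).sub (isHermitian_gram w n N)

theorem quadForm_smul_one_sub_gram (w : ℕ → ℕ → ℝ) (n N : ℕ) (u : ℝ) (x : Fin n → ℝ) :
    x ⬝ᵥ (u • (1 : Matrix (Fin n) (Fin n) ℝ) - gram w n N) *ᵥ x
      = u * (x ⬝ᵥ x) - ∑ j ∈ Finset.range N, (x ⬝ᵥ fun i : Fin n => w i j) ^ 2 := by
  rw [sub_mulVec, dotProduct_sub, quadForm_gram, smul_mulVec, one_mulVec, dotProduct_smul,
    smul_eq_mul]

theorem smul_one_sub_gram_submatrix (h : n ≤ n') :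
    (u • (1 : Matrix (Fin n') (Fin n') ℝ) - gram w n' N).submatrix (Fin.castLE h) (Fin.castLE h)
      = u • (1 : Matrix (Fin n) (Fin n) ℝ) - gram w n N := by
  ext i k
  simp [gram, Matrix.sum_apply, Matrix.one_apply, vecMulVec_apply]

/-- The interpolation device: positivity and trace bounds survive deleting rows (principal
submatrix), deleting columns and raising the parameter. -/
theorem BarrierBound.gram_mono (hB : BarrierBound c (u • (1 : Matrix (Fin n') (Fin n') ℝ) - gram w n' N'))
    (hn : n ≤ n') (hN : N ≤ N') (hu : u ≤ u') :
    BarrierBound c (u' • (1 : Matrix (Fin n) (Fin n) ℝ) - gram w n N) := by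
  have hinj := Fin.castLE_injective hn
  have h1 : (u • (1 : Matrix (Fin n) (Fin n) ℝ) - gram w n N').PosDef := by
    rw [← smul_one_sub_gram_submatrix hn]
    exact hB.1.submatrix hinj
  have h2 : (u • (1 : Matrix (Fin n) (Fin n) ℝ) - gram w n N')⁻¹.trace ≤ c := by
    rw [← smul_one_sub_gram_submatrix hn]
    exact (PosDef.trace_inv_submatrix_le hB.1 hinj).trans hB.2
  have h3 : ((u' • (1 : Matrix (Fin n) (Fin n) ℝ) - gram w n N)
      - (u • (1 : Matrix (Fin n) (Fin n) ℝ) - gram w n N')).PosSemidef := by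
    refine PosSemidef.of_dotProduct_mulVec_nonneg ((isHermitian_smul_one_sub_gram _ _ _ _).sub
      (isHermitian_smul_one_sub_gram _ _ _ _)) fun x => ?_
    rw [star_trivial, sub_mulVec, dotProduct_sub, quadForm_smul_one_sub_gram,
      quadForm_smul_one_sub_gram]
    have h4 : ∑ j ∈ Finset.range N, (x ⬝ᵥ fun i : Fin n => w i j) ^ 2
        ≤ ∑ j ∈ Finset.range N', (x ⬝ᵥ fun i : Fin n => w i j) ^ 2 :=
      Finset.sum_le_sum_of_subset_of_nonneg (Finset.range_mono hN) fun _ _ _ => sq_nonneg _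
    have h5 : 0 ≤ x ⬝ᵥ x := by simpa using dotProduct_star_self_nonneg x
    nlinarith
  have h6 : (u' • (1 : Matrix (Fin n) (Fin n) ℝ) - gram w n N).PosDef := by
    have := h1.add_posSemidef h3
    rwa [add_sub_cancel] at this
  exact ⟨h6, (PosDef.trace_inv_le h1 h6 h3).trans h2⟩

/-- Moving the spectral parameter by `1 / c` beyond a point of positivity leaves a gap of that size.
-/
theorem PosDef.coercive_gram (h : (u • (1 : Matrix (Fin n) (Fin n) ℝ) - gram w n N).PosDef)
    (hc : 0 < c) (hu : u + 1 / c ≤ u') :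
    Coercive c (u' • (1 : Matrix (Fin n) (Fin n) ℝ) - gram w n N) := by
  refine ⟨isHermitian_smul_one_sub_gram _ _ _ _, fun x => ?_⟩
  have h1 := PosSemidef.quadForm_nonneg h.posSemidef x
  rw [quadForm_smul_one_sub_gram] at h1 ⊢
  have h5 : 0 ≤ x ⬝ᵥ x := by simpa using dotProduct_star_self_nonneg x
  have h6 : 1 / c * (x ⬝ᵥ x) ≤
      u' * (x ⬝ᵥ x) - ∑ j ∈ Finset.range N, (x ⬝ᵥ fun i : Fin n => w i j) ^ 2 := by nlinarith
  have h7 := mul_le_mul_of_nonneg_left h6 hc.le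
  rwa [← mul_assoc, mul_one_div_cancel hc.ne', one_mul] at h7

end

theorem add_mul_le_of_div_add_lt {x y T φ δ v : ℝ} (hT : 0 < T) (h : x / T / φ + y / T * δ < v) :
    x / φ + y * δ ≤ T * v := by
  have h4 := mul_le_mul_of_nonneg_left h.le hT.le
  calc x / φ + y * δ = T * (x / T / φ + y / T * δ) := by
        rw [mul_add, ← mul_assoc, mul_div_cancel₀ _ hT.ne', ← mul_div_assoc,
          mul_div_cancel₀ _ hT.ne']
    _ ≤ _ := h4

theorem le_div_add_of_lt_div_add {x y T φ δ v : ℝ} (hT : 0 < T) (h : v < x / T / φ + y / T / δ) :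
    T * v ≤ x / φ + y / δ := by
  have h4 := mul_le_mul_of_nonneg_left h.le hT.le
  calc T * v ≤ T * (x / T / φ + y / T / δ) := h4
    _ = _ := by
        rw [mul_add, ← mul_div_assoc, mul_div_cancel₀ _ hT.ne', ← mul_div_assoc,
          mul_div_cancel₀ _ hT.ne']

section
variable {Ω : Type*} [MeasurableSpace Ω] {P : Measure Ω} [IsProbabilityMeasure P]
  {ξ : ℕ → ℕ → Ω → ℝ}
  (hmeas : ∀ i j, Measurable (ξ i j)) (hindep : iIndepFun (fun p : ℕ × ℕ => ξ p.1 p.2) P)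
  (hident : ∀ i j, IdentDistrib (ξ i j) (ξ 0 0) P P) {m : ℝ} (hμ : EntryLaw (P.map (ξ 0 0)) m)
include hmeas hindep hident hμ

theorem lattice_upper_failure_le {φ ε L : ℝ} (hφ : 0 < φ) (hε : 0 < ε) (hφε : φ + 2 * ε < 1)
    (hL : 0 ≤ L) :
    ∃ (C : ℝ) (a₀ : ℕ), ∀ a b : ℕ, a₀ ≤ a → 0 < a →
      (((b ^ 16 : ℕ) : ℝ)) ≤ L * ((a ^ 16 : ℕ) : ℝ) →
      P {ω | ¬ BarrierBound (φ + ε) ((((a ^ 16 : ℕ) : ℝ) / φ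
          + ((b ^ 16 : ℕ) : ℝ) * ((1 + ε) * (1 - (φ + 2 * ε))⁻¹)) • (1 : Matrix (Fin (a ^ 16)) (Fin (a ^ 16)) ℝ)
          - gram (fun i j => ξ i j ω) (a ^ 16) (b ^ 16))} ≤ ENNReal.ofReal (C / (a : ℝ) ^ 4) := by
  have : IsProbabilityMeasure (P.map (ξ 0 0)) :=
    Measure.isProbabilityMeasure_map (hmeas 0 0).aemeasurable
  set κ := (1 - (φ + 2 * ε))⁻¹ with hκ
  have hκ0 : 0 < κ := by rw [hκ]; exact inv_pos.2 (by linarith)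
  set K := (400 * m ^ 2) ^ 2
  have hK : 0 ≤ K := by positivity
  set e := Real.exp (κ ^ 2 * ((φ + ε) / (ε * κ))) with he
  set D := (κ ^ 2 / ε ^ 2 + 1 / ε ^ 4) * (K * e ^ 2) with hD
  have hD0 : 0 ≤ D := by positivity
  obtain ⟨a₀, ha₀⟩ := exists_nat_ge (κ * K * √e / (2 * ε))
  refine ⟨φ ^ 2 + L * D, a₀, fun a b ha ha0 hb => ?_⟩
  have ha1 : (1 : ℝ) ≤ a := by exact_mod_cast ha0
  have hapos : (0 : ℝ) < a := by linarith
  -- With `n = a^16` and `y₀ = a^(-12)`, the initial potential costs `φ² / (n y₀) = φ² / a⁴`. The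
  -- step errors sum to order `a^16 · a^(-24)`, and `√y₁` is of order `a^(-6)`, small enough for
  -- `small`.
  have hd : BarrierData φ ε κ ((1 + ε) * κ) K (1 / (a : ℝ) ^ 12) (1 / (a : ℝ) ^ 12 * e) := by
    refine ⟨hφ, hε, hφε, rfl, rfl, hK, by positivity, rfl, ?_⟩
    have h1 : √(1 / (a : ℝ) ^ 12 * e) = √e / (a : ℝ) ^ 6 := by
      rw [one_div_mul_eq_div, Real.sqrt_div' _ (by positivity)]
      congr 1
      rw [show (a : ℝ) ^ 12 = ((a : ℝ) ^ 6) ^ 2 by ring, Real.sqrt_sq (by positivity)]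
    rw [h1, ← mul_div_assoc, div_le_iff₀ (by positivity)]
    rw [div_le_iff₀ (by positivity)] at ha₀
    have h2 : (a₀ : ℝ) ≤ (a : ℝ) ^ 6 :=
      (by exact_mod_cast ha : (a₀ : ℝ) ≤ a).trans (le_self_pow₀ ha1 (by norm_num))
    nlinarith
  have h := resolvent_upper_failure_le (N := b ^ 16) hd (hμ.quadLaw (a ^ 16)) (pow_pos ha0 16)
  refine (columns_mem_le hmeas hindep hident (a ^ 16) (b ^ 16) _).trans (h.trans ?_)
  refine ENNReal.ofReal_le_ofReal ?_
  have h2 : barrierError ε κ K (1 / (a : ℝ) ^ 12 * e) = D / (a : ℝ) ^ 24 := by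
    rw [barrierError, hD]
    field_simp
  rw [h2, add_div]
  push_cast at hb ⊢
  gcongr ?_ + ?_
  · apply le_of_eq
    field_simp
  · calc (b : ℝ) ^ 16 * (D / (a : ℝ) ^ 24) ≤ L * (a : ℝ) ^ 16 * (D / (a : ℝ) ^ 24) := by gcongr
      _ = L * D / (a : ℝ) ^ 8 := by field_simp
      _ ≤ L * D / (a : ℝ) ^ 4 := by
        exact div_le_div_of_nonneg_left (by positivity) (by positivity)
          (pow_le_pow_right₀ ha1 (by norm_num))

/-- The barrier ends at parameter `n/φ + N δ`, and `δ` tends to `1/(1-φ)` with `ε`. The strict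
inequality on `v` leaves room to start from `φ - ε` and to pass to the next lattice point. -/
theorem ae_eventually_barrierBound {α φ v : ℝ} (hα0 : 0 < α) (hφ : 0 < φ) (hφ1 : φ < 1)
    (hv : α / φ + (1 - α) / (1 - φ) < v) :
    ∀ᵐ ω ∂P, ∀ᶠ p : ℕ × ℕ in highLoad α, BarrierBound φ
      ((((p.1 : ℝ) + p.2) * v) • (1 : Matrix (Fin p.1) (Fin p.1) ℝ)
        - gram (fun i j => ξ i j ω) p.1 p.2) := by
  obtain ⟨ε, hε, hε1, hε2, hεv⟩ : ∃ ε : ℝ, 0 < ε ∧ ε < φ ∧ φ + ε < 1 ∧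
      α / (φ - ε) + (1 - α) * ((1 + ε) * (1 - (φ - ε + 2 * ε))⁻¹) < v := by
    have hc : ContinuousAt (fun ε : ℝ => α / (φ - ε)
        + (1 - α) * ((1 + ε) * (1 - (φ - ε + 2 * ε))⁻¹)) 0 := by
      have h1 : φ - 0 ≠ 0 := by linarith
      have h2 : 1 - (φ - 0 + 2 * 0) ≠ 0 := by linarith
      fun_prop (disch := assumption)
    have h1 : ∀ᶠ ε in 𝓝[>] (0 : ℝ), α / (φ - ε)
        + (1 - α) * ((1 + ε) * (1 - (φ - ε + 2 * ε))⁻¹) < v := by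
      refine (hc.eventually_lt continuousAt_const ?_).filter_mono nhdsWithin_le_nhds
      simpa [div_eq_mul_inv] using hv
    have h2 : ∀ᶠ ε in 𝓝[>] (0 : ℝ), ε < φ :=
      (eventually_lt_nhds hφ).filter_mono nhdsWithin_le_nhds
    have h3 : ∀ᶠ ε in 𝓝[>] (0 : ℝ), ε < 1 - φ :=
      (eventually_lt_nhds (by linarith)).filter_mono nhdsWithin_le_nhds
    obtain ⟨ε, a, b, c, d⟩ := (h1.and (h2.and (h3.and self_mem_nhdsWithin))).exists
    exact ⟨ε, d, b, by linarith, a⟩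
  set δ := (1 + ε) * (1 - (φ - ε + 2 * ε))⁻¹ with hδ
  set L := max 1 ((1 - α) / α + 1)
  obtain ⟨C, a₀, hC⟩ := lattice_upper_failure_le hmeas hindep hident hμ (φ := φ - ε) (ε := ε) (L := L)
    (by linarith) hε (by linarith) (by positivity)
  -- The lattice corner above `(N₁, N₂)` is used, since the bound is inherited by smaller systems.
  have h := ae_eventually_notMem_lattice (P := P) hα0 (L := L) (C := C)
    ((lt_add_one _).trans_le (le_max_right _ _)) _ hC 1 1
  filter_upwards [h] with ω hω
  have ht : Tendsto (fun p : ℕ × ℕ => (((root16 p.1 + 1) ^ 16 : ℕ) : ℝ) / ((p.1 : ℝ) + p.2) / (φ - ε)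
      + (((root16 p.2 + 1) ^ 16 : ℕ) : ℝ) / ((p.1 : ℝ) + p.2) * δ) (highLoad α)
      (𝓝 (α / (φ - ε) + (1 - α) * δ)) :=
    ((highLoad_tendsto_lattice 1).div_const _).add ((highLoad_tendsto_lattice' 1).mul_const _)
  filter_upwards [hω, ht.eventually_lt_const hεv, highLoad_eventually_pos] with p h1 h2 h3
  simp only [not_not, sub_add_cancel] at h1
  refine h1.gram_mono (le_root16_succ_pow _) (le_root16_succ_pow _) ?_
  have hT : (0 : ℝ) < (p.1 : ℝ) + p.2 := by
    have : (0 : ℝ) < p.1 := by exact_mod_cast h3.1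
    positivity
  exact add_mul_le_of_div_add_lt hT h2

theorem lattice_lower_failure_le {φ η θ L : ℝ} (hφ : 0 < φ) (hφ1 : φ < 1) (hη : 0 < η)
    (hθ : 0 < θ) (hL0 : 0 ≤ L) (hL : L < (1 - φ) ^ 2 / φ ^ 2) :
    ∃ (C : ℝ) (a₀ : ℕ), ∀ a b : ℕ, a₀ ≤ a → 0 < a →
      (((b ^ 16 : ℕ) : ℝ)) ≤ L * ((a ^ 16 : ℕ) : ℝ) →
      P {ω | Coercive (1 / (θ * ((a ^ 16 : ℕ) : ℝ))) ((((a ^ 16 : ℕ) : ℝ) / φ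
          + ((b ^ 16 : ℕ) : ℝ) / (1 - φ)) • (1 : Matrix (Fin (a ^ 16)) (Fin (a ^ 16)) ℝ)
          - gram (fun i j => ξ i j ω) (a ^ 16) (b ^ 16)) ∧
          ((((a ^ 16 : ℕ) : ℝ) / φ
          + ((b ^ 16 : ℕ) : ℝ) / (1 - φ)) • (1 : Matrix (Fin (a ^ 16)) (Fin (a ^ 16)) ℝ)
          - gram (fun i j => ξ i j ω) (a ^ 16) (b ^ 16))⁻¹.trace < φ - η}
        ≤ ENNReal.ofReal (C / (a : ℝ) ^ 4) := by
  have : IsProbabilityMeasure (P.map (ξ 0 0)) :=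
    Measure.isProbabilityMeasure_map (hmeas 0 0).aemeasurable
  have hs : 0 < 1 - φ := by linarith
  set K := (400 * m ^ 2) ^ 2
  have hK : 0 ≤ K := by positivity
  -- Minus the slope in the trace, per row, in the worst admissible case `N = L n`; it is positive
  -- by the bound on `L`.
  set g := 1 / φ - L * φ / (1 - φ) ^ 2 with hg
  have hg0 : 0 < g := by
    rw [lt_div_iff₀ (by positivity)] at hL
    rw [hg, sub_pos, div_lt_div_iff₀ (by positivity) hφ]
    nlinarith
  set w := η * g * (1 - φ) ^ 2 with hw
  have hw0 : 0 < w := by positivity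
  set D := (1 / φ + L / (1 - φ)) / θ ^ 2 with hD
  have hD0 : 0 < D := by positivity
  obtain ⟨a₀, ha₀⟩ := exists_nat_ge (2 * D / w)
  refine ⟨4 * L ^ 2 * K / (θ ^ 2 * w ^ 2), a₀, fun a b ha ha0 hb => ?_⟩
  have ha1 : (1 : ℝ) ≤ a := by exact_mod_cast ha0
  have hapos : (0 : ℝ) < a := by linarith
  set n : ℕ := a ^ 16 with hn
  set N : ℕ := b ^ 16 with hN
  have hn' : (n : ℝ) = (a : ℝ) ^ 16 := by rw [hn]; push_cast; rfl
  have hnpos : (0 : ℝ) < n := by rw [hn']; positivity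
  have hna : (a : ℝ) ≤ n := by rw [hn']; exact le_self_pow₀ ha1 (by norm_num)
  have hgn : g * n ≤ (n : ℝ) / φ - N * φ / (1 - φ) ^ 2 := by
    have h1 : (N : ℝ) * φ / (1 - φ) ^ 2 ≤ L * n * φ / (1 - φ) ^ 2 := by gcongr
    calc g * n = (n : ℝ) / φ - L * n * φ / (1 - φ) ^ 2 := by rw [hg]; ring
      _ ≤ _ := by linarith
  set W := η * ((n : ℝ) / φ - N * φ / (1 - φ) ^ 2) * (1 - φ) ^ 2
      - 1 / (θ * n) * ((n / φ + N / (1 - φ)) * (1 / (θ * n) * n)) with hWdef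
  -- The main term of `W` grows linearly in `n`, whereas coercivity at scale `θ n` keeps the
  -- leave-one-out correction below the constant `D`.
  have hW : w / 2 * n ≤ W := by
    have h1 : w * n ≤ η * ((n : ℝ) / φ - N * φ / (1 - φ) ^ 2) * (1 - φ) ^ 2 := by
      calc w * n = η * (g * n) * (1 - φ) ^ 2 := by rw [hw]; ring
        _ ≤ _ := by gcongr
    have h2 : 1 / (θ * n) * ((n / φ + N / (1 - φ)) * (1 / (θ * n) * n)) ≤ D := by
      calc 1 / (θ * n) * ((n / φ + N / (1 - φ)) * (1 / (θ * n) * n))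
          ≤ 1 / (θ * n) * ((n / φ + L * n / (1 - φ)) * (1 / (θ * n) * n)) := by gcongr
        _ = D := by rw [hD]; field_simp
    have h3 : D ≤ w / 2 * n := by
      rw [div_le_iff₀ hw0] at ha₀
      have h4 : (a₀ : ℝ) ≤ n := (by exact_mod_cast ha : (a₀ : ℝ) ≤ a).trans hna
      nlinarith
    linarith
  have hW0 : 0 < W := lt_of_lt_of_le (by positivity) hW
  have h := resolvent_lower_failure_le (N := N) hK (c := 1 / (θ * n)) (by positivity)
    (hμ.quadLaw n) hφ hφ1 (pow_pos ha0 16) hW0 rfl (lt_of_lt_of_le (by positivity) hgn)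
  refine (columns_mem_le hmeas hindep hident n N _).trans (h.trans ?_)
  refine ENNReal.ofReal_le_ofReal ?_
  calc (N : ℝ) ^ 2 * (K * ((1 / (θ * n)) ^ 2 * n)) / W ^ 2
      ≤ (L * n) ^ 2 * (K * ((1 / (θ * n)) ^ 2 * n)) / (w / 2 * n) ^ 2 := by gcongr
    _ = 4 * L ^ 2 * K / (θ ^ 2 * w ^ 2) / n := by field_simp; ring
    _ ≤ 4 * L ^ 2 * K / (θ ^ 2 * w ^ 2) / (a : ℝ) ^ 4 := by
      rw [hn']
      exact div_le_div_of_nonneg_left (by positivity) (by positivity)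
          (pow_le_pow_right₀ ha1 (by norm_num))

/-- Lower bounds on the trace pass to larger systems, so the lattice corner below `(N₁, N₂)` is
used. Positivity at the smaller `v'` supplies the coercivity needed at `v`. -/
theorem ae_eventually_le_trace {α φ v v' η : ℝ} (hα0 : 0 < α) (hφ : 0 < φ) (hφ1 : φ < 1)
    (hη : 0 < η) (hv : v < α / φ + (1 - α) / (1 - φ)) (hvv' : v' < v) (hα1 : α < 1)
    (hφα : (1 - α) / α < (1 - φ) ^ 2 / φ ^ 2)
    (hpos : ∀ᵐ ω ∂P, ∀ᶠ p : ℕ × ℕ in highLoad α,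
      ((((p.1 : ℝ) + p.2) * v') • (1 : Matrix (Fin p.1) (Fin p.1) ℝ)
        - gram (fun i j => ξ i j ω) p.1 p.2).PosDef) :
    ∀ᵐ ω ∂P, ∀ᶠ p : ℕ × ℕ in highLoad α, φ - η ≤
      ((((p.1 : ℝ) + p.2) * v) • (1 : Matrix (Fin p.1) (Fin p.1) ℝ)
        - gram (fun i j => ξ i j ω) p.1 p.2)⁻¹.trace := by
  obtain ⟨L, hL1, hL2⟩ := exists_between hφα
  have hL4 : 0 < L := (div_pos (by linarith) hα0).trans hL1
  set θ := v - v'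
  obtain ⟨C, a₀, hC⟩ := lattice_lower_failure_le hmeas hindep hident hμ (φ := φ) (η := η) (θ := θ)
    (L := L) hφ hφ1 hη (by simp only [θ]; linarith) hL4.le hL2
  have h := ae_eventually_notMem_lattice (P := P) hα0 (L := L) (C := C) hL1 _ hC 0 0
  filter_upwards [h, hpos] with ω hω hω'
  have ht : Tendsto (fun p : ℕ × ℕ => (((root16 p.1 + 0) ^ 16 : ℕ) : ℝ) / ((p.1 : ℝ) + p.2) / φ
      + (((root16 p.2 + 0) ^ 16 : ℕ) : ℝ) / ((p.1 : ℝ) + p.2) / (1 - φ)) (highLoad α)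
      (𝓝 (α / φ + (1 - α) / (1 - φ))) :=
    ((highLoad_tendsto_lattice 0).div_const _).add ((highLoad_tendsto_lattice' 0).div_const _)
  filter_upwards [hω, hω', ht.eventually_const_lt hv, highLoad_eventually_pos,
    (tendsto_root16.comp highLoad_tendsto_fst).eventually_ge_atTop 1] with p h1 h1' h2 h3 h5
  simp only [add_zero, Function.comp] at h1 h2 h5
  have hs : 0 < 1 - φ := by linarith
  have hT : (0 : ℝ) < (p.1 : ℝ) + p.2 := by
    have : (0 : ℝ) < p.1 := by exact_mod_cast h3.1
    positivity
  have h4 : ((p.1 : ℝ) + p.2) * v ≤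
      ((root16 p.1 ^ 16 : ℕ) : ℝ) / φ + ((root16 p.2 ^ 16 : ℕ) : ℝ) / (1 - φ) :=
    le_div_add_of_lt_div_add hT h2
  have hT' : ((p.1 : ℝ) + p.2) * v' ≤ ((p.1 : ℝ) + p.2) * v := by gcongr
  have hB' := BarrierBound.gram_mono (c := _) ⟨h1', le_rfl⟩ le_rfl le_rfl hT'
  have hB := BarrierBound.gram_mono (c := _) ⟨hB'.1, le_rfl⟩ (root16_pow_le _) (root16_pow_le _) h4
  have hB'' := BarrierBound.gram_mono (c := _) ⟨h1', le_rfl⟩ (root16_pow_le p.1) (root16_pow_le p.2)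
    (le_refl _)
  refine le_trans ?_ hB.2
  by_contra hlt
  refine h1 ⟨?_, not_le.1 hlt⟩
  have hnpos : (0 : ℝ) < ((root16 p.1 ^ 16 : ℕ) : ℝ) := by
    have : 0 < root16 p.1 ^ 16 := pow_pos h5 16
    exact_mod_cast this
  have hθ : 0 < θ := by simp only [θ]; linarith
  refine PosDef.coercive_gram hB''.1 (by positivity) ?_
  have h6 : ((root16 p.1 ^ 16 : ℕ) : ℝ) ≤ (p.1 : ℝ) + p.2 :=
    (by exact_mod_cast root16_pow_le p.1 : ((root16 p.1 ^ 16 : ℕ) : ℝ) ≤ p.1).trans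
      (le_add_of_nonneg_right p.2.cast_nonneg)
  rw [one_div_one_div]
  have h7 : θ * ((root16 p.1 ^ 16 : ℕ) : ℝ) ≤ θ * ((p.1 : ℝ) + p.2) := by gcongr
  have h8 : θ * ((p.1 : ℝ) + p.2) = ((p.1 : ℝ) + p.2) * v - ((p.1 : ℝ) + p.2) * v' := by
    simp only [θ]; ring
  linarith

end

end Hopfield

end

noncomputable section

namespace Hopfield

/-! ### The limiting resolvent and its almost sure attainment -/

open Matrix

/-- The limit of the largest eigenvalue of `Ξ Ξᵀ / (N₁ + N₂)`. -/
def topEdge (α : ℝ) : ℝ := (√α + √(1 - α)) ^ 2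

/-- The smaller root `φ` of `v φ² - (v - 1 + 2 α) φ + α = 0`, the limit of the trace of the
resolvent. -/
def branch (α v : ℝ) : ℝ :=
  ((v - 1 + 2 * α) - √((v - 1 + 2 * α) ^ 2 - 4 * α * v)) / (2 * v)

section
variable {α : ℝ}

theorem one_lt_topEdge (hα0 : 0 < α) (hα1 : α < 1) : 1 < topEdge α := by
  have h1 : 0 < √α := Real.sqrt_pos.2 hα0
  have h2 : 0 < √(1 - α) := Real.sqrt_pos.2 (by linarith)
  have h3 := Real.sq_sqrt hα0.le
  have h4 := Real.sq_sqrt (show 0 ≤ 1 - α by linarith)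
  rw [topEdge]
  nlinarith [mul_pos h1 h2]

/-- For `0 < x < 1` the quadratic has the sign of `α/x + (1-α)/(1-x) - v`. That function of `x` has
its minimum `topEdge α - v` at `√α / (√α + √(1-α))`, so for `v` beyond the edge this point separates
the two roots. -/
theorem branch_spec (hα0 : 0 < α) (hα1 : α < 1) {v : ℝ} (hv : topEdge α < v) :
    0 < branch α v ∧ branch α v < √α / (√α + √(1 - α)) ∧
    (∀ x, x < branch α v → 0 < v * x ^ 2 - (v - 1 + 2 * α) * x + α) ∧
    (∀ x, branch α v < x → x ≤ √α / (√α + √(1 - α)) →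
      v * x ^ 2 - (v - 1 + 2 * α) * x + α < 0) := by
  have hv1 := (one_lt_topEdge hα0 hα1).trans hv
  have hs : 0 < √α := Real.sqrt_pos.2 hα0
  have ht : 0 < √(1 - α) := Real.sqrt_pos.2 (by linarith)
  have h3 := Real.sq_sqrt hα0.le
  have h4 := Real.sq_sqrt (show 0 ≤ 1 - α by linarith)
  rw [topEdge] at hv
  set s := √α
  set t := √(1 - α)
  have hst := mul_pos hs ht
  set d := (v - 1 + 2 * α) ^ 2 - 4 * α * v with hd
  have hd0 : 0 < d := by
    -- The discriminant vanishes exactly at the two spectral edges `(√α ± √(1-α))²`.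
    have e : d = (v - (s + t) ^ 2) * (v - (s - t) ^ 2) := by
      have h5 : (1 - 2 * α) ^ 2 = (s + t) ^ 2 * (s - t) ^ 2 := by
        have h6 : 1 - 2 * α = -(s + t) * (s - t) := by linear_combination h3 - h4
        rw [h6]; ring
      have h7 : (s + t) ^ 2 + (s - t) ^ 2 = 2 := by linear_combination 2 * h3 + 2 * h4
      rw [hd]
      linear_combination h5 + v * h7
    rw [e]
    exact mul_pos (by linarith) (by nlinarith)
  have hr0 : 0 < √d := Real.sqrt_pos.2 hd0
  have hr := Real.sq_sqrt hd0.le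
  have hrB : √d < v - 1 + 2 * α := by
    rw [Real.sqrt_lt' (by linarith)]
    nlinarith
  set b' := ((v - 1 + 2 * α) + √d) / (2 * v) with hb'
  have hbb : branch α v < b' := by
    rw [branch, hb', ← hd]
    gcongr
    linarith
  have hfac : ∀ x, v * x ^ 2 - (v - 1 + 2 * α) * x + α = v * ((x - branch α v) * (x - b')) := by
    intro x
    rw [branch, hb', ← hd]
    field_simp
    linear_combination hr - hd
  have hc : v * (s / (s + t)) ^ 2 - (v - 1 + 2 * α) * (s / (s + t)) + α < 0 := by
    have e : v * (s / (s + t)) ^ 2 - (v - 1 + 2 * α) * (s / (s + t)) + α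
        = s * t * ((s + t) ^ 2 - v) / (s + t) ^ 2 := by
      have h0 : s + t ≠ 0 := by positivity
      field_simp
      have h1' : (1 : ℝ) = s ^ 2 + t ^ 2 := by linear_combination -h3 - h4
      rw [← h3]
      linear_combination (-s * (s + t)) * (-h1')
    rw [e]
    exact div_neg_of_neg_of_pos (mul_neg_of_pos_of_neg hst (by linarith)) (by positivity)
  have hc' := hc
  rw [hfac] at hc'
  have hc2 : (s / (s + t) - branch α v) * (s / (s + t) - b') < 0 := by
    by_contra hcon
    have := mul_nonneg (by linarith : (0 : ℝ) ≤ v) (not_lt.1 hcon)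
    linarith
  have hc3 : branch α v < s / (s + t) ∧ s / (s + t) < b' := by
    constructor <;> by_contra hcon <;> nlinarith
  refine ⟨?_, hc3.1, fun x hx => ?_, fun x hx hx' => ?_⟩
  · rw [branch, ← hd]
    exact div_pos (by linarith) (by linarith)
  · rw [hfac]
    exact mul_pos (by linarith) (mul_pos_of_neg_of_neg (by linarith) (by linarith))
  · rw [hfac]
    exact mul_neg_of_pos_of_neg (by linarith)
      (mul_neg_of_pos_of_neg (by linarith) (by linarith [hc3.2]))

theorem characteristic_sub {x v : ℝ} (hx : 0 < x) (hx1 : x < 1) :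
    α / x + (1 - α) / (1 - x) - v = (v * x ^ 2 - (v - 1 + 2 * α) * x + α) / (x * (1 - x)) := by
  have h1 : 1 - x ≠ 0 := by linarith
  field_simp
  ring

/-- States that `α/x + (1-α)/(1-x)` is strictly decreasing at `x`, which is the sign condition
needed by the leave-one-out bound. -/
theorem ratio_lt_of_lt_critical (hα0 : 0 < α) (hα1 : α < 1) {x : ℝ} (hx : 0 < x)
    (hxc : x < √α / (√α + √(1 - α))) : (1 - α) / α < (1 - x) ^ 2 / x ^ 2 := by
  have hs : 0 < √α := Real.sqrt_pos.2 hα0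
  have ht : 0 < √(1 - α) := Real.sqrt_pos.2 (by linarith)
  have h3 := Real.sq_sqrt hα0.le
  have h4 := Real.sq_sqrt (show 0 ≤ 1 - α by linarith)
  rw [lt_div_iff₀ (by positivity)] at hxc
  rw [← h4, div_lt_div_iff₀ hα0 (by positivity)]
  have h5 : √(1 - α) * x < (1 - x) * √α := by linarith
  calc √(1 - α) ^ 2 * x ^ 2 = (√(1 - α) * x) ^ 2 := by ring
    _ < ((1 - x) * √α) ^ 2 := by gcongr
    _ = _ := by rw [mul_pow, h3]

theorem critical_lt_one (hα1 : α < 1) : √α / (√α + √(1 - α)) < 1 := by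
  have ht : 0 < √(1 - α) := Real.sqrt_pos.2 (by linarith)
  rw [div_lt_one (by positivity)]
  linarith

theorem abs_sub_le_of_lattice {S S₀ S₁ N₀ N₁ n T η : ℝ} (hT : 0 < T) (hη : 0 < η) (m0 : S₀ ≤ S)
    (m1 : S ≤ S₁) (k0 : -(η / 2 * n) < S₀ - N₀) (k1 : S₁ - N₁ < η / 2 * n)
    (l0 : |N₀ / T - (1 - α)| ≤ η / 4) (l1 : |N₁ / T - (1 - α)| ≤ η / 4) (l2 : n / T < 3 / 2) :
    |S - (1 - α) * T| ≤ η * T := by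
  have a0 := abs_le.1 l0
  have a1 := abs_le.1 l1
  rw [div_lt_iff₀ hT] at l2
  have b0 : (1 - α - η / 4) * T ≤ N₀ := by
    rw [← le_div_iff₀ hT]; linarith [a0.1]
  have b1 : N₁ ≤ (1 - α + η / 4) * T := by
    rw [← div_le_iff₀ hT]; linarith [a1.2]
  have b2 : η / 2 * n ≤ η / 2 * (3 / 2 * T) := by gcongr
  rw [abs_le]
  constructor <;> nlinarith

theorem continuousAt_branch {v : ℝ} (hv : 0 < v) : ContinuousAt (branch α) v := by
  unfold branch
  have h : 2 * v ≠ 0 := by positivity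
  fun_prop (disch := assumption)

end

/-- The asymptotic spectral information on a fixed array `w` that the free energy depends on. -/
structure SpectralLimit (α : ℝ) (w : ℕ → ℕ → ℝ) : Prop where
  posDef : ∀ v, topEdge α < v → ∀ᶠ p : ℕ × ℕ in highLoad α,
    ((((p.1 : ℝ) + p.2) * v) • (1 : Matrix (Fin p.1) (Fin p.1) ℝ) - gram w p.1 p.2).PosDef
  trace : ∀ v, topEdge α < v → Tendsto (fun p : ℕ × ℕ =>
    ((((p.1 : ℝ) + p.2) * v) • (1 : Matrix (Fin p.1) (Fin p.1) ℝ) - gram w p.1 p.2)⁻¹.trace)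
    (highLoad α) (𝓝 (branch α v))
  diag : ∀ η, 0 < η → ∀ᶠ p : ℕ × ℕ in highLoad α, ∀ i < p.1,
    |∑ j ∈ Finset.range p.2, w i j ^ 2 - (1 - α) * ((p.1 : ℝ) + p.2)| ≤ η * ((p.1 : ℝ) + p.2)

/-! ### Almost sure spectral limits. -/

section
variable {Ω : Type*} [MeasurableSpace Ω] {P : Measure Ω} [IsProbabilityMeasure P]
  {ξ : ℕ → ℕ → Ω → ℝ}
  (hmeas : ∀ i j, Measurable (ξ i j)) (hindep : iIndepFun (fun p : ℕ × ℕ => ξ p.1 p.2) P)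
  (hident : ∀ i j, IdentDistrib (ξ i j) (ξ 0 0) P P) {m : ℝ} (hμ : EntryLaw (P.map (ξ 0 0)) m)
include hmeas hindep hident hμ

/-- The fourth moment gives each row a failure probability of order `N² / n⁴`; the union over `n`
rows still leaves order `1 / n`. The condition `0 ≤ a` is the lattice threshold `a₀ = 0`. -/
theorem lattice_diag_failure_le {η L : ℝ} (hη : 0 < η) :
    ∀ a b : ℕ, 0 ≤ a → 0 < a →
      (((b ^ 16 : ℕ) : ℝ)) ≤ L * ((a ^ 16 : ℕ) : ℝ) →
      P {ω | ∃ i < a ^ 16, η * ((a ^ 16 : ℕ) : ℝ)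
        ≤ |∑ j ∈ Finset.range (b ^ 16), (ξ i j ω ^ 2 - 1)|}
        ≤ ENNReal.ofReal ((4 * m * L) ^ 2 / η ^ 4 / (a : ℝ) ^ 4) := by
  intro a b _ ha0 hb
  have : IsProbabilityMeasure (P.map (ξ 0 0)) :=
    Measure.isProbabilityMeasure_map (hmeas 0 0).aemeasurable
  have ha1 : (1 : ℝ) ≤ a := by exact_mod_cast ha0
  set n : ℕ := a ^ 16 with hn
  set N : ℕ := b ^ 16 with hN
  have hn' : (n : ℝ) = (a : ℝ) ^ 16 := by rw [hn]; push_cast; rfl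
  have hnpos : (0 : ℝ) < n := by rw [hn']; positivity
  have hm := hμ.one_le
  have hrow : ∀ i, P {ω | η * (n : ℝ) ≤ |∑ j ∈ Finset.range N, (ξ i j ω ^ 2 - 1)|}
      ≤ ENNReal.ofReal ((4 * m * N) ^ 2 / (η * n) ^ 4) := by
    intro i
    obtain ⟨h1, h2⟩ := hμ.sum_sq N
    have hS : P {ω | η * (n : ℝ) ≤ |∑ j ∈ Finset.range N, (ξ i j ω ^ 2 - 1)|}
        ≤ (Measure.pi fun _ : Fin N => P.map (ξ 0 0))
          {x | (η * n) ^ 4 ≤ (∑ j, (x j ^ 2 - 1)) ^ 4} := by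
      rw [← map_row_eq_pi hmeas hindep hident i N]
      refine le_trans (measure_mono fun ω hω => ?_) (Measure.le_map_apply (by fun_prop) _)
      simp only [mem_preimage, mem_ofPred_eq] at hω ⊢
      rw [Fin.sum_univ_eq_sum_range (fun j => (ξ i j ω ^ 2 - 1)),
        ← Even.pow_abs (by decide) (∑ j ∈ Finset.range N, _)]
      gcongr
    refine hS.trans ?_
    have hmk := mul_meas_ge_le_integral_of_nonneg
      (ae_of_all (Measure.pi fun _ : Fin N => P.map (ξ 0 0))
        fun x => (by positivity : 0 ≤ (∑ j, (x j ^ 2 - 1)) ^ 4)) h1.2 ((η * n) ^ 4)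
    rw [ENNReal.le_ofReal_iff_toReal_le (measure_ne_top _ _) (by positivity),
      le_div_iff₀ (by positivity), mul_comm]
    exact hmk.trans h2
  have hU : {ω | ∃ i < n, η * (n : ℝ) ≤ |∑ j ∈ Finset.range N, (ξ i j ω ^ 2 - 1)|}
      ⊆ ⋃ i ∈ Finset.range n, {ω | η * (n : ℝ) ≤ |∑ j ∈ Finset.range N, (ξ i j ω ^ 2 - 1)|} := by
    rintro ω ⟨i, hi, h⟩
    simp only [mem_iUnion]
    exact ⟨i, Finset.mem_range.2 hi, h⟩
  refine (measure_mono hU).trans ((measure_biUnion_finset_le _ _).trans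
    ((Finset.sum_le_sum fun i _ => hrow i).trans ?_))
  rw [Finset.sum_const, Finset.card_range, ← ENNReal.ofReal_nsmul, nsmul_eq_mul]
  refine ENNReal.ofReal_le_ofReal ?_
  calc (n : ℝ) * ((4 * m * N) ^ 2 / (η * n) ^ 4)
      ≤ (n : ℝ) * ((4 * m * (L * n)) ^ 2 / (η * n) ^ 4) := by gcongr
    _ = (4 * m * L) ^ 2 / η ^ 4 / n := by field_simp
    _ ≤ (4 * m * L) ^ 2 / η ^ 4 / (a : ℝ) ^ 4 := by
      rw [hn']
      exact div_le_div_of_nonneg_left (by positivity) (by positivity)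
          (pow_le_pow_right₀ ha1 (by norm_num))

variable {α : ℝ} (hα0 : 0 < α) (hα1 : α < 1)
include hα0 hα1

theorem ae_eventually_barrierBound_branch {v x : ℝ} (hv : topEdge α < v) (hx : branch α v < x) :
    ∀ᵐ ω ∂P, ∀ᶠ p : ℕ × ℕ in highLoad α, BarrierBound x
      ((((p.1 : ℝ) + p.2) * v) • (1 : Matrix (Fin p.1) (Fin p.1) ℝ)
        - gram (fun i j => ξ i j ω) p.1 p.2) := by
  obtain ⟨h1, h2, h3, h4⟩ := branch_spec hα0 hα1 hv
  -- Truncation at the critical point keeps `y` between the two roots, where the quadratic is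
  -- negative.
  set y := min x (√α / (√α + √(1 - α)))
  have hy : branch α v < y := lt_min hx h2
  have hy0 : 0 < y := h1.trans hy
  have hy1 : y < 1 := (min_le_right _ _).trans_lt (critical_lt_one hα1)
  have h5 := h4 y hy (min_le_right _ _)
  have h6 : α / y + (1 - α) / (1 - y) < v := by
    rw [← sub_neg, characteristic_sub hy0 hy1]
    exact div_neg_of_neg_of_pos h5 (mul_pos hy0 (by linarith))
  filter_upwards [ae_eventually_barrierBound hmeas hindep hident hμ hα0 hy0 hy1 h6] with ω hω
  filter_upwards [hω] with p hp
  exact ⟨hp.1, hp.2.trans (min_le_left _ _)⟩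

theorem ae_eventually_posDef {v : ℝ} (hv : topEdge α < v) :
    ∀ᵐ ω ∂P, ∀ᶠ p : ℕ × ℕ in highLoad α,
      ((((p.1 : ℝ) + p.2) * v) • (1 : Matrix (Fin p.1) (Fin p.1) ℝ)
        - gram (fun i j => ξ i j ω) p.1 p.2).PosDef := by
  filter_upwards [ae_eventually_barrierBound_branch hmeas hindep hident hμ hα0 hα1 hv
    (lt_add_one (branch α v))] with ω hω
  exact hω.mono fun p hp => hp.1

theorem ae_eventually_lt_trace {v x : ℝ} (hv : topEdge α < v) (hx : x < branch α v) :
    ∀ᵐ ω ∂P, ∀ᶠ p : ℕ × ℕ in highLoad α, x <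
      ((((p.1 : ℝ) + p.2) * v) • (1 : Matrix (Fin p.1) (Fin p.1) ℝ)
        - gram (fun i j => ξ i j ω) p.1 p.2)⁻¹.trace := by
  obtain ⟨h1, h2, h3, h4⟩ := branch_spec hα0 hα1 hv
  obtain ⟨y, hy, hyb⟩ := exists_between (max_lt hx h1)
  have hy0 : 0 < y := (le_max_right _ _).trans_lt hy
  have hyx : x < y := (le_max_left _ _).trans_lt hy
  have hy1 : y < 1 := hyb.trans (h2.trans (critical_lt_one hα1))
  have h6 : v < α / y + (1 - α) / (1 - y) := by
    rw [← sub_pos, characteristic_sub hy0 hy1]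
    exact div_pos (h3 y hyb) (mul_pos hy0 (by linarith))
  obtain ⟨v', hv', hv''⟩ := exists_between hv
  filter_upwards [ae_eventually_le_trace hmeas hindep hident hμ hα0 hy0 hy1
    (η := (y - x) / 2) (by linarith) h6 hv'' hα1
    (ratio_lt_of_lt_critical hα0 hα1 hy0 (hyb.trans h2))
    (ae_eventually_posDef hmeas hindep hident hμ hα0 hα1 hv')] with ω hω
  filter_upwards [hω] with p hp
  linarith

theorem ae_eventually_diag {η : ℝ} (hη : 0 < η) :
    ∀ᵐ ω ∂P, ∀ᶠ p : ℕ × ℕ in highLoad α, ∀ i < p.1,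
      |∑ j ∈ Finset.range p.2, ξ i j ω ^ 2 - (1 - α) * ((p.1 : ℝ) + p.2)|
        ≤ η * ((p.1 : ℝ) + p.2) := by
  set L := (1 - α) / α + 1
  have hη2 : 0 < η / 2 := by linarith
  have h := lattice_diag_failure_le hmeas hindep hident hμ (L := L) hη2
  -- Row sums of squares increase with `N₂`, so they are squeezed between lattice points `e₂ = 0,
  -- 1`. In both cases `e₁ = 1`, so that every row `i < N₁` is covered.
  filter_upwards [ae_eventually_notMem_lattice (P := P) hα0 (lt_add_one _) _ h 1 0,
    ae_eventually_notMem_lattice (P := P) hα0 (lt_add_one _) _ h 1 1] with ω h0 h1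
  have hlim : ∀ e : ℕ, ∀ᶠ p : ℕ × ℕ in highLoad α,
      |(((root16 p.2 + e) ^ 16 : ℕ) : ℝ) / ((p.1 : ℝ) + p.2) - (1 - α)| ≤ η / 4 := by
    intro e
    filter_upwards [Metric.tendsto_nhds.1 (highLoad_tendsto_lattice' (α := α) e) (η / 4)
      (by linarith)] with p hp
    rw [Real.dist_eq] at hp
    exact hp.le
  have hlim1 := (highLoad_tendsto_lattice (α := α) 1).eventually_lt_const
    (show α < 3 / 2 by linarith)
  filter_upwards [h0, h1, hlim 0, hlim 1, hlim1, highLoad_eventually_pos] with p g0 g1 l0 l1 l2 hp i hi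
  have hT : (0 : ℝ) < (p.1 : ℝ) + p.2 := by
    have : (0 : ℝ) < p.1 := by exact_mod_cast hp.1
    positivity
  simp only [not_exists, not_and, not_le] at g0 g1
  have hi' : i < (root16 p.1 + 1) ^ 16 := hi.trans_le (le_root16_succ_pow _)
  have k0 := abs_lt.1 (g0 i hi')
  have k1 := abs_lt.1 (g1 i hi')
  have hmono : ∀ {A B : ℕ}, A ≤ B → ∑ j ∈ Finset.range A, ξ i j ω ^ 2
      ≤ ∑ j ∈ Finset.range B, ξ i j ω ^ 2 := fun hAB =>
    Finset.sum_le_sum_of_subset_of_nonneg (Finset.range_mono hAB) fun _ _ _ => sq_nonneg _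
  have m0 := hmono (root16_pow_le p.2)
  have m1 := hmono (le_root16_succ_pow p.2)
  simp only [Finset.sum_sub_distrib, Finset.sum_const, Finset.card_range, nsmul_eq_mul, mul_one,
    add_zero] at k0 k1
  simp only [add_zero] at l0
  exact abs_sub_le_of_lattice hT hη m0 m1 k0.1 k1.2 l0 l1 l2

/-- Rational parameters and levels keep the exceptional set null. All real `v` follow because the
trace decreases in `v` and `branch` is continuous. -/
theorem ae_spectralLimit : ∀ᵐ ω ∂P, SpectralLimit α (fun i j => ξ i j ω) := by
  have hup : ∀ᵐ ω ∂P, ∀ q k : ℚ, topEdge α < q → branch α q < k →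
      ∀ᶠ p : ℕ × ℕ in highLoad α, BarrierBound (k : ℝ)
      ((((p.1 : ℝ) + p.2) * q) • (1 : Matrix (Fin p.1) (Fin p.1) ℝ)
        - gram (fun i j => ξ i j ω) p.1 p.2) := by
    refine ae_all_iff.2 fun q => ae_all_iff.2 fun k => ?_
    by_cases h : topEdge α < q ∧ branch α q < k
    · filter_upwards [ae_eventually_barrierBound_branch hmeas hindep hident hμ hα0 hα1 h.1 h.2]
        with ω hω _ _ using hω
    · exact ae_of_all _ fun ω h1 h2 => absurd ⟨h1, h2⟩ h
  have hlo : ∀ᵐ ω ∂P, ∀ q k : ℚ, topEdge α < q → k < branch α q →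
      ∀ᶠ p : ℕ × ℕ in highLoad α, (k : ℝ) <
      ((((p.1 : ℝ) + p.2) * q) • (1 : Matrix (Fin p.1) (Fin p.1) ℝ)
        - gram (fun i j => ξ i j ω) p.1 p.2)⁻¹.trace := by
    refine ae_all_iff.2 fun q => ae_all_iff.2 fun k => ?_
    by_cases h : topEdge α < q ∧ k < branch α q
    · filter_upwards [ae_eventually_lt_trace hmeas hindep hident hμ hα0 hα1 h.1 h.2]
        with ω hω _ _ using hω
    · exact ae_of_all _ fun ω h1 h2 => absurd ⟨h1, h2⟩ h
  have hdi : ∀ᵐ ω ∂P, ∀ k : ℕ, ∀ᶠ p : ℕ × ℕ in highLoad α, ∀ i < p.1,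
      |∑ j ∈ Finset.range p.2, ξ i j ω ^ 2 - (1 - α) * ((p.1 : ℝ) + p.2)|
        ≤ 1 / ((k : ℝ) + 1) * ((p.1 : ℝ) + p.2) :=
    ae_all_iff.2 fun k => ae_eventually_diag hmeas hindep hident hμ hα0 hα1 (by positivity)
  have htop := one_lt_topEdge hα0 hα1
  filter_upwards [hup, hlo, hdi] with ω h1 h2 h3
  have hpos : ∀ v, topEdge α < v → ∀ᶠ p : ℕ × ℕ in highLoad α,
      ((((p.1 : ℝ) + p.2) * v) • (1 : Matrix (Fin p.1) (Fin p.1) ℝ)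
        - gram (fun i j => ξ i j ω) p.1 p.2).PosDef := by
    intro v hv
    obtain ⟨q, hq1, hq2⟩ := exists_rat_btwn hv
    obtain ⟨k, hk⟩ := exists_rat_gt (branch α q)
    filter_upwards [h1 q k hq1 hk] with p hp
    exact (hp.gram_mono le_rfl le_rfl (by gcongr)).1
  refine ⟨hpos, fun v hv => ?_, fun η hη => ?_⟩
  · have hc := continuousAt_branch (α := α) (by linarith : 0 < v)
    refine tendsto_order.2 ⟨fun x hx => ?_, fun x hx => ?_⟩
    · obtain ⟨k, hk1, hk2⟩ := exists_rat_btwn hx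
      have hev : ∀ᶠ u in 𝓝 v, (k : ℝ) < branch α u := hc.eventually_const_lt hk2
      obtain ⟨b, hb, hsub⟩ := mem_nhdsGT_iff_exists_Ioo_subset.1
        (hev.filter_mono (nhdsWithin_le_nhds (s := Ioi v)))
      obtain ⟨q, hq1, hq2⟩ := exists_rat_btwn (show v < b from hb)
      filter_upwards [h2 q k (hv.trans hq1) (hsub ⟨hq1, hq2⟩), hpos v hv] with p hp hp'
      refine hk1.trans (hp.trans_le ?_)
      exact (BarrierBound.gram_mono (c := _) ⟨hp', le_rfl⟩ le_rfl le_rfl (by gcongr)).2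
    · obtain ⟨k, hk1, hk2⟩ := exists_rat_btwn hx
      have hev : ∀ᶠ u in 𝓝 v, branch α u < k := hc.eventually_lt_const hk1
      obtain ⟨b, hb, hsub⟩ := mem_nhdsLT_iff_exists_Ioo_subset.1
        (hev.filter_mono (nhdsWithin_le_nhds (s := Iio v)))
      obtain ⟨q, hq1, hq2⟩ := exists_rat_btwn (show max b (topEdge α) < v from max_lt hb hv)
      filter_upwards [h1 q k ((le_max_right _ _).trans_lt hq1)
        (hsub ⟨(le_max_left _ _).trans_lt hq1, hq2⟩)] with p hp
      refine lt_of_le_of_lt ?_ hk2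
      exact (hp.gram_mono le_rfl le_rfl (by gcongr)).2
  · obtain ⟨k, hk⟩ := exists_nat_one_div_lt hη
    filter_upwards [h3 k] with p hp i hi
    exact (hp i hi).trans (by gcongr)

end

end Hopfield

end

noncomputable section

namespace Hopfield

/-! ### Integrals against the Marchenko–Pastur law -/

theorem hasDerivAt_arcsin_div {r x s : ℝ} (hr : 0 < r) (hs : 0 < s) (hx : s ^ 2 = r ^ 2 - x ^ 2) :
    HasDerivAt (fun y => Real.arcsin (y / r)) (1 / s) x := by
  have h1 : √(1 - (x / r) ^ 2) = s / r := by
    rw [show 1 - (x / r) ^ 2 = (s / r) ^ 2 by field_simp; linarith, Real.sqrt_sq (by positivity)]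
  have hx2 : x ^ 2 < r ^ 2 := by nlinarith
  have h2 : x / r ≠ -1 := by
    intro h
    rw [div_eq_iff hr.ne'] at h
    nlinarith
  have h3 : x / r ≠ 1 := by
    intro h
    rw [div_eq_iff hr.ne'] at h
    nlinarith
  have h := (Real.hasDerivAt_arcsin h2 h3).comp x ((hasDerivAt_id x).div_const r)
  rw [h1] at h
  refine h.congr_deriv ?_
  field_simp

theorem hasDerivAt_sqrt_sub_sq {r x s : ℝ} (hs : 0 < s) (hx : s ^ 2 = r ^ 2 - x ^ 2) :
    HasDerivAt (fun y => √(r ^ 2 - y ^ 2)) (-x / s) x := by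
  have hd : HasDerivAt (fun y => r ^ 2 - y ^ 2) (-(2 * x)) x := by
    simpa using (hasDerivAt_pow 2 x).const_sub (r ^ 2)
  have h := hd.sqrt (by rw [← hx]; positivity)
  rw [← hx, Real.sqrt_sq hs.le] at h
  refine h.congr_deriv ?_
  field_simp

/-- Supplies the antiderivative of `1 / ((w - x) √(r² - x²))` for `w > r`. -/
theorem hasDerivAt_arcsin_moebius {w r x s D : ℝ} (hr : 0 < r) (hs : 0 < s) (hD : 0 < D)
    (hx : s ^ 2 = r ^ 2 - x ^ 2) (hw : D ^ 2 = w ^ 2 - r ^ 2) (hxw : 0 < w - x) :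
    HasDerivAt (fun y => Real.arcsin ((w * y - r ^ 2) / (r * (w - y)))) (D / (s * (w - x))) x := by
  set u := (w * x - r ^ 2) / (r * (w - x)) with hu
  have h0 : 1 - u ^ 2 = (s * D / (r * (w - x))) ^ 2 := by
    rw [hu]
    have h1 : (s * D) ^ 2 = (r ^ 2 - x ^ 2) * (w ^ 2 - r ^ 2) := by rw [mul_pow, hx, hw]
    rw [div_pow, div_pow, h1, eq_div_iff (by positivity), sub_mul,
      div_mul_cancel₀ _ (by positivity)]
    ring
  have h1 : √(1 - u ^ 2) = s * D / (r * (w - x)) := by rw [h0, Real.sqrt_sq (by positivity)]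
  have hpos : 0 < 1 - u ^ 2 := by rw [h0]; positivity
  have h2 : u ≠ -1 := by intro h; rw [h] at hpos; norm_num at hpos
  have h3 : u ≠ 1 := by intro h; rw [h] at hpos; norm_num at hpos
  have hd : HasDerivAt (fun y => (w * y - r ^ 2) / (r * (w - y)))
      (D ^ 2 / (r * (w - x) ^ 2)) x := by
    have h := (((hasDerivAt_id x).const_mul w).sub_const (r ^ 2)).div
      (((hasDerivAt_id x).const_sub w).const_mul r) (by simp; exact ⟨hr.ne', hxw.ne'⟩)
    simp only [id] at h
    refine h.congr_deriv ?_
    rw [hw]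
    field_simp
    ring
  have h := (Real.hasDerivAt_arcsin h2 h3).comp x hd
  rw [h1] at h
  refine h.congr_deriv ?_
  field_simp

/-- An antiderivative comes from `√(r²-x²)/(w-x) = ((w+x) - (w²-r²)/(w-x)) / √(r²-x²)`. At `w = r`
the second piece vanishes and its Möbius argument degenerates, hence the separate case.
Integrability follows from nonnegativity of the derivative. -/
theorem semicircle_cauchy {w r : ℝ} (hr : 0 < r) (hw : r ≤ w) :
    IntervalIntegrable (fun x => √(r ^ 2 - x ^ 2) / (w - x)) volume (-r) r ∧
    ∫ x in (-r)..r, √(r ^ 2 - x ^ 2) / (w - x) = Real.pi * (w - √(w ^ 2 - r ^ 2)) := by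
  suffices h : ∃ F : ℝ → ℝ, ContinuousOn F (Icc (-r) r) ∧
      (∀ x ∈ Ioo (-r) r, HasDerivAt F (√(r ^ 2 - x ^ 2) / (w - x)) x) ∧
      F r - F (-r) = Real.pi * (w - √(w ^ 2 - r ^ 2)) by
    obtain ⟨F, hc, hF, hval⟩ := h
    have hle : -r ≤ r := by linarith
    have hi : IntervalIntegrable (fun x => √(r ^ 2 - x ^ 2) / (w - x)) volume (-r) r := by
      rw [intervalIntegrable_iff_integrableOn_Ioc_of_le hle]
      refine intervalIntegral.integrableOn_deriv_of_nonneg hc hF fun x hx => ?_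
      exact div_nonneg (Real.sqrt_nonneg _) (by linarith [hx.2])
    exact ⟨hi, by rw [intervalIntegral.integral_eq_sub_of_hasDerivAt_of_le hle hc hF hi, hval]⟩
  have hkey : ∀ x ∈ Ioo (-r) r, 0 < r ^ 2 - x ^ 2 := fun x hx => by nlinarith [hx.1, hx.2]
  have hasin : ContinuousOn (fun y => w * Real.arcsin (y / r) - √(r ^ 2 - y ^ 2)) (Icc (-r) r) := by
    have := Real.continuous_arcsin
    fun_prop
  have hderiv : ∀ x ∈ Ioo (-r) r, HasDerivAt (fun y => w * Real.arcsin (y / r) - √(r ^ 2 - y ^ 2))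
      ((w + x) / √(r ^ 2 - x ^ 2)) x := by
    intro x hx
    have hs := Real.sqrt_pos.2 (hkey x hx)
    have hs2 := Real.sq_sqrt (hkey x hx).le
    refine (((hasDerivAt_arcsin_div hr hs hs2).const_mul w).sub
      (hasDerivAt_sqrt_sub_sq hs hs2)).congr_deriv ?_
    field_simp
    ring
  rcases hw.eq_or_lt with rfl | hw
  · refine ⟨_, hasin, fun x hx => ?_, ?_⟩
    · refine (hderiv x hx).congr_deriv ?_
      have hs := Real.sqrt_pos.2 (hkey x hx)
      have hs2 := Real.sq_sqrt (hkey x hx).le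
      have hx' : r - x ≠ 0 := by linarith [hx.2]
      field_simp
      linarith
    · simp [hr.ne']
      ring
  · have hD0 : 0 < w ^ 2 - r ^ 2 := by nlinarith
    have hD := Real.sqrt_pos.2 hD0
    have hD2 := Real.sq_sqrt hD0.le
    refine ⟨fun y => (w * Real.arcsin (y / r) - √(r ^ 2 - y ^ 2))
      - √(w ^ 2 - r ^ 2) * Real.arcsin ((w * y - r ^ 2) / (r * (w - y))),
      hasin.sub (continuousOn_const.mul
        (Real.continuous_arcsin.comp_continuousOn (ContinuousOn.div (by fun_prop) (by fun_prop) ?_))),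
      fun x hx => ?_, ?_⟩
    · intro x hx
      exact mul_ne_zero hr.ne' (by linarith [hx.2])
    · have hs := Real.sqrt_pos.2 (hkey x hx)
      have hs2 := Real.sq_sqrt (hkey x hx).le
      have hx' : 0 < w - x := by linarith [hx.2]
      refine ((hderiv x hx).sub
        ((hasDerivAt_arcsin_moebius hr hs hD hs2 hD2 hx').const_mul _)).congr_deriv ?_
      field_simp
      linarith
    · have h1 : (w * r - r ^ 2) / (r * (w - r)) = 1 := by
        have : w - r ≠ 0 := by linarith
        field_simp
      have h2 : (w * -r - r ^ 2) / (r * (w - -r)) = -1 := by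
        have : w - -r ≠ 0 := by linarith
        field_simp
        ring
      simp only [h1, h2]
      simp [hr.ne']
      ring

/-- The Cauchy transform of the semicircle on `[a, b]`, up to and including the edge. -/
theorem semicircle_cauchy_Icc {a b l : ℝ} (hab : a < b) (hl : b ≤ l) :
    IntervalIntegrable (fun t => √((t - a) * (b - t)) / (l - t)) volume a b ∧
    ∫ t in a..b, √((t - a) * (b - t)) / (l - t)
      = Real.pi * (l - (a + b) / 2 - √((l - a) * (l - b))) := by
  obtain ⟨h1, h2⟩ := semicircle_cauchy (r := (b - a) / 2) (w := l - (a + b) / 2) (by linarith)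
    (by linarith)
  have e : ∀ t, √((t - a) * (b - t)) / (l - t)
      = √(((b - a) / 2) ^ 2 - (t - (a + b) / 2) ^ 2) / (l - (a + b) / 2 - (t - (a + b) / 2)) := by
    intro t
    rw [show ((b - a) / 2) ^ 2 - (t - (a + b) / 2) ^ 2 = (t - a) * (b - t) by ring,
      sub_sub_sub_cancel_right]
  simp_rw [e]
  constructor
  · have := h1.comp_sub_right ((a + b) / 2)
    convert this using 1 <;> ring
  · rw [intervalIntegral.integral_comp_sub_right
      (fun x => √(((b - a) / 2) ^ 2 - x ^ 2) / (l - (a + b) / 2 - x)),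
      show a - (a + b) / 2 = -((b - a) / 2) by ring, show b - (a + b) / 2 = (b - a) / 2 by ring, h2]
    congr 3
    ring

/-- The reflection `t ↦ a + b - t` turns `1/t` into the Cauchy kernel at `l = a + b`; the case `a =
0` is included. -/
theorem semicircle_inv {a b : ℝ} (ha : 0 ≤ a) (hab : a < b) :
    IntervalIntegrable (fun t => √((t - a) * (b - t)) / t) volume a b ∧
    ∫ t in a..b, √((t - a) * (b - t)) / t = Real.pi * ((a + b) / 2 - √(a * b)) := by
  obtain ⟨h1, h2⟩ := semicircle_cauchy_Icc hab (l := a + b) (by linarith)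
  have e : ∀ t, √((t - a) * (b - t)) / t
      = √(((a + b - t) - a) * (b - (a + b - t))) / (a + b - (a + b - t)) := by
    intro t
    congr 2 <;> ring
  simp_rw [e]
  constructor
  · have := (h1.comp_sub_left (a + b)).symm
    convert this using 1 <;> ring
  · rw [intervalIntegral.integral_comp_sub_left
      (fun x => √((x - a) * (b - x)) / (a + b - x)), add_sub_cancel_right, add_sub_cancel_left, h2]
    congr 1
    rw [add_sub_cancel_left, add_sub_cancel_right, mul_comm b a]
    ring

/-! ### Mass, Stieltjes transform and logarithmic integrability of the Marchenko–Pastur law. -/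

section
variable {α : ℝ}

theorem lamMinus_nonneg (α : ℝ) : 0 ≤ lamMinus α := sq_nonneg _

theorem lamMinus_lt_lamPlus (hα0 : 0 < α) (hα1 : α < 1) : lamMinus α < lamPlus α := by
  have h : 0 < √(α / (1 - α)) := Real.sqrt_pos.2 (div_pos hα0 (by linarith))
  rw [lamMinus, lamPlus]
  nlinarith

theorem lamMinus_add_lamPlus (hα0 : 0 < α) (hα1 : α < 1) :
    lamMinus α + lamPlus α = 2 / (1 - α) := by
  have h1 : 0 < 1 - α := by linarith
  have h := Real.sq_sqrt (div_pos hα0 h1).le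
  have e : lamMinus α + lamPlus α = 2 + 2 * √(α / (1 - α)) ^ 2 := by rw [lamMinus, lamPlus]; ring
  rw [e, h]
  field_simp
  ring

theorem lamMinus_mul_lamPlus (hα0 : 0 < α) (hα1 : α < 1) :
    lamMinus α * lamPlus α = ((1 - 2 * α) / (1 - α)) ^ 2 := by
  have h1 : 0 < 1 - α := by linarith
  have h := Real.sq_sqrt (div_pos hα0 h1).le
  have e : lamMinus α * lamPlus α = (1 - √(α / (1 - α)) ^ 2) ^ 2 := by rw [lamMinus, lamPlus]; ring
  rw [e, h]
  field_simp
  ring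

theorem topEdge_eq (hα1 : α < 1) : topEdge α = (1 - α) * lamPlus α := by
  have h1 : 0 < 1 - α := by linarith
  have h2 := Real.sq_sqrt h1.le
  have h3 : √(1 - α) ≠ 0 := (Real.sqrt_pos.2 h1).ne'
  rw [topEdge, lamPlus, Real.sqrt_div' _ h1.le]
  nth_rewrite 2 [← h2]
  field_simp
  ring

theorem lamPlus_pos (α : ℝ) : 0 < lamPlus α := by
  rw [lamPlus]
  positivity

theorem mpDensity_nonneg (hα0 : 0 < α) (hα1 : α < 1) (l : ℝ) : 0 ≤ mpDensity α l := by
  refine indicator_nonneg (fun t ht => ?_) l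
  have h1 : 0 < 1 - α := by linarith
  have h2 : 0 ≤ t := (lamMinus_nonneg α).trans ht.1
  positivity

theorem measurable_mpDensity (α : ℝ) : Measurable (mpDensity α) := by
  unfold mpDensity
  exact Measurable.indicator (by fun_prop) measurableSet_Icc

/-- Integration against the Marchenko–Pastur law. -/
theorem integral_marchenkoPastur (hα0 : 0 < α) (hα1 : α < 1) {f : ℝ → ℝ}
    (hf : IntervalIntegrable (fun t => √((t - lamMinus α) * (lamPlus α - t)) / t * f t) volume
      (lamMinus α) (lamPlus α)) :
    Integrable f (marchenkoPastur α) ∧ ∫ t, f t ∂(marchenkoPastur α)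
      = max (2 - 1 / α) 0 * f 0 + (1 - α) / (2 * Real.pi * α)
        * ∫ t in (lamMinus α)..(lamPlus α), √((t - lamMinus α) * (lamPlus α - t)) / t * f t := by
  have hle := (lamMinus_lt_lamPlus hα0 hα1).le
  have hm : Measurable fun l => ENNReal.ofReal (mpDensity α l) :=
    (measurable_mpDensity α).ennreal_ofReal
  have hfin : ∀ᵐ l ∂(volume : Measure ℝ), ENNReal.ofReal (mpDensity α l) < ∞ :=
    ae_of_all _ fun _ => ENNReal.ofReal_lt_top
  have e : (fun l => (ENNReal.ofReal (mpDensity α l)).toReal • f l)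
      = (Icc (lamMinus α) (lamPlus α)).indicator fun t => (1 - α) / (2 * Real.pi * α)
        * (√((t - lamMinus α) * (lamPlus α - t)) / t * f t) := by
    funext l
    rw [ENNReal.toReal_ofReal (mpDensity_nonneg hα0 hα1 l), smul_eq_mul, mpDensity]
    by_cases h : l ∈ Icc (lamMinus α) (lamPlus α)
    · simp only [indicator_of_mem h]; ring
    · simp only [indicator_of_notMem h, zero_mul]
  have hi : Integrable f (volume.withDensity fun l => ENNReal.ofReal (mpDensity α l)) := by
    rw [integrable_withDensity_iff_integrable_smul' hm hfin, e, integrable_indicator_iff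
      measurableSet_Icc]
    exact ((intervalIntegrable_iff_integrableOn_Icc_of_le hle).1 hf).const_mul _
  have hd : Integrable f (ENNReal.ofReal (2 - 1 / α) • Measure.dirac (0 : ℝ)) :=
    (integrable_dirac (by simp)).smul_measure ENNReal.ofReal_ne_top
  refine ⟨hd.add_measure hi, ?_⟩
  rw [marchenkoPastur, integral_add_measure hd hi, integral_smul_measure, integral_dirac,
    integral_withDensity_eq_integral_toReal_smul hm hfin, e, integral_indicator measurableSet_Icc,
    integral_const_mul, integral_Icc_eq_integral_Ioc, ← intervalIntegral.integral_of_le hle]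
  rw [ENNReal.toReal_ofReal', smul_eq_mul]

/-- Since `√(λ₋ λ₊) = |1 - 2α| / (1 - α)`, the continuous part has mass one for `α ≤ 1/2`, and
beyond that exactly the mass of the atom is missing. -/
theorem marchenkoPastur_univ_integral (hα0 : 0 < α) (hα1 : α < 1) :
    ∫ _, (1 : ℝ) ∂(marchenkoPastur α) = 1 := by
  obtain ⟨h1, h2⟩ := semicircle_inv (lamMinus_nonneg α) (lamMinus_lt_lamPlus hα0 hα1)
  have h := (integral_marchenkoPastur hα0 hα1 (f := fun _ => 1) (by simpa using h1)).2
  simp only [mul_one] at h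
  have h3 : 0 < 1 - α := by linarith
  rw [h, h2, lamMinus_add_lamPlus hα0 hα1, lamMinus_mul_lamPlus hα0 hα1, Real.sqrt_sq_eq_abs,
    abs_div, abs_of_pos h3]
  have hpi := Real.pi_pos
  rcases le_total α (1 / 2) with hc | hc
  · rw [max_eq_right (by rw [sub_nonpos, le_div_iff₀ hα0]; linarith), abs_of_nonneg (by linarith)]
    field_simp
    ring
  · rw [max_eq_left (by rw [sub_nonneg, div_le_iff₀ hα0]; linarith), abs_of_nonpos (by linarith)]
    field_simp
    ring

theorem isProbabilityMeasure_marchenkoPastur (hα0 : 0 < α) (hα1 : α < 1) :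
    IsProbabilityMeasure (marchenkoPastur α) := by
  have h := marchenkoPastur_univ_integral hα0 hα1
  rw [integral_const, smul_eq_mul, mul_one, measureReal_def] at h
  exact ⟨(ENNReal.toReal_eq_one_iff _).1 h⟩

theorem ae_mem_Icc_marchenkoPastur (α : ℝ) :
    ∀ᵐ l ∂(marchenkoPastur α), l ∈ Icc 0 (lamPlus α) := by
  rw [marchenkoPastur, ae_add_measure_iff]
  constructor
  · refine Measure.ae_smul_measure ?_ _
    refine (ae_dirac_iff (p := fun x => x ∈ Icc 0 (lamPlus α)) measurableSet_Icc).2 ?_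
    exact ⟨le_rfl, (lamPlus_pos α).le⟩
  · rw [ae_withDensity_iff (measurable_mpDensity α).ennreal_ofReal]
    refine ae_of_all _ fun l hl => ?_
    by_contra hcon
    refine hl ?_
    rw [mpDensity, indicator_of_notMem, ENNReal.ofReal_zero]
    exact fun h => hcon ⟨(lamMinus_nonneg α).trans h.1, h.2⟩

/-- The Stieltjes transform of the Marchenko–Pastur law, up to and including the edge. -/
theorem stieltjes_marchenkoPastur (hα0 : 0 < α) (hα1 : α < 1) {l : ℝ} (hl : lamPlus α ≤ l) :
    Integrable (fun t => (l - t)⁻¹) (marchenkoPastur α) ∧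
    ∫ t, (l - t)⁻¹ ∂(marchenkoPastur α) = (1 - α) / α * branch α ((1 - α) * l) := by
  have hlt := lamMinus_lt_lamPlus hα0 hα1
  have hl0 : 0 < l := (lamPlus_pos α).trans_le hl
  have h3 : 0 < 1 - α := by linarith
  obtain ⟨h1, h2⟩ := semicircle_inv (lamMinus_nonneg α) hlt
  obtain ⟨k1, k2⟩ := semicircle_cauchy_Icc hlt hl
  have hne : ∀ᵐ t ∂(volume : Measure ℝ), t ≠ 0 ∧ t ≠ l := by
    filter_upwards [Measure.ae_ne volume 0, Measure.ae_ne volume l] with t a b using ⟨a, b⟩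
  -- Partial fractions for `1 / (t (l - t))`.
  have hc : (fun t => √((t - lamMinus α) * (lamPlus α - t)) / t * (l - t)⁻¹)
      =ᵐ[volume] fun t => l⁻¹ * (√((t - lamMinus α) * (lamPlus α - t)) / t
        + √((t - lamMinus α) * (lamPlus α - t)) / (l - t)) := by
    filter_upwards [hne] with t ht
    have a : l - t ≠ 0 := sub_ne_zero.2 ht.2.symm
    have b := ht.1
    field_simp
    ring
  have hi := (h1.add k1).const_mul l⁻¹
  have hi' : IntervalIntegrable (fun t => √((t - lamMinus α) * (lamPlus α - t)) / t * (l - t)⁻¹)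
      volume (lamMinus α) (lamPlus α) := hi.congr_ae (ae_restrict_of_ae hc.symm)
  obtain ⟨r1, r2⟩ := integral_marchenkoPastur hα0 hα1 hi'
  refine ⟨r1, ?_⟩
  have hI : ∫ t in (lamMinus α)..(lamPlus α), √((t - lamMinus α) * (lamPlus α - t)) / t * (l - t)⁻¹
      = l⁻¹ * ((∫ t in (lamMinus α)..(lamPlus α), √((t - lamMinus α) * (lamPlus α - t)) / t)
        + Real.pi * (l - (lamMinus α + lamPlus α) / 2 - √((l - lamMinus α) * (l - lamPlus α)))) := by
    rw [intervalIntegral.integral_congr_ae (hc.mono fun t ht _ => ht),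
      intervalIntegral.integral_const_mul, intervalIntegral.integral_add h1 k1, k2]
  -- The total mass eliminates the atom together with the integral of the density part, avoiding a
  -- case split on `α`.
  have hmass := (integral_marchenkoPastur hα0 hα1 (f := fun _ => 1) (by simpa using h1)).2
  rw [marchenkoPastur_univ_integral hα0 hα1] at hmass
  simp only [mul_one] at hmass
  have hS : (1 - α) * √((l - lamMinus α) * (l - lamPlus α))
      = √(((1 - α) * l - 1 + 2 * α) ^ 2 - 4 * α * ((1 - α) * l)) := by
    rw [← Real.sqrt_sq h3.le, ← Real.sqrt_mul (sq_nonneg _), Real.sqrt_sq h3.le]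
    congr 1
    have e1 := lamMinus_add_lamPlus hα0 hα1
    have e2 := lamMinus_mul_lamPlus hα0 hα1
    have e3 : (l - lamMinus α) * (l - lamPlus α)
        = l ^ 2 - (lamMinus α + lamPlus α) * l + lamMinus α * lamPlus α := by ring
    rw [e3, e1, e2]
    field_simp
    ring
  rw [r2, hI, branch, ← hS, lamMinus_add_lamPlus hα0 hα1]
  have hpi := Real.pi_pos
  simp only [sub_zero]
  set J := ∫ t in (lamMinus α)..(lamPlus α), √((t - lamMinus α) * (lamPlus α - t)) / t
  set A := max (2 - 1 / α) 0
  set S := √((l - lamMinus α) * (l - lamPlus α))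
  have e4 : A = 1 - (1 - α) / (2 * Real.pi * α) * J := by linarith
  rw [e4]
  field_simp
  ring

theorem abs_log_le_add_inv {y : ℝ} (hy : 0 ≤ y) : |Real.log y| ≤ y + y⁻¹ := by
  rcases hy.eq_or_lt with rfl | hy
  · simp
  have h1 := Real.log_le_sub_one_of_pos hy
  have h2 := Real.log_le_sub_one_of_pos (inv_pos.2 hy)
  rw [Real.log_inv] at h2
  have h3 := inv_pos.2 hy
  rw [abs_le]
  constructor <;> linarith

/-- Even at the edge the logarithmic singularity is dominated by the resolvent, which is integrable
there. -/
theorem integrable_log_marchenkoPastur (hα0 : 0 < α) (hα1 : α < 1) {l : ℝ} (hl : lamPlus α ≤ l) :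
    Integrable (fun t => Real.log (l - t)) (marchenkoPastur α) := by
  have := isProbabilityMeasure_marchenkoPastur hα0 hα1
  refine Integrable.mono' ((integrable_const (l : ℝ)).add (stieltjes_marchenkoPastur hα0 hα1 hl).1)
    (Real.measurable_log.comp (measurable_const.sub measurable_id)).aestronglyMeasurable ?_
  filter_upwards [ae_mem_Icc_marchenkoPastur α] with t ht
  have h := abs_log_le_add_inv (y := l - t) (by linarith [ht.2])
  simp only [Real.norm_eq_abs, Pi.add_apply]
  linarith [ht.1]

end

end Hopfield

end

noncomputable section

namespace Hopfield

/-! ### Spherical integrals of Gaussian type -/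

section
variable {n : ℕ}

/-- Surface measure of a set is `n` times the volume of the cone over it, so it is the radial
projection of Lebesgue measure on the ball. -/
theorem map_toSphere_eq (ρ : ℝ) :
    ((volume : Measure (EuclideanSpace ℝ (Fin n))).toSphere).map
      (fun u : Metric.sphere (0 : EuclideanSpace ℝ (Fin n)) 1 => ρ • (u : EuclideanSpace ℝ (Fin n)))
      = (n : ℝ≥0∞) • (volume.restrict (Metric.ball (0 : EuclideanSpace ℝ (Fin n)) 1 \ {0})).map
          (fun x => (ρ / ‖x‖) • x) := by
  have hm1 : Measurable (fun u : Metric.sphere (0 : EuclideanSpace ℝ (Fin n)) 1 =>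
      ρ • (u : EuclideanSpace ℝ (Fin n))) := by fun_prop
  have hm2 : Measurable (fun x : EuclideanSpace ℝ (Fin n) => (ρ / ‖x‖) • x) := by fun_prop
  ext s hs
  rw [Measure.map_apply hm1 hs, Measure.toSphere_apply' _ (hm1 hs), Measure.smul_apply,
    Measure.map_apply hm2 hs, Measure.restrict_apply (hm2 hs), finrank_euclideanSpace_fin,
    smul_eq_mul]
  congr 2
  ext x
  simp only [Set.mem_smul, mem_image, mem_preimage, mem_inter_iff, Set.mem_sdiff, Metric.mem_ball,
    dist_zero_right, mem_singleton_iff]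
  constructor
  · rintro ⟨r, hr, y, ⟨u, hu, rfl⟩, rfl⟩
    have hu1 : ‖(u : EuclideanSpace ℝ (Fin n))‖ = 1 := by simp
    have hr0 : 0 < r := hr.1
    rw [norm_smul, hu1, mul_one, Real.norm_of_nonneg hr0.le]
    refine ⟨?_, hr.2, ?_⟩
    · rw [smul_smul, div_mul_cancel₀ _ hr0.ne']
      exact hu
    · rw [smul_eq_zero, not_or]
      refine ⟨hr0.ne', fun h => ?_⟩
      rw [h] at hu1
      simp at hu1
  · rintro ⟨hx, h1, h0⟩
    have hn : 0 < ‖x‖ := norm_pos_iff.2 h0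
    refine ⟨‖x‖, ⟨hn, h1⟩, ‖x‖⁻¹ • x, ⟨⟨‖x‖⁻¹ • x, ?_⟩, ?_, rfl⟩, ?_⟩
    · simp [norm_smul, hn.ne']
    · rw [smul_smul, ← div_eq_mul_inv]
      exact hx
    · rw [smul_smul, mul_inv_cancel₀ hn.ne', one_smul]

/-- The radial extension is homogeneous of degree zero, so the unit ball may be dilated. With radius
`R √n`, the projection only moves points outwards. -/
theorem integral_sphericalPrior (hn : 0 < n) {R : ℝ} (hR : 0 < R)
    {f : EuclideanSpace ℝ (Fin n) → ℝ} (hf : Measurable f) :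
    ∫ x, f x ∂(sphericalPrior n R)
      = (volume.real (Metric.ball (0 : EuclideanSpace ℝ (Fin n)) (R * √n)))⁻¹
        * ∫ x in Metric.ball (0 : EuclideanSpace ℝ (Fin n)) (R * √n),
          f ((R * √n / ‖x‖) • x) := by
  have hn' : (0 : ℝ) < n := by exact_mod_cast hn
  have : Nonempty (Fin n) := ⟨⟨0, hn⟩⟩
  set ρ := R * √n with hρ
  have hρ0 : 0 < ρ := by positivity
  have hm2 : Measurable (fun x : EuclideanSpace ℝ (Fin n) => (ρ / ‖x‖) • x) := by fun_prop
  have hset : (Metric.ball (0 : EuclideanSpace ℝ (Fin n)) 1 \ {0} : Set _)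
      =ᵐ[volume] Metric.ball (0 : EuclideanSpace ℝ (Fin n)) 1 :=
    sdiff_null_ae_eq_self (measure_singleton _)
  have hsc := Measure.setIntegral_comp_smul_of_pos volume
    (fun y : EuclideanSpace ℝ (Fin n) => f ((ρ / ‖y‖) • y)) (Metric.ball 0 1) hρ0
  have hcone : ∀ x : EuclideanSpace ℝ (Fin n), (ρ / ‖ρ • x‖) • ρ • x = (ρ / ‖x‖) • x := by
    intro x
    rw [smul_smul, norm_smul, Real.norm_of_nonneg hρ0.le]
    congr 1
    by_cases hx : ‖x‖ = 0
    · simp [hx]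
    · field_simp
  simp only [hcone] at hsc
  rw [smul_unitBall hρ0.ne', Real.norm_of_nonneg hρ0.le, finrank_euclideanSpace_fin, smul_eq_mul]
    at hsc
  have hvol : volume.real (Metric.ball (0 : EuclideanSpace ℝ (Fin n)) ρ)
      = ρ ^ n * volume.real (Metric.ball (0 : EuclideanSpace ℝ (Fin n)) 1) := by
    rw [measureReal_def, Measure.addHaar_ball_of_pos _ _ hρ0, ENNReal.toReal_mul,
      ENNReal.toReal_ofReal (by positivity), finrank_euclideanSpace_fin, measureReal_def]
  rw [sphericalPrior, ← hρ, map_toSphere_eq, Measure.toSphere_apply_univ,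
    finrank_euclideanSpace_fin, integral_smul_measure, integral_smul_measure,
    integral_map hm2.aemeasurable hf.aestronglyMeasurable, setIntegral_congr_set hset, hsc, hvol]
  rw [ENNReal.toReal_inv, ENNReal.toReal_mul, ENNReal.toReal_natCast, smul_eq_mul, smul_eq_mul,
    ← measureReal_def]
  have hv0 : 0 < volume.real (Metric.ball (0 : EuclideanSpace ℝ (Fin n)) 1) :=
    ENNReal.toReal_pos (Metric.measure_ball_pos _ _ one_pos).ne' measure_ball_lt_top.ne
  field_simp

/-- The integral over the ball of radius `ρ` of the radially constant extension of
`exp (β/2 ∑ μ_i y_i²)` from the sphere of radius `ρ`. -/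
def coneIntegral (β ρ : ℝ) (μ : Fin n → ℝ) : ℝ :=
  ∫ y in {y : Fin n → ℝ | ∑ i, y i ^ 2 < ρ ^ 2},
    Real.exp (β / 2 * (∑ i, μ i * y i ^ 2) * (ρ ^ 2 / ∑ i, y i ^ 2))

theorem setIntegral_ball_eq (b : OrthonormalBasis (Fin n) ℝ (EuclideanSpace ℝ (Fin n))) {ρ : ℝ}
    (hρ : 0 < ρ) (F : (Fin n → ℝ) → ℝ) :
    ∫ x in Metric.ball (0 : EuclideanSpace ℝ (Fin n)) ρ, F (WithLp.ofLp (b.repr x))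
      = ∫ y in {y : Fin n → ℝ | ∑ i, y i ^ 2 < ρ ^ 2}, F y := by
  have h1 := (PiLp.volume_preserving_ofLp (Fin n)).comp b.measurePreserving_repr
  have h2 : MeasurableEmbedding (WithLp.ofLp ∘ b.repr : EuclideanSpace ℝ (Fin n) → Fin n → ℝ) :=
    (((EuclideanSpace.equiv (Fin n) ℝ).toHomeomorph.measurableEmbedding)).comp
      b.repr.toHomeomorph.measurableEmbedding
  rw [← h1.setIntegral_preimage_emb h2]
  congr 2
  ext x
  simp only [Metric.mem_ball, dist_zero_right, mem_preimage, Function.comp, mem_ofPred_eq]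
  have h3 : ∑ i, (WithLp.ofLp (b.repr x)) i ^ 2 = ‖x‖ ^ 2 := by
    rw [← b.repr.norm_map x, EuclideanSpace.norm_sq_eq]
    simp
  rw [h3]
  exact (pow_lt_pow_iff_left₀ (norm_nonneg x) hρ.le two_ne_zero).symm

/-- Rotating to an eigenbasis preserves the ball, and the zero spectrum gives its volume, so the
normalisation can be treated by the same asymptotics. -/
theorem integral_sphericalPrior_exp (hn : 0 < n) {R β : ℝ} (hR : 0 < R) {μ : Fin n → ℝ}
    (b : OrthonormalBasis (Fin n) ℝ (EuclideanSpace ℝ (Fin n)))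
    {Q : EuclideanSpace ℝ (Fin n) → ℝ} (hQ : ∀ x, Q x = ∑ i, μ i * (b.repr x i) ^ 2) :
    ∫ x, Real.exp (β / 2 * Q x) ∂(sphericalPrior n R)
      = coneIntegral β (R * √n) μ / coneIntegral β (R * √n) (0 : Fin n → ℝ) := by
  have hn' : (0 : ℝ) < n := by exact_mod_cast hn
  have hρ : 0 < R * √n := by positivity
  have hQm : Measurable Q := by
    have : Q = fun x => ∑ i, μ i * (b.repr x i) ^ 2 := funext hQ
    rw [this]
    fun_prop
  rw [integral_sphericalPrior hn hR (f := fun x => Real.exp (β / 2 * Q x)) (by fun_prop),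
    div_eq_inv_mul (coneIntegral β (R * √n) μ)]
  congr 1
  · congr 1
    have h := setIntegral_ball_eq b hρ (fun _ => 1)
    rw [coneIntegral]
    simp only [Pi.zero_apply, zero_mul, Finset.sum_const_zero, mul_zero, Real.exp_zero]
    rw [← h]
    simp
  · rw [coneIntegral, ← setIntegral_ball_eq b hρ]
    refine setIntegral_congr_fun Metric.isOpen_ball.measurableSet fun x _ => ?_
    have h3 : ∑ i, (WithLp.ofLp (b.repr x)) i ^ 2 = ‖x‖ ^ 2 := by
      rw [← b.repr.norm_map x, EuclideanSpace.norm_sq_eq]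
      simp
    simp only [h3]
    congr 1
    rw [hQ, mul_assoc, Finset.sum_mul]
    congr 1
    refine Finset.sum_congr rfl fun i _ => ?_
    rw [map_smul]
    simp only [PiLp.smul_apply, smul_eq_mul]
    ring

/-! ### Gaussian upper and lower bounds for cone integrals. -/

variable {β ρ v : ℝ} {μ : Fin n → ℝ}

theorem measurableSet_sum_sq_lt (n : ℕ) (r : ℝ) :
    MeasurableSet {y : Fin n → ℝ | ∑ i, y i ^ 2 < r} :=
  measurableSet_lt (by fun_prop) measurable_const

/-- Write the form as `v |y|² - ∑ (v - μᵢ) yᵢ²`. Radial scaling by `ρ²/|y|² ≥ 1` makes the first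
term exactly `v ρ²` and can only enlarge the subtracted one. -/
theorem exp_cone_le (hβ : 0 ≤ β) (hv : 0 ≤ v) (hμv : ∀ i, μ i ≤ v) {y : Fin n → ℝ}
    (hy : ∑ i, y i ^ 2 < ρ ^ 2) :
    Real.exp (β / 2 * (∑ i, μ i * y i ^ 2) * (ρ ^ 2 / ∑ i, y i ^ 2))
      ≤ Real.exp (β / 2 * v * ρ ^ 2) * ∏ i, Real.exp (-(β / 2 * (v - μ i)) * y i ^ 2) := by
  rw [← Real.exp_sum, ← Real.exp_add, Real.exp_le_exp]
  set N := ∑ i, y i ^ 2 with hN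
  have e1 : ∑ i, -(β / 2 * (v - μ i)) * y i ^ 2 = -(β / 2) * ∑ i, (v - μ i) * y i ^ 2 := by
    rw [Finset.mul_sum]
    exact Finset.sum_congr rfl fun i _ => by ring
  have e2 : ∑ i, μ i * y i ^ 2 = v * N - ∑ i, (v - μ i) * y i ^ 2 := by
    rw [hN, Finset.mul_sum, ← Finset.sum_sub_distrib]
    exact Finset.sum_congr rfl fun i _ => by ring
  have hP : 0 ≤ ∑ i, (v - μ i) * y i ^ 2 :=
    Finset.sum_nonneg fun i _ => mul_nonneg (sub_nonneg.2 (hμv i)) (sq_nonneg _)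
  have hN0 : 0 ≤ N := Finset.sum_nonneg fun i _ => sq_nonneg _
  rw [e1, e2]
  set p := ∑ i, (v - μ i) * y i ^ 2 with hp
  rcases hN0.eq_or_lt with h0 | h0
  · have hz : ∀ i, y i = 0 := by
      intro i
      have := (Finset.sum_eq_zero_iff_of_nonneg fun i _ => sq_nonneg (y i)).1 h0.symm i
        (Finset.mem_univ i)
      simpa using this
    have hp0 : p = 0 := by rw [hp]; simp [hz]
    rw [hp0, ← h0]
    simp only [mul_zero, sub_zero, zero_mul, add_zero]
    positivity
  · have h1 : 1 ≤ ρ ^ 2 / N := by rw [one_le_div h0]; exact hy.le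
    have h2 : β / 2 * (v * N - p) * (ρ ^ 2 / N)
        = β / 2 * v * ρ ^ 2 - β / 2 * p * (ρ ^ 2 / N) := by
      field_simp
    have h3 : β / 2 * p * 1 ≤ β / 2 * p * (ρ ^ 2 / N) := by gcongr
    rw [h2]
    linarith

theorem integrable_prod_gaussian {c : Fin n → ℝ} (hc : ∀ i, 0 < c i) :
    Integrable fun y : Fin n → ℝ => ∏ i, Real.exp (-(c i) * y i ^ 2) :=
  Integrable.fintype_prod (f := fun i x => Real.exp (-(c i) * x ^ 2))
    fun i => integrable_exp_neg_mul_sq (hc i)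

theorem integral_prod_gaussian (c : Fin n → ℝ) :
    ∫ y : Fin n → ℝ, ∏ i, Real.exp (-(c i) * y i ^ 2) = ∏ i, √(Real.pi / c i) := by
  rw [integral_fintype_prod_volume_eq_prod (f := fun i x => Real.exp (-(c i) * x ^ 2))]
  exact Finset.prod_congr rfl fun i _ => integral_gaussian _

theorem integrableOn_cone (hβ : 0 < β) (hv : 0 ≤ v) (hμv : ∀ i, μ i < v) :
    IntegrableOn (fun y : Fin n → ℝ =>
      Real.exp (β / 2 * (∑ i, μ i * y i ^ 2) * (ρ ^ 2 / ∑ i, y i ^ 2)))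
      {y : Fin n → ℝ | ∑ i, y i ^ 2 < ρ ^ 2} := by
  refine Integrable.mono' (((integrable_prod_gaussian (c := fun i => β / 2 * (v - μ i))
    fun i => ?_).const_mul (Real.exp (β / 2 * v * ρ ^ 2))).integrableOn)
    (by fun_prop) ?_
  · have := sub_pos.2 (hμv i)
    positivity
  · filter_upwards [ae_restrict_mem (measurableSet_sum_sq_lt n (ρ ^ 2))] with y hy
    rw [Real.norm_of_nonneg (Real.exp_pos _).le]
    exact exp_cone_le hβ.le hv (fun i => (hμv i).le) hy

theorem coneIntegral_le (hβ : 0 < β) (hv : 0 ≤ v) (hμv : ∀ i, μ i < v) :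
    coneIntegral β ρ μ
      ≤ Real.exp (β / 2 * v * ρ ^ 2) * ∏ i, √(Real.pi / (β / 2 * (v - μ i))) := by
  have hint := (integrable_prod_gaussian (c := fun i => β / 2 * (v - μ i)) fun i => by
    have := sub_pos.2 (hμv i)
    positivity).const_mul (Real.exp (β / 2 * v * ρ ^ 2))
  rw [← integral_prod_gaussian, ← integral_const_mul, coneIntegral]
  refine (setIntegral_mono_on (integrableOn_cone hβ hv hμv) hint.integrableOn
    (measurableSet_sum_sq_lt n _) fun y hy => exp_cone_le hβ.le hv (fun i => (hμv i).le) hy).trans ?_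
  refine setIntegral_le_integral hint (ae_of_all _ fun y => ?_)
  simp only [Pi.zero_apply]
  positivity

/-- The product of a Gaussian in all coordinates but the `k`-th and the indicator of a unit
interval in the `k`-th. -/
def slab (k : Fin n) (t : ℝ) (c : Fin n → ℝ) (y : Fin n → ℝ) : ℝ :=
  ∏ i, if i = k then (Icc t (t + 1)).indicator (fun _ => (1 : ℝ)) (y i)
    else Real.exp (-(c i) * y i ^ 2)

theorem slab_eq (k : Fin n) (t : ℝ) (c : Fin n → ℝ) (y : Fin n → ℝ) :
    slab k t c y = (Icc t (t + 1)).indicator (fun _ => (1 : ℝ)) (y k)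
      * Real.exp (-∑ i ∈ Finset.univ.erase k, c i * y i ^ 2) := by
  rw [slab, ← Finset.mul_prod_erase _ _ (Finset.mem_univ k), if_pos rfl, ← Finset.sum_neg_distrib,
    Real.exp_sum]
  congr 1
  refine Finset.prod_congr rfl fun i hi => ?_
  rw [if_neg (Finset.ne_of_mem_erase hi), neg_mul]

theorem integrable_slab (k : Fin n) (t : ℝ) {c : Fin n → ℝ} (hc : ∀ i, 0 < c i) :
    Integrable (slab k t c) := by
  refine Integrable.fintype_prod (f := fun i x => if i = k then
    (Icc t (t + 1)).indicator (fun _ => (1 : ℝ)) x else Real.exp (-(c i) * x ^ 2)) fun i => ?_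
  by_cases h : i = k
  · simp only [h, if_true]
    exact (integrable_indicator_iff measurableSet_Icc).2 (integrableOn_const (by simp))
  · simp only [h, if_false]
    exact integrable_exp_neg_mul_sq (hc i)

theorem integral_slab (k : Fin n) (t : ℝ) (c : Fin n → ℝ) :
    ∫ y, slab k t c y = ∏ i ∈ Finset.univ.erase k, √(Real.pi / c i) := by
  have h := integral_fintype_prod_volume_eq_prod (𝕜 := ℝ) (ι := Fin n) (E := fun _ => ℝ)
    (fun i x => if i = k then
    (Icc t (t + 1)).indicator (fun _ => (1 : ℝ)) x else Real.exp (-(c i) * x ^ 2))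
  simp only [slab]
  rw [h, ← Finset.mul_prod_erase _ _ (Finset.mem_univ k)]
  have h1 : ∫ x, (Icc t (t + 1)).indicator (fun _ => (1 : ℝ)) x = 1 := by
    rw [integral_indicator measurableSet_Icc]
    simp
  simp only [if_true, h1, one_mul]
  refine Finset.prod_congr rfl fun i hi => ?_
  simp only [if_neg (Finset.ne_of_mem_erase hi)]
  exact integral_gaussian _

/-- Coordinate `k` is confined to `[t, t+1]` and carries energy at least `u t²`; the others should
have squared norm `s` in `[a, A]`. Outside that window the left side is nonpositive, since a
subtracted Chernoff term with `v` tilted by `∓τ` dominates. Inside it the point lies in the ball and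
the exponents compare directly. -/
theorem slab_le_exp_cone (hβ : 0 ≤ β) (hv : 0 ≤ v) (hμ : ∀ i, 0 ≤ μ i) {k : Fin n} {t u a A τ : ℝ}
    (ht : 0 ≤ t) (hu : u ≤ μ k) (hτ : 0 ≤ τ) (hA : A + (t + 1) ^ 2 < ρ ^ 2) (y : Fin n → ℝ) :
    Real.exp (β / 2 * (u * t ^ 2 + v * a)) * (slab k t (fun i => β / 2 * (v - μ i)) y
      - Real.exp (-(β / 2 * τ * A)) * slab k t (fun i => β / 2 * (v - τ - μ i)) y
      - Real.exp (β / 2 * τ * a) * slab k t (fun i => β / 2 * (v + τ - μ i)) y)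
    ≤ {y : Fin n → ℝ | ∑ i, y i ^ 2 < ρ ^ 2}.indicator (fun y =>
      Real.exp (β / 2 * (∑ i, μ i * y i ^ 2) * (ρ ^ 2 / ∑ i, y i ^ 2))) y := by
  have hR0 : 0 ≤ {y : Fin n → ℝ | ∑ i, y i ^ 2 < ρ ^ 2}.indicator (fun y =>
      Real.exp (β / 2 * (∑ i, μ i * y i ^ 2) * (ρ ^ 2 / ∑ i, y i ^ 2))) y :=
    indicator_nonneg (fun _ _ => (Real.exp_pos _).le) _
  simp only [slab_eq]
  by_cases hk : y k ∈ Icc t (t + 1)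
  swap
  · simpa [indicator_of_notMem hk] using hR0
  simp only [indicator_of_mem hk, one_mul]
  set s := ∑ i ∈ Finset.univ.erase k, y i ^ 2 with hs
  set g := ∑ i ∈ Finset.univ.erase k, β / 2 * (v - μ i) * y i ^ 2 with hg
  have e1 : ∑ i ∈ Finset.univ.erase k, β / 2 * (v - τ - μ i) * y i ^ 2 = g - β / 2 * τ * s := by
    rw [hg, hs, Finset.mul_sum, ← Finset.sum_sub_distrib]
    exact Finset.sum_congr rfl fun i _ => by ring
  have e2 : ∑ i ∈ Finset.univ.erase k, β / 2 * (v + τ - μ i) * y i ^ 2 = g + β / 2 * τ * s := by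
    rw [hg, hs, Finset.mul_sum, ← Finset.sum_add_distrib]
    exact Finset.sum_congr rfl fun i _ => by ring
  rw [e1, e2, ← Real.exp_add, ← Real.exp_add]
  set θ := β / 2 * τ with hθ
  have hθ0 : 0 ≤ θ := by positivity
  have hpos := Real.exp_pos (β / 2 * (u * t ^ 2 + v * a))
  by_cases hsA : A < s
  · refine le_trans (mul_nonpos_of_nonneg_of_nonpos hpos.le ?_) hR0
    have h1 : Real.exp (-g) ≤ Real.exp (-(θ * A) + -(g - θ * s)) :=
      Real.exp_le_exp.2 (by nlinarith)
    have h2 := Real.exp_pos (θ * a + -(g + θ * s))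
    linarith
  by_cases hsa : s < a
  · refine le_trans (mul_nonpos_of_nonneg_of_nonpos hpos.le ?_) hR0
    have h1 : Real.exp (-g) ≤ Real.exp (θ * a + -(g + θ * s)) :=
      Real.exp_le_exp.2 (by nlinarith)
    have h2 := Real.exp_pos (-(θ * A) + -(g - θ * s))
    linarith
  push Not at hsA hsa
  have hN : ∑ i, y i ^ 2 = y k ^ 2 + s := (Finset.add_sum_erase _ _ (Finset.mem_univ k)).symm
  have hM : ∑ i, μ i * y i ^ 2 = μ k * y k ^ 2 + ∑ i ∈ Finset.univ.erase k, μ i * y i ^ 2 :=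
    (Finset.add_sum_erase _ _ (Finset.mem_univ k)).symm
  have hyk : y k ^ 2 ≤ (t + 1) ^ 2 := pow_le_pow_left₀ (ht.trans hk.1) hk.2 2
  have hyk' : t ^ 2 ≤ y k ^ 2 := pow_le_pow_left₀ ht hk.1 2
  have hmem : y ∈ {y : Fin n → ℝ | ∑ i, y i ^ 2 < ρ ^ 2} := by
    change ∑ i, y i ^ 2 < ρ ^ 2
    rw [hN]
    linarith
  rw [indicator_of_mem hmem]
  have hM0 : 0 ≤ ∑ i, μ i * y i ^ 2 :=
    Finset.sum_nonneg fun i _ => mul_nonneg (hμ i) (sq_nonneg _)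
  have hN0 : 0 ≤ ∑ i, y i ^ 2 := Finset.sum_nonneg fun i _ => sq_nonneg _
  have hcone : β / 2 * (∑ i, μ i * y i ^ 2)
      ≤ β / 2 * (∑ i, μ i * y i ^ 2) * (ρ ^ 2 / ∑ i, y i ^ 2) := by
    rcases hN0.eq_or_lt with h0 | h0
    · have hz : ∀ i, y i = 0 := by
        intro i
        have := (Finset.sum_eq_zero_iff_of_nonneg fun i _ => sq_nonneg (y i)).1 h0.symm i
          (Finset.mem_univ i)
        simpa using this
      simp [hz]
    · exact le_mul_of_one_le_right (by positivity) (by rw [one_le_div h0]; exact hmem.le)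
  have e3 : g = β / 2 * (v * s - ∑ i ∈ Finset.univ.erase k, μ i * y i ^ 2) := by
    rw [hg, hs, Finset.mul_sum, ← Finset.sum_sub_distrib, Finset.mul_sum]
    exact Finset.sum_congr rfl fun i _ => by ring
  have h1 : Real.exp (β / 2 * (u * t ^ 2 + v * a)) * Real.exp (-g)
      ≤ Real.exp (β / 2 * (∑ i, μ i * y i ^ 2) * (ρ ^ 2 / ∑ i, y i ^ 2)) := by
    rw [← Real.exp_add, Real.exp_le_exp]
    refine le_trans ?_ hcone
    have h2 : u * t ^ 2 ≤ μ k * y k ^ 2 :=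
      (mul_le_mul_of_nonneg_right hu (sq_nonneg t)).trans
        (mul_le_mul_of_nonneg_left hyk' (hμ k))
    have h3 : v * a ≤ v * s := mul_le_mul_of_nonneg_left hsa hv
    have h4 : u * t ^ 2 + v * a - (v * s - ∑ i ∈ Finset.univ.erase k, μ i * y i ^ 2)
        ≤ ∑ i, μ i * y i ^ 2 := by rw [hM]; linarith
    have h5 := mul_le_mul_of_nonneg_left h4 (by positivity : 0 ≤ β / 2)
    rw [e3]
    linarith
  refine le_trans (mul_le_mul_of_nonneg_left ?_ hpos.le) h1
  have h2 := Real.exp_pos (-(θ * A) + -(g - θ * s))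
  have h3 := Real.exp_pos (θ * a + -(g + θ * s))
  linarith

theorem le_coneIntegral (hβ : 0 < β) (hμ : ∀ i, 0 ≤ μ i) {k : Fin n} {t u a A τ : ℝ}
    (ht : 0 ≤ t) (hu : u ≤ μ k) (hτ : 0 ≤ τ) (hA : A + (t + 1) ^ 2 < ρ ^ 2)
    (hμv : ∀ i, μ i < v - τ) :
    Real.exp (β / 2 * (u * t ^ 2 + v * a)) *
      (∏ i ∈ Finset.univ.erase k, √(Real.pi / (β / 2 * (v - μ i)))
      - Real.exp (-(β / 2 * τ * A)) *
        ∏ i ∈ Finset.univ.erase k, √(Real.pi / (β / 2 * (v - τ - μ i)))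
      - Real.exp (β / 2 * τ * a) *
        ∏ i ∈ Finset.univ.erase k, √(Real.pi / (β / 2 * (v + τ - μ i))))
      ≤ coneIntegral β ρ μ := by
  have hv : 0 ≤ v := by linarith [hμ k, hμv k]
  have hi : ∀ w, v - τ ≤ w → Integrable (slab k t (fun i => β / 2 * (w - μ i))) := fun w hw =>
    integrable_slab k t fun i => by
      have : 0 < w - μ i := by linarith [hμv i]
      positivity
  have i0 := hi v (by linarith)
  have i1 := (hi (v - τ) le_rfl).const_mul (Real.exp (-(β / 2 * τ * A)))
  have i2 := (hi (v + τ) (by linarith)).const_mul (Real.exp (β / 2 * τ * a))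
  have i01 : Integrable fun y => slab k t (fun i => β / 2 * (v - μ i)) y
      - Real.exp (-(β / 2 * τ * A)) * slab k t (fun i => β / 2 * (v - τ - μ i)) y := i0.sub i1
  have hc := integrableOn_cone (ρ := ρ) hβ hv (fun i => (hμv i).trans_le (by linarith))
  rw [coneIntegral, ← integral_indicator (measurableSet_sum_sq_lt n _), ← integral_slab k t,
    ← integral_slab k t, ← integral_slab k t, ← integral_const_mul, ← integral_const_mul,
    ← integral_sub i0 i1, ← integral_sub i01 i2, ← integral_const_mul]
  refine integral_mono ((i01.sub i2).const_mul _)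
    ((integrable_indicator_iff (measurableSet_sum_sq_lt n _)).2 hc) fun y => ?_
  exact slab_le_exp_cone hβ.le hv hμ ht hu hτ hA y

end

end Hopfield

end

noncomputable section

namespace Hopfield

/-! ### Asymptotics of spherical integrals -/

section
variable {n : ℕ} {β ρ v : ℝ} {μ : Fin n → ℝ}

theorem coneIntegral_pos (hρ : 0 < ρ) (hβ : 0 < β) (hv : 0 ≤ v) (hμv : ∀ i, μ i < v) :
    0 < coneIntegral β ρ μ := by
  have ho : IsOpen {y : Fin n → ℝ | ∑ i, y i ^ 2 < ρ ^ 2} :=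
    isOpen_lt (by fun_prop) continuous_const
  have hne : {y : Fin n → ℝ | ∑ i, y i ^ 2 < ρ ^ 2}.Nonempty := ⟨0, by simp [hρ.ne', sq_pos_iff]⟩
  have : NeZero ((volume : Measure (Fin n → ℝ)).restrict {y | ∑ i, y i ^ 2 < ρ ^ 2}) :=
    ⟨by rw [Ne, Measure.restrict_eq_zero]; exact (ho.measure_pos _ hne).ne'⟩
  exact integral_exp_pos (integrableOn_cone hβ hv hμv)

theorem log_prod_sqrt (hβ : 0 < β) (s : Finset (Fin n)) {w : ℝ} (hw : ∀ i, μ i < w) :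
    Real.log (∏ i ∈ s, √(Real.pi / (β / 2 * (w - μ i))))
      = ∑ i ∈ s, (1 / 2 * Real.log (2 * Real.pi / β) - 1 / 2 * Real.log (w - μ i)) := by
  have hpi := Real.pi_pos
  rw [Real.log_prod]
  · refine Finset.sum_congr rfl fun i _ => ?_
    have h := sub_pos.2 (hw i)
    rw [Real.log_sqrt (by positivity), show Real.pi / (β / 2 * (w - μ i))
      = 2 * Real.pi / β / (w - μ i) by field_simp, Real.log_div (by positivity) h.ne']
    ring
  · intro i _
    have h := sub_pos.2 (hw i)
    positivity

theorem prod_sqrt_pos (hβ : 0 < β) (s : Finset (Fin n)) {w : ℝ} (hw : ∀ i, μ i < w) :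
    0 < ∏ i ∈ s, √(Real.pi / (β / 2 * (w - μ i))) := by
  refine Finset.prod_pos fun i _ => Real.sqrt_pos.2 ?_
  have h := sub_pos.2 (hw i)
  have hpi := Real.pi_pos
  positivity

theorem log_coneIntegral_le {R : ℝ} (hn : 0 < n) (hR : 0 < R) (hβ : 0 < β) (hv : 0 ≤ v)
    (hμv : ∀ i, μ i < v) :
    1 / (n : ℝ) * Real.log (coneIntegral β (R * √n) μ)
      ≤ β / 2 * v * R ^ 2 + 1 / 2 * Real.log (2 * Real.pi / β)
        - 1 / 2 * (1 / (n : ℝ) * ∑ i, Real.log (v - μ i)) := by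
  have hn' : (0 : ℝ) < n := by exact_mod_cast hn
  have hρ : 0 < R * √n := by positivity
  have hP := prod_sqrt_pos hβ Finset.univ hμv
  have h := Real.log_le_log (coneIntegral_pos hρ hβ hv hμv) (coneIntegral_le (ρ := R * √n) hβ hv hμv)
  rw [Real.log_mul (Real.exp_pos _).ne' hP.ne', Real.log_exp, log_prod_sqrt hβ _ hμv,
    Finset.sum_sub_distrib, Finset.sum_const, Finset.card_univ, Fintype.card_fin, nsmul_eq_mul,
    ← Finset.mul_sum, mul_pow, Real.sq_sqrt hn'.le] at h
  have h2 := mul_le_mul_of_nonneg_left h (by positivity : 0 ≤ 1 / (n : ℝ))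
  refine h2.trans (le_of_eq ?_)
  field_simp
  ring

/-- `h1` and `h2` make each Chernoff term at most a quarter of the main product, so half of it
survives. -/
theorem le_log_coneIntegral (hβ : 0 < β) (hμ : ∀ i, 0 ≤ μ i) {k : Fin n} {t u a A τ : ℝ}
    (ht : 0 ≤ t) (hu : u ≤ μ k) (hτ : 0 < τ) (hA : A + (t + 1) ^ 2 < ρ ^ 2)
    (hμv : ∀ i, μ i < v - τ)
    (h1 : 1 / 2 * (∑ i, Real.log (v - μ i) - ∑ i, Real.log (v - τ - μ i)) - β / 2 * τ * A
      ≤ Real.log (1 / 4))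
    (h2 : 1 / 2 * (∑ i, Real.log (v - μ i) - ∑ i, Real.log (v + τ - μ i)) + β / 2 * τ * a + 1 / 2
      ≤ Real.log (1 / 4)) :
    β / 2 * (u * t ^ 2 + v * a) + n * (1 / 2 * Real.log (2 * Real.pi / β))
      - 1 / 2 * ∑ i, Real.log (v - μ i)
      - (1 / 2 * Real.log (2 * Real.pi / β) - 1 / 2 * Real.log τ + Real.log 2)
      ≤ Real.log (coneIntegral β ρ μ) := by
  have hμ0 : ∀ i, μ i < v := fun i => (hμv i).trans (by linarith)
  have hμ2 : ∀ i, μ i < v + τ := fun i => (hμv i).trans (by linarith)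
  set S := Finset.univ.erase k with hS
  have hsum : ∀ w, ∑ i ∈ S, Real.log (w - μ i) = ∑ i, Real.log (w - μ i) - Real.log (w - μ k) :=
    fun w => by rw [← Finset.add_sum_erase _ _ (Finset.mem_univ k)]; ring
  have hcard : ((S.card : ℕ) : ℝ) = n - 1 := by
    rw [hS, Finset.card_erase_of_mem (Finset.mem_univ k), Finset.card_univ, Fintype.card_fin,
      Nat.cast_sub (by have := k.2; omega)]
    simp
  have hlog : ∀ w, (∀ i, μ i < w) → Real.log (∏ i ∈ S, √(Real.pi / (β / 2 * (w - μ i))))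
      = (n - 1) * (1 / 2 * Real.log (2 * Real.pi / β))
        - 1 / 2 * (∑ i, Real.log (w - μ i) - Real.log (w - μ k)) := by
    intro w hw
    rw [log_prod_sqrt hβ S hw, Finset.sum_sub_distrib, Finset.sum_const, nsmul_eq_mul, hcard,
      ← Finset.mul_sum, hsum]
  have l0 := hlog v hμ0
  have l1 := hlog (v - τ) hμv
  have l2 := hlog (v + τ) hμ2
  have p0 := prod_sqrt_pos hβ S hμ0
  have p1 := prod_sqrt_pos hβ S hμv
  have p2 := prod_sqrt_pos hβ S hμ2
  have hmain := le_coneIntegral (a := a) hβ hμ ht hu hτ.le hA hμv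
  set P0 := ∏ i ∈ S, √(Real.pi / (β / 2 * (v - μ i)))
  set P1 := ∏ i ∈ S, √(Real.pi / (β / 2 * (v - τ - μ i)))
  set P2 := ∏ i ∈ S, √(Real.pi / (β / 2 * (v + τ - μ i)))
  have hk : 0 < v - τ - μ k := sub_pos.2 (hμv k)
  have hk1 : Real.log (v - τ - μ k) ≤ Real.log (v - μ k) := Real.log_le_log hk (by linarith)
  have hkτ : Real.log τ ≤ Real.log (v - μ k) := Real.log_le_log hτ (by linarith)
  -- Restoring the omitted factor `k` costs at most one in the logarithm, which accounts for the `1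
  -- / 2` in `h2`.
  have hk2 : Real.log (v + τ - μ k) ≤ Real.log (v - μ k) + 1 := by
    have h3 : 0 < v - μ k := by linarith
    rw [← sub_le_iff_le_add', ← Real.log_div (by linarith) h3.ne']
    refine (Real.log_le_sub_one_of_pos (div_pos (by linarith) h3)).trans ?_
    rw [sub_le_iff_le_add, div_le_iff₀ h3]
    linarith
  have q1 : Real.exp (-(β / 2 * τ * A)) * P1 ≤ 1 / 4 * P0 := by
    rw [← Real.log_le_log_iff (by positivity) (by positivity), Real.log_mul (Real.exp_pos _).ne' p1.ne',
      Real.log_exp, Real.log_mul (by norm_num) p0.ne', l0, l1]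
    linarith
  have q2 : Real.exp (β / 2 * τ * a) * P2 ≤ 1 / 4 * P0 := by
    rw [← Real.log_le_log_iff (by positivity) (by positivity), Real.log_mul (Real.exp_pos _).ne' p2.ne',
      Real.log_exp, Real.log_mul (by norm_num) p0.ne', l0, l2]
    linarith
  have q3 : Real.exp (β / 2 * (u * t ^ 2 + v * a)) * (P0 / 2) ≤ coneIntegral β ρ μ := by
    refine le_trans (mul_le_mul_of_nonneg_left ?_ (Real.exp_pos _).le) hmain
    linarith
  have q4 := Real.log_le_log (by positivity) q3
  rw [Real.log_mul (Real.exp_pos _).ne' (by positivity), Real.log_exp,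
    Real.log_div p0.ne' two_ne_zero, l0] at q4
  refine le_trans ?_ q4
  linarith

end

/-- A family of finite spectra with asymptotic upper edge `v₀` and logarithmic potential `L`. -/
structure SpectralFamily {ι : Type*} (F : Filter ι) (n : ι → ℕ) (μ : ∀ i, Fin (n i) → ℝ) (v₀ : ℝ)
    (L : ℝ → ℝ) : Prop where
  tendsto_card : Tendsto n F atTop
  nonneg : ∀ i k, 0 ≤ μ i k
  edge_nonneg : 0 ≤ v₀
  lt : ∀ v, v₀ < v → ∀ᶠ i in F, ∀ k, μ i k < v
  log : ∀ v, v₀ < v →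
    Tendsto (fun i => 1 / (n i : ℝ) * ∑ k, Real.log (v - μ i k)) F (𝓝 (L v))

section
variable {ι : Type*} {F : Filter ι} {n : ι → ℕ} {μ : ∀ i, Fin (n i) → ℝ} {v₀ : ℝ} {L : ℝ → ℝ}
  {β R v : ℝ}

theorem SpectralFamily.eventually_log_cone_lt (h : SpectralFamily F n μ v₀ L) (hβ : 0 < β)
    (hR : 0 < R) (hv : v₀ < v) {x : ℝ}
    (hx : β / 2 * v * R ^ 2 + 1 / 2 * Real.log (2 * Real.pi / β) - 1 / 2 * L v < x) :
    ∀ᶠ i in F, 1 / (n i : ℝ) * Real.log (coneIntegral β (R * √(n i)) (μ i)) < x := by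
  have ht := ((h.log v hv).const_mul (1 / 2)).const_sub
    (β / 2 * v * R ^ 2 + 1 / 2 * Real.log (2 * Real.pi / β))
  filter_upwards [ht.eventually_lt_const hx, h.lt v hv, h.tendsto_card.eventually_gt_atTop 0]
    with i h1 h2 h3
  exact (log_coneIntegral_le h3 hR hβ (h.edge_nonneg.trans hv.le) h2).trans_lt h1

/-- First-order expansion of `L` at `v`: the margin `ε` around the derivative makes both tail
exponents negative for one small tilt `τ`. -/
theorem exists_chernoff_step {d ε : ℝ} (hL : HasDerivAt L d v) (hε : 0 < ε) (hv : v₀ < v) :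
    ∃ τ, 0 < τ ∧ v₀ < v - τ ∧ L v - L (v - τ) < τ * (d + ε) ∧ τ * (d - ε) < L (v + τ) - L v := by
  have h := hasDerivAt_iff_tendsto_slope_zero.1 hL
  have h1 : Tendsto (fun t : ℝ => t⁻¹ • (L (v + t) - L v)) (𝓝[>] 0) (𝓝 d) :=
    h.mono_left (nhdsWithin_mono _ fun x (hx : 0 < x) => hx.ne')
  have h2 : Tendsto (fun t : ℝ => (-t)⁻¹ • (L (v + -t) - L v)) (𝓝[>] 0) (𝓝 d) := by
    refine h.comp (tendsto_nhdsWithin_iff.2 ⟨?_, ?_⟩)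
    · have : Tendsto (fun t : ℝ => -t) (𝓝 0) (𝓝 0) := by simpa using (continuous_neg (G := ℝ)).tendsto 0
      exact this.mono_left nhdsWithin_le_nhds
    · filter_upwards [self_mem_nhdsWithin] with t ht
      simpa using (show (0 : ℝ) < t from ht).ne'
  have h3 : ∀ᶠ t in 𝓝[>] (0 : ℝ), t < v - v₀ :=
    (eventually_lt_nhds (by linarith)).filter_mono nhdsWithin_le_nhds
  obtain ⟨τ, a, b, c, hτ⟩ := ((h1.eventually_const_lt (show d - ε < d by linarith)).and
    ((h2.eventually_lt_const (show d < d + ε by linarith)).and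
      (h3.and self_mem_nhdsWithin))).exists
  have hτ : 0 < τ := hτ
  refine ⟨τ, hτ, by linarith, ?_, ?_⟩
  · rw [smul_eq_mul, ← sub_eq_add_neg, inv_neg, neg_mul, ← mul_neg, neg_sub, inv_mul_lt_iff₀ hτ] at b
    exact b
  · rw [smul_eq_mul, lt_inv_mul_iff₀ hτ] at a
    exact a

/-- The Gaussian with variances `1 / (β (v - μᵢ))` has squared norm about `n L'(v) / β = n s`, so
the window `n (s ± ε)` captures it. The remaining `n (R² - s - 2ε)` is placed on the coordinate with
eigenvalue at least `u`. -/
theorem SpectralFamily.eventually_lt_log_cone (h : SpectralFamily F n μ v₀ L) (hβ : 0 < β)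
    (hv : v₀ < v) {s ε u : ℝ} (hL : HasDerivAt L (β * s) v) (hε : 0 < ε)
    (hs : s + 2 * ε ≤ R ^ 2) (hu : ∀ᶠ i in F, ∃ k, u ≤ μ i k) {x : ℝ}
    (hx : x < β / 2 * (u * (R ^ 2 - s - 2 * ε) + v * (s - ε)) + 1 / 2 * Real.log (2 * Real.pi / β)
      - 1 / 2 * L v) :
    ∀ᶠ i in F, x < 1 / (n i : ℝ) * Real.log (coneIntegral β (R * √(n i)) (μ i)) := by
  obtain ⟨τ, hτ, hτv, d1, d2⟩ := exists_chernoff_step hL (mul_pos hβ hε) hv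
  have hcast : Tendsto (fun i => (n i : ℝ)) F atTop := tendsto_natCast_atTop_atTop.comp h.tendsto_card
  have t0 := h.log v hv
  have t1 := h.log (v - τ) hτv
  have t2 := h.log (v + τ) (by linarith)
  have hinv : ∀ C : ℝ, Tendsto (fun i => C * (1 / (n i : ℝ))) F (𝓝 0) := fun C => by
    simpa using (tendsto_const_nhds (x := C)).mul (hcast.const_div_atTop 1)
  have e1 : ∀ᶠ i in F, 1 / 2 * (∑ k, Real.log (v - μ i k) - ∑ k, Real.log (v - τ - μ i k))
      - β / 2 * τ * (n i * (s + ε)) ≤ Real.log (1 / 4) := by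
    have ht : Tendsto (fun i => 1 / 2 * (1 / (n i : ℝ) * ∑ k, Real.log (v - μ i k)
        - 1 / (n i : ℝ) * ∑ k, Real.log (v - τ - μ i k)) - β / 2 * τ * (s + ε)
        - Real.log (1 / 4) * (1 / (n i : ℝ))) F
        (𝓝 (1 / 2 * (L v - L (v - τ)) - β / 2 * τ * (s + ε) - 0)) :=
      (((t0.sub t1).const_mul _).sub_const _).sub (hinv _)
    filter_upwards [ht.eventually_lt_const (show _ < (0 : ℝ) by linarith),
      h.tendsto_card.eventually_gt_atTop 0] with i hi hn
    have hn' : (0 : ℝ) < n i := by exact_mod_cast hn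
    have := mul_neg_of_pos_of_neg hn' hi
    field_simp at this
    linarith
  have e2 : ∀ᶠ i in F, 1 / 2 * (∑ k, Real.log (v - μ i k) - ∑ k, Real.log (v + τ - μ i k))
      + β / 2 * τ * (n i * (s - ε)) + 1 / 2 ≤ Real.log (1 / 4) := by
    have ht : Tendsto (fun i => 1 / 2 * (1 / (n i : ℝ) * ∑ k, Real.log (v - μ i k)
        - 1 / (n i : ℝ) * ∑ k, Real.log (v + τ - μ i k)) + β / 2 * τ * (s - ε)
        - (Real.log (1 / 4) - 1 / 2) * (1 / (n i : ℝ))) F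
        (𝓝 (1 / 2 * (L v - L (v + τ)) + β / 2 * τ * (s - ε) - 0)) :=
      (((t0.sub t2).const_mul _).add_const _).sub (hinv _)
    filter_upwards [ht.eventually_lt_const (show _ < (0 : ℝ) by linarith),
      h.tendsto_card.eventually_gt_atTop 0] with i hi hn
    have hn' : (0 : ℝ) < n i := by exact_mod_cast hn
    have := mul_neg_of_pos_of_neg hn' hi
    field_simp at this
    linarith
  set r := R ^ 2 - s - 2 * ε with hr
  have hr0 : 0 ≤ r := by linarith
  -- The unit width of the slab adds only `O(√n)` to the squared norm, less than the `ε n` held in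
  -- reserve.
  have e3 : ∀ᶠ i in F, (n i : ℝ) * (s + ε) + (√(n i * r) + 1) ^ 2 < (R * √(n i)) ^ 2 := by
    have hsq : Tendsto (fun i => √(n i : ℝ)) F atTop := Real.tendsto_sqrt_atTop.comp hcast
    filter_upwards [hsq.eventually_gt_atTop ((2 * √r + 1) / ε),
      hsq.eventually_ge_atTop 1] with i hi hi1
    have hn' : (0 : ℝ) ≤ n i := Nat.cast_nonneg _
    have h1 := Real.sq_sqrt hn'
    have h2 := Real.sq_sqrt hr0
    rw [div_lt_iff₀ hε] at hi
    rw [Real.sqrt_mul hn', mul_pow, h1]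
    have h3 : (√(n i : ℝ) * √r + 1) ^ 2 = n i * r + 2 * √(n i : ℝ) * √r + 1 := by
      rw [add_sq, mul_pow, h1, h2]; ring
    have h4 : 2 * √(n i : ℝ) * √r + 1 ≤ √(n i : ℝ) * (2 * √r + 1) := by linarith
    have h5 : √(n i : ℝ) * (2 * √r + 1) < √(n i : ℝ) * (√(n i : ℝ) * ε) :=
      mul_lt_mul_of_pos_left hi (by linarith)
    have h6 : √(n i : ℝ) * (√(n i : ℝ) * ε) = n i * ε := by rw [← mul_assoc, ← sq, h1]
    have h7 : (n i : ℝ) * (s + ε) + (n i * r + n i * ε) = R ^ 2 * n i := by rw [hr]; ring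
    rw [h3]
    linarith
  set C := 1 / 2 * Real.log (2 * Real.pi / β) - 1 / 2 * Real.log τ + Real.log 2 with hC
  have e4 : ∀ᶠ i in F, x < β / 2 * (u * r + v * (s - ε)) + 1 / 2 * Real.log (2 * Real.pi / β)
      - 1 / 2 * (1 / (n i : ℝ) * ∑ k, Real.log (v - μ i k)) - C * (1 / (n i : ℝ)) := by
    have ht := ((t0.const_mul (1 / 2)).const_sub (β / 2 * (u * r + v * (s - ε))
      + 1 / 2 * Real.log (2 * Real.pi / β))).sub (hinv C)
    exact ht.eventually_const_lt (by linarith)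
  filter_upwards [e1, e2, e3, e4, h.lt (v - τ) hτv, hu, h.tendsto_card.eventually_gt_atTop 0]
    with i h1 h2 h3 h4 h5 ⟨k, hk⟩ hn
  have hn' : (0 : ℝ) < n i := by exact_mod_cast hn
  have hmain := le_log_coneIntegral hβ (h.nonneg i) (Real.sqrt_nonneg (n i * r)) hk hτ h3 h5 h1 h2
  refine h4.trans_le ?_
  rw [Real.sq_sqrt (by positivity)] at hmain
  have h6 := mul_le_mul_of_nonneg_left hmain (by positivity : 0 ≤ 1 / (n i : ℝ))
  refine le_trans (le_of_eq ?_) h6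
  rw [hC]
  field_simp

theorem SpectralFamily.eventually_lt_log_cone' (h : SpectralFamily F n μ v₀ L) (hβ : 0 < β)
    (hv : v₀ < v) {s : ℝ} (hL : HasDerivAt L (β * s) v)
    (hs : s < R ^ 2) (hu : ∀ u < v₀, ∀ᶠ i in F, ∃ k, u ≤ μ i k) {x : ℝ}
    (hx : x < β / 2 * (v₀ * (R ^ 2 - s) + v * s) + 1 / 2 * Real.log (2 * Real.pi / β)
      - 1 / 2 * L v) :
    ∀ᶠ i in F, x < 1 / (n i : ℝ) * Real.log (coneIntegral β (R * √(n i)) (μ i)) := by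
  have hc : Tendsto (fun ε : ℝ => β / 2 * ((v₀ - ε) * (R ^ 2 - s - 2 * ε) + v * (s - ε))
      + 1 / 2 * Real.log (2 * Real.pi / β) - 1 / 2 * L v) (𝓝[>] 0)
      (𝓝 (β / 2 * (v₀ * (R ^ 2 - s) + v * s) + 1 / 2 * Real.log (2 * Real.pi / β)
      - 1 / 2 * L v)) := by
    have : Continuous fun ε : ℝ => β / 2 * ((v₀ - ε) * (R ^ 2 - s - 2 * ε) + v * (s - ε))
      + 1 / 2 * Real.log (2 * Real.pi / β) - 1 / 2 * L v := by fun_prop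
    have h := (this.tendsto 0).mono_left (nhdsWithin_le_nhds (s := Ioi 0))
    simpa using h
  have h3 : ∀ᶠ t in 𝓝[>] (0 : ℝ), t < (R ^ 2 - s) / 2 :=
    (eventually_lt_nhds (by linarith)).filter_mono nhdsWithin_le_nhds
  obtain ⟨ε, a, b, hε⟩ := ((hc.eventually_const_lt hx).and (h3.and self_mem_nhdsWithin)).exists
  have hε : 0 < ε := hε
  exact h.eventually_lt_log_cone hβ hv hL hε (by linarith) (hu _ (by linarith)) a

/-- The exponential growth rate of the volume of the ball of radius `R √n`. -/
theorem tendsto_log_cone_zero (hn : Tendsto n F atTop) (hβ : 0 < β) (hR : 0 < R) :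
    Tendsto (fun i => 1 / (n i : ℝ) * Real.log (coneIntegral β (R * √(n i)) (0 : Fin (n i) → ℝ))) F
      (𝓝 (1 / 2 + 1 / 2 * Real.log (2 * Real.pi) + Real.log R)) := by
  have hpi := Real.pi_pos
  -- The volume of the ball is the case of zero spectrum, with edge `0` and potential `log`; the
  -- optimal parameter is `v = 1 / (β R²)`.
  have hfam : SpectralFamily F n (fun i => (0 : Fin (n i) → ℝ)) 0 Real.log := by
    refine ⟨hn, fun i k => le_rfl, le_rfl, fun v hv => Eventually.of_forall fun i k => hv, fun v hv => ?_⟩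
    refine tendsto_const_nhds.congr' ?_
    filter_upwards [hn.eventually_gt_atTop 0] with i hi
    have hi' : (n i : ℝ) ≠ 0 := by exact_mod_cast hi.ne'
    simp [hi']
  have hval : ∀ s, 0 < s → 1 / 2 * Real.log (2 * Real.pi / β) - 1 / 2 * Real.log (1 / (β * s))
      = 1 / 2 * Real.log (2 * Real.pi) + 1 / 2 * Real.log s := by
    intro s hs
    rw [Real.log_div (by positivity) hβ.ne', Real.log_div one_ne_zero (by positivity), Real.log_one,
      Real.log_mul hβ.ne' hs.ne']
    ring
  have hR2 : 1 / 2 * Real.log (R ^ 2) = Real.log R := by rw [Real.log_pow]; push_cast; ring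
  refine tendsto_order.2 ⟨fun x hx => ?_, fun x hx => ?_⟩
  · obtain ⟨s, hs0, hsR, hs⟩ : ∃ s, 0 < s ∧ s < R ^ 2 ∧
        x < 1 / 2 + 1 / 2 * Real.log (2 * Real.pi) + 1 / 2 * Real.log s := by
      have hR0 : 0 < R ^ 2 := by positivity
      have hc : ContinuousAt (fun s => 1 / 2 + 1 / 2 * Real.log (2 * Real.pi) + 1 / 2 * Real.log s)
          (R ^ 2) := by
        have h0 := hR0.ne'
        fun_prop (disch := assumption)
      have h1 : ∀ᶠ s in 𝓝[<] (R ^ 2), x < 1 / 2 + 1 / 2 * Real.log (2 * Real.pi) + 1 / 2 * Real.log s :=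
        (hc.eventually_const_lt (by simp only [hR2]; exact hx)).filter_mono nhdsWithin_le_nhds
      have h2 : ∀ᶠ s in 𝓝[<] (R ^ 2), 0 < s :=
        (eventually_gt_nhds hR0).filter_mono nhdsWithin_le_nhds
      obtain ⟨s, a, b, c⟩ := (h1.and (h2.and self_mem_nhdsWithin)).exists
      exact ⟨s, b, c, a⟩
    have hv : 0 < 1 / (β * s) := by positivity
    have hd : HasDerivAt Real.log (β * s) (1 / (β * s)) := by
      simpa using Real.hasDerivAt_log hv.ne'
    refine hfam.eventually_lt_log_cone' hβ hv hd hsR (fun u hu => ?_) ?_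
    · filter_upwards [hn.eventually_gt_atTop 0] with i hi
      exact ⟨⟨0, hi⟩, hu.le⟩
    · have e : β / 2 * (0 * (R ^ 2 - s) + 1 / (β * s) * s) = 1 / 2 := by field_simp; ring
      rw [e]
      linarith [hval s hs0]
  · refine hfam.eventually_log_cone_lt hβ hR (v := 1 / (β * R ^ 2)) (by positivity) ?_
    have e : β / 2 * (1 / (β * R ^ 2)) * R ^ 2 = 1 / 2 := by field_simp
    rw [e]
    linarith [hval (R ^ 2) (by positivity)]

/-- The limit of the normalised logarithm of a spherical integral. -/
theorem SpectralFamily.tendsto_log_div (h : SpectralFamily F n μ v₀ L) (hβ : 0 < β) (hR : 0 < R)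
    (hu : ∀ u < v₀, ∀ᶠ i in F, ∃ k, u ≤ μ i k) {m : ℝ}
    (hup : ∀ ε > 0, ∃ v > v₀, β / 2 * v * R ^ 2 - 1 / 2 * Real.log β - 1 / 2 * L v
      - Real.log R - 1 / 2 < m + ε)
    (hlo : ∀ ε > 0, ∃ v > v₀, ∃ s < R ^ 2, HasDerivAt L (β * s) v ∧
      m - ε < β / 2 * (v₀ * (R ^ 2 - s) + v * s) - 1 / 2 * Real.log β - 1 / 2 * L v
        - Real.log R - 1 / 2) :
    Tendsto (fun i => 1 / (n i : ℝ) * Real.log (coneIntegral β (R * √(n i)) (μ i)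
      / coneIntegral β (R * √(n i)) (0 : Fin (n i) → ℝ))) F (𝓝 m) := by
  have hpi := Real.pi_pos
  have h0 := tendsto_log_cone_zero (n := n) (F := F) h.tendsto_card hβ hR
  set c := 1 / 2 + 1 / 2 * Real.log (2 * Real.pi) + Real.log R with hc
  have hlog : Real.log (2 * Real.pi / β) = Real.log (2 * Real.pi) - Real.log β :=
    Real.log_div (by positivity) hβ.ne'
  have h1 : Tendsto (fun i => 1 / (n i : ℝ) * Real.log (coneIntegral β (R * √(n i)) (μ i))) F
      (𝓝 (m + c)) := by
    refine tendsto_order.2 ⟨fun x hx => ?_, fun x hx => ?_⟩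
    · obtain ⟨v, hv, s, hs, hd, hm⟩ := hlo (m + c - x) (by linarith)
      exact h.eventually_lt_log_cone' hβ hv hd hs hu (by rw [hlog]; linarith)
    · obtain ⟨v, hv, hm⟩ := hup (x - (m + c)) (by linarith)
      exact h.eventually_log_cone_lt hβ hR hv (by rw [hlog]; linarith)
  have h2 := h1.sub h0
  rw [add_sub_cancel_right] at h2
  refine h2.congr' ?_
  filter_upwards [h.lt (v₀ + 1) (by linarith), h.tendsto_card.eventually_gt_atTop 0] with i hi hn
  have hn' : (0 : ℝ) < n i := by exact_mod_cast hn
  have hρ : 0 < R * √(n i) := by positivity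
  have p1 := coneIntegral_pos hρ hβ (by linarith [h.edge_nonneg]) hi
  have p2 := coneIntegral_pos (μ := (0 : Fin (n i) → ℝ)) hρ hβ zero_le_one (fun _ => one_pos)
  rw [Real.log_div p1.ne' p2.ne', mul_sub]

end

end Hopfield

end

noncomputable section

namespace Hopfield

/-! ### Logarithmic potentials from resolvents -/

/-- `S` bounds the difference quotients of `L` between points of `s` from both sides. -/
def SlopeBound (L S : ℝ → ℝ) (s : Set ℝ) : Prop :=
  ∀ u ∈ s, ∀ u' ∈ s, u < u' → (u' - u) * S u' ≤ L u' - L u ∧ L u' - L u ≤ (u' - u) * S u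

theorem log_sub_log_bounds {x u u' : ℝ} (hx : x < u) (hu : u < u') :
    (u' - u) * (u' - x)⁻¹ ≤ Real.log (u' - x) - Real.log (u - x) ∧
      Real.log (u' - x) - Real.log (u - x) ≤ (u' - u) * (u - x)⁻¹ := by
  have h1 : 0 < u - x := by linarith
  have h2 : 0 < u' - x := by linarith
  constructor
  · have h := Real.log_le_sub_one_of_pos (div_pos h1 h2)
    rw [Real.log_div h1.ne' h2.ne'] at h
    have e : (u' - u) * (u' - x)⁻¹ = 1 - (u - x) / (u' - x) := by field_simp; ring
    linarith
  · have h := Real.log_le_sub_one_of_pos (div_pos h2 h1)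
    rw [Real.log_div h2.ne' h1.ne'] at h
    have e : (u' - u) * (u - x)⁻¹ = (u' - x) / (u - x) - 1 := by field_simp; ring
    linarith

theorem SlopeBound.grid {L S : ℝ → ℝ} {v V : ℝ} (h : SlopeBound L S (Icc v V)) (hv : v < V) {K : ℕ}
    (hK : 0 < K) :
    (V - v) / K * ∑ k ∈ Finset.range K, S (v + (k + 1 : ℕ) * ((V - v) / K)) ≤ L V - L v ∧
    L V - L v ≤ (V - v) / K * ∑ k ∈ Finset.range K, S (v + k * ((V - v) / K)) := by
  have hK' : (0 : ℝ) < K := by exact_mod_cast hK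
  set η := (V - v) / K with hη
  have hη0 : 0 < η := div_pos (by linarith) hK'
  have hKη : K * η = V - v := by rw [hη]; field_simp
  have htel : L V - L v = ∑ k ∈ Finset.range K, (L (v + (k + 1 : ℕ) * η) - L (v + k * η)) := by
    rw [Finset.sum_range_sub (fun k : ℕ => L (v + k * η)), hKη]
    simp
  have hmem : ∀ k : ℕ, k ≤ K → v + k * η ∈ Icc v V := fun k hk => by
    have h1 : (k : ℝ) * η ≤ K * η := by gcongr
    have h2 : 0 ≤ (k : ℝ) * η := by positivity
    constructor <;> linarith
  have hstep : ∀ k ∈ Finset.range K,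
      η * S (v + (k + 1 : ℕ) * η) ≤ L (v + (k + 1 : ℕ) * η) - L (v + k * η) ∧
      L (v + (k + 1 : ℕ) * η) - L (v + k * η) ≤ η * S (v + k * η) := by
    intro k hk
    have hk := Finset.mem_range.1 hk
    have h1 := h _ (hmem k hk.le) _ (hmem (k + 1) hk) (by push_cast; linarith)
    have e : v + ((k + 1 : ℕ) : ℝ) * η - (v + k * η) = η := by push_cast; ring
    rwa [e] at h1
  rw [htel, Finset.mul_sum, Finset.mul_sum]
  exact ⟨Finset.sum_le_sum fun k hk => (hstep k hk).1, Finset.sum_le_sum fun k hk => (hstep k hk).2⟩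

/-- The upper and lower Riemann sums differ by the mesh times `S v - S V`, so pointwise convergence
of the slopes on a finite grid suffices. -/
theorem tendsto_sub_of_slopeBound {ι : Type*} {F : Filter ι} {l s : ι → ℝ → ℝ} {L S : ℝ → ℝ}
    {v V : ℝ} (hv : v < V) (hs : ∀ u ∈ Icc v V, Tendsto (fun i => s i u) F (𝓝 (S u)))
    (hl : ∀ᶠ i in F, SlopeBound (l i) (s i) (Icc v V)) (hL : SlopeBound L S (Icc v V)) :
    Tendsto (fun i => l i V - l i v) F (𝓝 (L V - L v)) := by
  have hmem : ∀ {K k : ℕ}, 0 < K → k ≤ K → v + k * ((V - v) / K) ∈ Icc v V := by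
    intro K k hK hk
    have hK' : (0 : ℝ) < K := by exact_mod_cast hK
    have h1 : (k : ℝ) * ((V - v) / K) ≤ K * ((V - v) / K) := by
      have := div_pos (sub_pos.2 hv) hK'
      gcongr
    have h2 : 0 ≤ (k : ℝ) * ((V - v) / K) := by
      have := div_pos (sub_pos.2 hv) hK'
      positivity
    have h3 : (K : ℝ) * ((V - v) / K) = V - v := by field_simp
    constructor <;> linarith
  have hgap : ∀ {K : ℕ}, 0 < K → ∑ k ∈ Finset.range K, S (v + k * ((V - v) / K))
      - ∑ k ∈ Finset.range K, S (v + (k + 1 : ℕ) * ((V - v) / K)) = S v - S V := by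
    intro K hK
    have hK' : (K : ℝ) ≠ 0 := by exact_mod_cast hK.ne'
    rw [← Finset.sum_sub_distrib, Finset.sum_range_sub' (fun k : ℕ => S (v + k * ((V - v) / K)))]
    have h3 : (K : ℝ) * ((V - v) / K) = V - v := by field_simp
    rw [h3]
    simp
  have hchoose : ∀ ε > 0, ∃ K : ℕ, 0 < K ∧ (V - v) / K * (S v - S V) < ε := by
    intro ε hε
    obtain ⟨K, hK⟩ := exists_nat_gt (max 0 ((V - v) * (S v - S V) / ε))
    have hK0 : (0 : ℝ) < K := (le_max_left _ _).trans_lt hK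
    refine ⟨K, by exact_mod_cast hK0, ?_⟩
    have h1 := (le_max_right _ _).trans_lt hK
    rw [div_lt_iff₀ hε] at h1
    rw [div_mul_eq_mul_div, div_lt_iff₀ hK0]
    linarith
  refine tendsto_order.2 ⟨fun x hx => ?_, fun x hx => ?_⟩
  · obtain ⟨K, hK, hε⟩ := hchoose (L V - L v - x) (by linarith)
    have ht : Tendsto (fun i => (V - v) / K * ∑ k ∈ Finset.range K,
        s i (v + (k + 1 : ℕ) * ((V - v) / K))) F (𝓝 ((V - v) / K * ∑ k ∈ Finset.range K,
        S (v + (k + 1 : ℕ) * ((V - v) / K)))) :=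
      (tendsto_finsetSum _ fun k hk => hs _ (hmem hK (Finset.mem_range.1 hk))).const_mul _
    have h1 := (hL.grid hv hK).2
    have h2 := hgap hK
    have h3 : x < (V - v) / K * ∑ k ∈ Finset.range K, S (v + (k + 1 : ℕ) * ((V - v) / K)) := by
      rw [← h2, mul_sub] at hε
      linarith
    filter_upwards [hl, ht.eventually_const_lt h3] with i hi hi'
    exact hi'.trans_le (hi.grid hv hK).1
  · obtain ⟨K, hK, hε⟩ := hchoose (x - (L V - L v)) (by linarith)
    have ht : Tendsto (fun i => (V - v) / K * ∑ k ∈ Finset.range K,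
        s i (v + k * ((V - v) / K))) F (𝓝 ((V - v) / K * ∑ k ∈ Finset.range K,
        S (v + k * ((V - v) / K)))) :=
      (tendsto_finsetSum _ fun k hk => hs _ (hmem hK (Finset.mem_range.1 hk).le)).const_mul _
    have h1 := (hL.grid hv hK).1
    have h2 := hgap hK
    have h3 : (V - v) / K * ∑ k ∈ Finset.range K, S (v + k * ((V - v) / K)) < x := by
      rw [← h2, mul_sub] at hε
      linarith
    filter_upwards [hl, ht.eventually_lt_const h3] with i hi hi'
    exact (hi.grid hv hK).2.trans_lt hi'

/-- Fixes the constant of integration: far from the spectrum every logarithmic potential is close to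
`log v`. -/
theorem abs_log_sub_le {x v c : ℝ} (hx0 : 0 ≤ x) (hxc : x ≤ c) (hc : 0 < c) (hv : 2 * c ≤ v) :
    |Real.log (v - x) - Real.log v| ≤ 2 * c / v := by
  have hv0 : 0 < v := by linarith
  have h1 : 0 < v - x := by linarith
  have h2 : Real.log (v - x) ≤ Real.log v := Real.log_le_log h1 (by linarith)
  rw [abs_of_nonpos (by linarith), neg_sub]
  have h := Real.log_le_sub_one_of_pos (div_pos hv0 h1)
  rw [Real.log_div hv0.ne' h1.ne'] at h
  refine h.trans ?_
  rw [sub_le_iff_le_add, div_le_iff₀ h1, ← sub_nonneg]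
  have e : (2 * c / v + 1) * (v - x) - v = (2 * c - x) - 2 * c * x / v := by field_simp; ring
  rw [e]
  have h3 : 2 * c * x / v ≤ x := by rw [div_le_iff₀ hv0]; nlinarith
  linarith

theorem hasDerivAt_of_slopeBound {L S : ℝ → ℝ} {v₀ v : ℝ} (h : SlopeBound L S (Ioi v₀)) (hv : v₀ < v)
    (hS : ContinuousAt S v) : HasDerivAt L (S v) v := by
  rw [hasDerivAt_iff_tendsto_slope, tendsto_iff_norm_sub_tendsto_zero]
  have h0 : Tendsto (fun u => |S u - S v|) (𝓝[≠] v) (𝓝 0) := by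
    have h1 : Tendsto (fun u => |S u - S v|) (𝓝 v) (𝓝 |S v - S v|) := (hS.tendsto.sub_const _).abs
    rw [sub_self, abs_zero] at h1
    exact h1.mono_left nhdsWithin_le_nhds
  refine squeeze_zero' (Eventually.of_forall fun _ => norm_nonneg _) ?_ h0
  filter_upwards [self_mem_nhdsWithin, (eventually_gt_nhds hv).filter_mono nhdsWithin_le_nhds]
    with u hu hu0
  rw [slope_def_field, Real.norm_eq_abs]
  rcases lt_or_gt_of_ne (show u ≠ v from hu) with huv | huv
  · obtain ⟨a, b⟩ := h u hu0 v hv huv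
    have e : (L u - L v) / (u - v) = (L v - L u) / (v - u) := by
      rw [← neg_sub (L v), ← neg_sub v, neg_div_neg_eq]
    have huv' := sub_pos.2 huv
    have a' : S v ≤ (L v - L u) / (v - u) := by rw [le_div_iff₀ huv']; linarith
    have b' : (L v - L u) / (v - u) ≤ S u := by rw [div_le_iff₀ huv']; linarith
    rw [e, abs_of_nonneg (by linarith), abs_of_nonneg (by linarith)]
    linarith
  · obtain ⟨a, b⟩ := h v hv u hu0 huv
    have huv' := sub_pos.2 huv
    have a' : S u ≤ (L u - L v) / (u - v) := by rw [le_div_iff₀ huv']; linarith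
    have b' : (L u - L v) / (u - v) ≤ S v := by rw [div_le_iff₀ huv']; linarith
    rw [abs_of_nonpos (by linarith), abs_of_nonpos (by linarith)]
    linarith

/-! ### The logarithmic potential of the Marchenko–Pastur law and its behaviour at the edge. -/

section
variable {α : ℝ}

/-- The only atom is at `0 < lamPlus α`. Strictness allows logarithm and inverse estimates at the
edge itself. -/
theorem ae_lt_lamPlus_marchenkoPastur (α : ℝ) : ∀ᵐ l ∂(marchenkoPastur α), l < lamPlus α := by
  have h : ∀ᵐ l ∂(marchenkoPastur α), l ≠ lamPlus α := by
    rw [marchenkoPastur, ae_add_measure_iff]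
    constructor
    · refine Measure.ae_smul_measure ?_ _
      refine (ae_dirac_iff (p := fun x => x ≠ lamPlus α)
        (measurableSet_singleton (lamPlus α)).compl).2 (lamPlus_pos α).ne
    · exact (withDensity_absolutelyContinuous _ _).ae_le (Measure.ae_ne volume _)
  filter_upwards [h, ae_mem_Icc_marchenkoPastur α] with l h1 h2
  exact lt_of_le_of_ne h2.2 h1

/-- Logarithms of affine functions under the Marchenko–Pastur law. -/
theorem log_affine_marchenkoPastur (hα0 : 0 < α) (hα1 : α < 1) {c w : ℝ} (hc : 0 < c)
    (hw : c * lamPlus α ≤ w) :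
    Integrable (fun l => Real.log (w - c * l)) (marchenkoPastur α) ∧
    ∫ l, Real.log (w - c * l) ∂(marchenkoPastur α)
      = Real.log c + ∫ l, Real.log (w / c - l) ∂(marchenkoPastur α) := by
  have := isProbabilityMeasure_marchenkoPastur hα0 hα1
  have hw' : lamPlus α ≤ w / c := by rw [le_div_iff₀ hc]; linarith
  have hi := integrable_log_marchenkoPastur hα0 hα1 hw'
  have e : (fun l => Real.log (w - c * l)) =ᵐ[marchenkoPastur α]
      fun l => Real.log c + Real.log (w / c - l) := by
    filter_upwards [ae_lt_lamPlus_marchenkoPastur α] with l hl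
    rw [← Real.log_mul hc.ne' (by linarith)]
    congr 1
    field_simp
  refine ⟨((integrable_const _).add hi).congr e.symm, ?_⟩
  rw [integral_congr_ae e, integral_add (integrable_const _) hi]
  simp

/-- The logarithmic potential of the limiting spectral law of `Ξ Ξᵀ / (N₁ + N₂)`. -/
def logPotential (α v : ℝ) : ℝ := ∫ l, Real.log (v - (1 - α) * l) ∂(marchenkoPastur α)

theorem integrable_logPotential (hα0 : 0 < α) (hα1 : α < 1) {v : ℝ} (hv : topEdge α ≤ v) :
    Integrable (fun l => Real.log (v - (1 - α) * l)) (marchenkoPastur α) :=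
  (log_affine_marchenkoPastur hα0 hα1 (by linarith) (by rwa [← topEdge_eq hα1])).1

theorem variational_eq (hα0 : 0 < α) (hα1 : α < 1) {β q : ℝ} (R : ℝ) (hβ : 0 < β)
    (hq : q ∈ feasible α β) :
    variational α β R q = q * R ^ 2 - 1 / 2 * (Real.log β + logPotential α (2 * q / β))
      - Real.log R - 1 / 2 := by
  have h1 : 0 < 1 - α := by linarith
  have hq : β * (1 - α) * lamPlus α ≤ 2 * q := hq
  rw [variational, (log_affine_marchenkoPastur hα0 hα1 (mul_pos hβ h1) hq).2, logPotential,
    (log_affine_marchenkoPastur hα0 hα1 h1 (w := 2 * q / β) ?_).2, Real.log_mul hβ.ne' h1.ne',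
    div_div, add_assoc]
  rw [le_div_iff₀ hβ]
  linarith

theorem resolvent_marchenkoPastur (hα0 : 0 < α) (hα1 : α < 1) {v : ℝ} (hv : topEdge α ≤ v) :
    Integrable (fun l => (v - (1 - α) * l)⁻¹) (marchenkoPastur α) ∧
    ∫ l, (v - (1 - α) * l)⁻¹ ∂(marchenkoPastur α) = branch α v / α := by
  have h1 : 0 < 1 - α := by linarith
  have hv' : lamPlus α ≤ v / (1 - α) := by
    rw [le_div_iff₀ h1, mul_comm, ← topEdge_eq hα1]
    exact hv
  obtain ⟨a, b⟩ := stieltjes_marchenkoPastur hα0 hα1 hv'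
  have e : (fun l => (v - (1 - α) * l)⁻¹) = fun l => (1 - α)⁻¹ * (v / (1 - α) - l)⁻¹ := by
    funext l
    rw [← mul_inv, mul_sub, mul_div_cancel₀ _ h1.ne']
  rw [e]
  refine ⟨a.const_mul _, ?_⟩
  rw [integral_const_mul, b, mul_div_cancel₀ _ h1.ne']
  field_simp

theorem slopeBound_logPotential (hα0 : 0 < α) (hα1 : α < 1) :
    SlopeBound (logPotential α) (fun v => branch α v / α) (Ici (topEdge α)) := by
  intro u hu u' hu' huu
  have h1 : 0 < 1 - α := by linarith
  have i1 := integrable_logPotential hα0 hα1 hu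
  have i2 := integrable_logPotential hα0 hα1 hu'
  obtain ⟨r1, r2⟩ := resolvent_marchenkoPastur hα0 hα1 hu
  obtain ⟨r1', r2'⟩ := resolvent_marchenkoPastur hα0 hα1 hu'
  have hlt : ∀ᵐ l ∂(marchenkoPastur α), (1 - α) * l < u := by
    filter_upwards [ae_lt_lamPlus_marchenkoPastur α] with l hl
    refine lt_of_lt_of_le ?_ hu
    rw [topEdge_eq hα1]
    gcongr
  simp only
  rw [logPotential, logPotential, ← integral_sub i2 i1, ← r2, ← r2', ← integral_const_mul,
    ← integral_const_mul]
  exact ⟨integral_mono_ae (r1'.const_mul _) (i2.sub i1) (hlt.mono fun l hl => (log_sub_log_bounds hl huu).1),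
    integral_mono_ae (i2.sub i1) (r1.const_mul _) (hlt.mono fun l hl => (log_sub_log_bounds hl huu).2)⟩

theorem abs_logPotential_sub_le (hα0 : 0 < α) (hα1 : α < 1) {c v : ℝ} (hc : topEdge α ≤ c)
    (hv : 2 * c ≤ v) : |logPotential α v - Real.log v| ≤ 2 * c / v := by
  have := isProbabilityMeasure_marchenkoPastur hα0 hα1
  have h1 : 0 < 1 - α := by linarith
  have hc0 : 0 < c := by linarith [one_lt_topEdge hα0 hα1]
  have i1 := integrable_logPotential hα0 hα1 (v := v) (by linarith)
  have e : logPotential α v - Real.log v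
      = ∫ l, (Real.log (v - (1 - α) * l) - Real.log v) ∂(marchenkoPastur α) := by
    rw [integral_sub i1 (integrable_const _), logPotential]
    simp
  rw [e, ← Real.norm_eq_abs]
  refine (norm_integral_le_of_norm_le_const (C := 2 * c / v) ?_).trans (by simp)
  filter_upwards [ae_mem_Icc_marchenkoPastur α] with l hl
  rw [Real.norm_eq_abs]
  refine abs_log_sub_le (mul_nonneg h1.le hl.1) (le_trans ?_ hc) hc0 hv
  rw [topEdge_eq hα1]
  gcongr
  exact hl.2

theorem logPotential_le_log (hα0 : 0 < α) (hα1 : α < 1) {v : ℝ} (hv : topEdge α ≤ v) :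
    logPotential α v ≤ Real.log v := by
  have := isProbabilityMeasure_marchenkoPastur hα0 hα1
  have h1 : 0 < 1 - α := by linarith
  have e : Real.log v = ∫ _, Real.log v ∂(marchenkoPastur α) := by simp
  rw [e, logPotential]
  refine integral_mono_ae (integrable_logPotential hα0 hα1 hv) (integrable_const _) ?_
  filter_upwards [ae_lt_lamPlus_marchenkoPastur α, ae_mem_Icc_marchenkoPastur α] with l hl hl0
  have h2 : (1 - α) * l < v := by
    refine lt_of_lt_of_le ?_ hv
    rw [topEdge_eq hα1]
    gcongr
  exact Real.log_le_log (by linarith) (by linarith [mul_nonneg h1.le hl0.1])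

/-- The Stieltjes transform is finite at the edge and decreasing, so its edge value is a Lipschitz
constant up to the boundary. -/
theorem continuousOn_logPotential (hα0 : 0 < α) (hα1 : α < 1) :
    ContinuousOn (logPotential α) (Ici (topEdge α)) := by
  have hsl := slopeBound_logPotential hα0 hα1
  have hbr : ∀ v, topEdge α ≤ v → 0 ≤ branch α v / α ∧ branch α v / α ≤ branch α (topEdge α) / α := by
    intro v hv
    have h1 : 0 < 1 - α := by linarith
    obtain ⟨r1, r2⟩ := resolvent_marchenkoPastur hα0 hα1 hv
    obtain ⟨r1', r2'⟩ := resolvent_marchenkoPastur hα0 hα1 (le_refl (topEdge α))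
    have hlt : ∀ᵐ l ∂(marchenkoPastur α), (1 - α) * l < topEdge α := by
      filter_upwards [ae_lt_lamPlus_marchenkoPastur α] with l hl
      rw [topEdge_eq hα1]
      gcongr
    rw [← r2, ← r2']
    constructor
    · exact integral_nonneg_of_ae (hlt.mono fun l hl => inv_nonneg.2 (by linarith))
    · refine integral_mono_ae r1 r1' (hlt.mono fun l hl => ?_)
      exact inv_anti₀ (by linarith) (by linarith)
  have hlip : LipschitzOnWith (branch α (topEdge α) / α).toNNReal (logPotential α)
      (Ici (topEdge α)) := by
    refine LipschitzOnWith.of_dist_le_mul fun u hu u' hu' => ?_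
    rw [Real.coe_toNNReal _ (hbr _ le_rfl).1]
    wlog huu : u < u' generalizing u u'
    · rcases (not_lt.1 huu).eq_or_lt with h | h
      · simp [h]
      · rw [dist_comm, dist_comm u]
        exact this u' hu' u hu h
    obtain ⟨a, b⟩ := hsl u hu u' hu' huu
    have h1 := sub_pos.2 huu
    have h2 := mul_nonneg h1.le (hbr u' hu').1
    rw [Real.dist_eq, Real.dist_eq, abs_sub_comm, abs_sub_comm u, abs_of_pos h1,
      abs_of_nonneg (h2.trans a), mul_comm]
    exact b.trans (mul_le_mul_of_nonneg_left (hbr u hu).2 h1.le)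
  exact hlip.continuousOn

theorem hasDerivAt_logPotential (hα0 : 0 < α) (hα1 : α < 1) {v : ℝ} (hv : topEdge α < v) :
    HasDerivAt (logPotential α) (branch α v / α) v := by
  have htop := one_lt_topEdge hα0 hα1
  have h : SlopeBound (logPotential α) (fun v => branch α v / α) (Ioi (topEdge α)) :=
    fun u hu u' hu' => slopeBound_logPotential hα0 hα1 u (Ioi_subset_Ici_self hu) u'
      (Ioi_subset_Ici_self hu')
  exact hasDerivAt_of_slopeBound h hv ((continuousAt_branch (by linarith)).div_const _)

theorem branch_div_le (hα0 : 0 < α) (hα1 : α < 1) {v : ℝ} (hv : topEdge α < v) :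
    branch α v / α ≤ (v - topEdge α)⁻¹ := by
  have := isProbabilityMeasure_marchenkoPastur hα0 hα1
  have h1 : 0 < 1 - α := by linarith
  obtain ⟨r1, r2⟩ := resolvent_marchenkoPastur hα0 hα1 hv.le
  have e : (v - topEdge α)⁻¹ = ∫ _, (v - topEdge α)⁻¹ ∂(marchenkoPastur α) := by simp
  rw [← r2, e]
  refine integral_mono_ae r1 (integrable_const _) ?_
  filter_upwards [ae_lt_lamPlus_marchenkoPastur α] with l hl
  refine inv_anti₀ (by linarith) ?_
  rw [topEdge_eq hα1]
  have := mul_le_mul_of_nonneg_left hl.le h1.le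
  linarith

/-- A near-optimal spectral parameter at which the spherical constraint is satisfied strictly. -/
theorem exists_nearly_saturated (hα0 : 0 < α) (hα1 : α < 1) {K ε : ℝ} (hK : 0 < K) (hε : 0 < ε) :
    ∃ v, topEdge α < v ∧ branch α v / α < K ∧ (v - topEdge α) * (K - branch α v / α) < ε := by
  have htop := one_lt_topEdge hα0 hα1
  -- In the first case the spherical constraint is never saturated (condensation), and `v` is taken
  -- so close to the edge that the product is small.
  by_cases hc : ∀ v, topEdge α < v → branch α v / α < K
  · refine ⟨topEdge α + ε / (2 * K), lt_add_of_pos_right _ (by positivity), hc _ ?_, ?_⟩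
    · exact lt_add_of_pos_right _ (by positivity)
    · have hv : topEdge α < topEdge α + ε / (2 * K) := lt_add_of_pos_right _ (by positivity)
      have h1 : 0 < branch α (topEdge α + ε / (2 * K)) / α :=
        div_pos (branch_spec hα0 hα1 hv).1 hα0
      rw [add_sub_cancel_left]
      calc ε / (2 * K) * (K - branch α (topEdge α + ε / (2 * K)) / α)
          ≤ ε / (2 * K) * K := by gcongr; linarith
        _ = ε / 2 := by field_simp
        _ < ε := by linarith
  · push Not at hc
    obtain ⟨v₁, hv₁, hK₁⟩ := hc
    -- Here saturation is possible, and `v` is chosen by the intermediate value theorem to reach a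
    -- level `κ` just below `K`. As `v - topEdge α ≤ κ⁻¹ ≤ 2 / K`, a gap `K ε / 4` gives a product
    -- of at most `ε / 2`.
    set κ := max (K / 2) (K - K * ε / 4) with hκ
    have hκK : κ < K := max_lt (by linarith) (by linarith [mul_pos hK hε])
    have hκ2 : K / 2 ≤ κ := le_max_left _ _
    have hκ0 : 0 < κ := by linarith
    set v₂ := max v₁ (topEdge α + κ⁻¹) with hv₂
    have hv₂' : topEdge α < v₂ := hv₁.trans_le (le_max_left _ _)
    have h2 : branch α v₂ / α ≤ κ := by
      refine (branch_div_le hα0 hα1 hv₂').trans ?_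
      rw [inv_le_comm₀ (by linarith) hκ0]
      linarith [le_max_right v₁ (topEdge α + κ⁻¹)]
    have hcont : ContinuousOn (fun v => branch α v / α) (Icc v₁ v₂) := fun v hv =>
      ((continuousAt_branch (by linarith [hv.1])).div_const _).continuousWithinAt
    obtain ⟨v, hv, hvκ⟩ := intermediate_value_Icc' (le_max_left _ _) hcont
      (show κ ∈ Icc (branch α v₂ / α) (branch α v₁ / α) from ⟨h2, by linarith⟩)
    simp only at hvκ
    have hv' : topEdge α < v := hv₁.trans_le hv.1
    refine ⟨v, hv', by rw [hvκ]; exact hκK, ?_⟩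
    have h3 := branch_div_le hα0 hα1 hv'
    rw [hvκ, le_inv_comm₀ hκ0 (by linarith)] at h3
    rw [hvκ]
    have h4 : κ⁻¹ ≤ 2 / K := by
      rw [inv_le_comm₀ hκ0 (by positivity), inv_div]
      exact hκ2
    have h5 : K - κ ≤ K * ε / 4 := by linarith [le_max_right (K / 2) (K - K * ε / 4)]
    calc (v - topEdge α) * (K - κ) ≤ 2 / K * (K * ε / 4) :=
          mul_le_mul (h3.trans h4) h5 (by linarith) (by positivity)
      _ = ε / 2 := by field_simp; norm_num
      _ < ε := by linarith

/-- The square-root singularity of the limiting resolvent at the edge. -/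
theorem not_branch_lipschitz (hα0 : 0 < α) (hα1 : α < 1) {C : ℝ} (hC : 0 ≤ C)
    (h : ∀ v v', topEdge α < v → v < v' → branch α v - branch α v' ≤ C * (v' - v)) : False := by
  have htop := one_lt_topEdge hα0 hα1
  have hs : 0 < √α := Real.sqrt_pos.2 hα0
  have ht : 0 < √(1 - α) := Real.sqrt_pos.2 (by linarith)
  have h3 := Real.sq_sqrt hα0.le
  have h4 := Real.sq_sqrt (show 0 ≤ 1 - α by linarith)
  set e := 4 * (√α * √(1 - α)) with he
  have he0 : 0 < e := by positivity
  -- At distance `η` from the edge the root in `branch` is `√(η (η + e))`, of order `√η`, which no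
  -- linear bound can match.
  have hdisc : ∀ η, (topEdge α + η - 1 + 2 * α) ^ 2 - 4 * α * (topEdge α + η) = η * (η + e) := by
    intro η
    rw [topEdge, he]
    set s := √α
    set t := √(1 - α)
    have h1 : 1 = s ^ 2 + t ^ 2 := by linarith
    rw [← h3]
    linear_combination (-2 * ((s + t) ^ 2 + η + 2 * s ^ 2) + 1 + (s ^ 2 + t ^ 2)) * h1
  have hedge : ∀ v', topEdge α < v' → branch α (topEdge α) - branch α v' ≤ C * (v' - topEdge α) := by
    intro v' hv'
    have hc := (continuousAt_branch (α := α) (by linarith : 0 < topEdge α))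
    have t1 : Tendsto (fun v => branch α v - branch α v') (𝓝[>] (topEdge α))
        (𝓝 (branch α (topEdge α) - branch α v')) :=
      (hc.tendsto.sub_const _).mono_left nhdsWithin_le_nhds
    have t2 : Tendsto (fun v => C * (v' - v)) (𝓝[>] (topEdge α)) (𝓝 (C * (v' - topEdge α))) :=
      ((tendsto_id.const_sub _).const_mul _).mono_left nhdsWithin_le_nhds
    refine le_of_tendsto_of_tendsto t1 t2 ?_
    filter_upwards [self_mem_nhdsWithin,
      (eventually_lt_nhds hv').filter_mono nhdsWithin_le_nhds] with v hv hvv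
    exact h v v' hv hvv
  set D := 1 + 2 * topEdge α * C with hD
  have hD1 : 1 ≤ D := by rw [hD]; have := mul_nonneg (by linarith : 0 ≤ 2 * topEdge α) hC; linarith
  -- Chosen so that `(D η)² = η e / 2`, below `η (η + e)`.
  set η := e / (2 * D ^ 2) with hη
  have hη0 : 0 < η := by positivity
  have h5 := hedge (topEdge α + η) (by linarith)
  rw [add_sub_cancel_left] at h5
  have hb : ∀ η, 0 ≤ η → 2 * (topEdge α + η) * branch α (topEdge α + η)
      = (topEdge α + η - 1 + 2 * α) - √(η * (η + e)) := by
    intro η hη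
    have : 2 * (topEdge α + η) ≠ 0 := by linarith
    rw [branch, hdisc, mul_div_cancel₀ _ this]
  have b0 := hb 0 le_rfl
  have b1 := hb η hη0.le
  simp only [add_zero, zero_mul, Real.sqrt_zero, sub_zero] at b0
  have hbp := (branch_spec hα0 hα1 (show topEdge α < topEdge α + η by linarith)).1
  have h6 : √(η * (η + e)) ≤ D * η := by
    have h7 := mul_le_mul_of_nonneg_left h5 (by linarith : 0 ≤ 2 * topEdge α)
    have h8 := mul_pos hη0 hbp
    rw [hD]
    linarith
  have h9 : η * (η + e) ≤ (D * η) ^ 2 := by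
    rw [← Real.sqrt_le_left (by positivity)]
    exact h6
  have h10 : D ^ 2 * η = e / 2 := by rw [hη]; field_simp
  have h11 : (D * η) ^ 2 = (e / 2) * η := by rw [mul_pow, sq η, ← mul_assoc, h10]
  rw [h11] at h9
  nlinarith [mul_pos hη0 he0, mul_pos hη0 hη0]

end

end Hopfield

end

noncomputable section

namespace Hopfield

/-! ### The spectrum of the Gram matrix -/

section
open Matrix

variable {ι : Type*} [Fintype ι] [DecidableEq ι] {A : Matrix ι ι ℝ}

theorem IsHermitian.quadForm_eq (hA : A.IsHermitian) (x : EuclideanSpace ℝ ι) :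
    WithLp.ofLp x ⬝ᵥ A *ᵥ WithLp.ofLp x
      = ∑ k, hA.eigenvalues k * hA.eigenvectorBasis.repr x k ^ 2 := by
  have hsp := hA.spectral_theorem
  rw [Unitary.conjStarAlgAut_apply] at hsp
  set U : Matrix ι ι ℝ := (hA.eigenvectorUnitary : Matrix ι ι ℝ) with hU
  have hr : ∀ k, hA.eigenvectorBasis.repr x k = (Uᵀ *ᵥ WithLp.ofLp x) k := fun k => by
    rw [OrthonormalBasis.repr_apply_apply]
    simp [mulVec, dotProduct, hU, PiLp.inner_apply, mul_comm]
  have hs : star U = Uᵀ := by rw [star_eq_conjTranspose, conjTranspose_eq_transpose_of_trivial]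
  conv_lhs => rw [hsp, hs]
  rw [mul_assoc, ← mulVec_mulVec, dotProduct_mulVec, ← mulVec_transpose, ← mulVec_mulVec, dotProduct]
  refine Finset.sum_congr rfl fun k _ => ?_
  rw [hr, mulVec_diagonal]
  simp
  ring

theorem IsHermitian.eigenvalues_lt (hA : A.IsHermitian) {u : ℝ}
    (hu : (u • (1 : Matrix ι ι ℝ) - A).PosDef) (k : ι) : hA.eigenvalues k < u := by
  set e := hA.eigenvectorBasis k with he
  have hne : WithLp.ofLp e ≠ 0 := fun h => by
    have h1 : ‖e‖ = 1 := hA.eigenvectorBasis.orthonormal.1 k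
    have h2 : e = 0 := by ext i; exact congrFun h i
    rw [h2, norm_zero] at h1
    exact zero_ne_one h1
  have h := PosDef.quadForm_pos hu hne
  have h1 : A *ᵥ WithLp.ofLp e = hA.eigenvalues k • WithLp.ofLp e := hA.mulVec_eigenvectorBasis k
  rw [sub_mulVec, h1, smul_mulVec, one_mulVec, ← sub_smul, dotProduct_smul, smul_eq_mul] at h
  have h2 : 0 ≤ WithLp.ofLp e ⬝ᵥ WithLp.ofLp e := Finset.sum_nonneg fun i _ => mul_self_nonneg _
  by_contra hc
  push Not at hc
  exact absurd h (not_lt.2 (mul_nonpos_of_nonpos_of_nonneg (by linarith) h2))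

theorem IsHermitian.trace_resolvent (hA : A.IsHermitian) {u : ℝ}
    (hu : ∀ k, hA.eigenvalues k < u) :
    ((u • (1 : Matrix ι ι ℝ) - A)⁻¹).trace = ∑ k, (u - hA.eigenvalues k)⁻¹ := by
  set m := hA.eigenvalues with hm
  have hsp := hA.spectral_theorem
  rw [Unitary.conjStarAlgAut_apply] at hsp
  set U : Matrix ι ι ℝ := (hA.eigenvectorUnitary : Matrix ι ι ℝ)
  have hU1 : star U * U = 1 := Unitary.coe_star_mul_self _
  have hU2 : U * star U = 1 := Unitary.coe_mul_star_self _
  have e1 : u • (1 : Matrix ι ι ℝ) - A = U * diagonal (fun i => u - m i) * star U := by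
    have : diagonal (fun i => u - m i) = u • (1 : Matrix ι ι ℝ) - diagonal m := by
      rw [smul_one_eq_diagonal, diagonal_sub]
    rw [this, mul_sub, sub_mul, mul_smul_comm, mul_one, smul_mul_assoc, hU2]
    congr 1
  have hne : ∀ i, u - m i ≠ 0 := fun i => (sub_pos.2 (hu i)).ne'
  have e2 : (u • (1 : Matrix ι ι ℝ) - A)⁻¹ = U * diagonal (fun i => (u - m i)⁻¹) * star U := by
    refine inv_eq_right_inv ?_
    rw [e1]
    calc _ = U * diagonal (fun i => u - m i) * (star U * U) * diagonal (fun i => (u - m i)⁻¹)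
          * star U := by simp only [mul_assoc]
      _ = 1 := by
        rw [hU1, mul_one, mul_assoc U, diagonal_mul_diagonal]
        simp [hne, hU2]
  rw [e2, trace_mul_cycle, hU1, one_mul, trace_diagonal]

end

section
variable {α : ℝ} {w : ℕ → ℕ → ℝ}

/-- The eigenvalues of `Ξ Ξᵀ / (N₁ + N₂)`. -/
def spectrumGram (w : ℕ → ℕ → ℝ) (p : ℕ × ℕ) (k : Fin p.1) : ℝ :=
  (isHermitian_gram w p.1 p.2).eigenvalues k / ((p.1 : ℝ) + p.2)

theorem spectrumGram_nonneg (w : ℕ → ℕ → ℝ) (p : ℕ × ℕ) (k : Fin p.1) : 0 ≤ spectrumGram w p k := by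
  refine div_nonneg (Matrix.PosSemidef.eigenvalues_nonneg ?_ k) (by positivity)
  refine Matrix.PosSemidef.of_dotProduct_mulVec_nonneg (isHermitian_gram w p.1 p.2) fun x => ?_
  rw [star_trivial, quadForm_gram]
  exact Finset.sum_nonneg fun j _ => sq_nonneg _

theorem SpectralLimit.eventually_lt (h : SpectralLimit α w) {v : ℝ} (hv : topEdge α < v) :
    ∀ᶠ p in highLoad α, ∀ k, spectrumGram w p k < v := by
  filter_upwards [h.posDef v hv, highLoad_eventually_pos] with p hp hpos k
  have hT : (0 : ℝ) < (p.1 : ℝ) + p.2 := by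
    have : (0 : ℝ) < p.1 := by exact_mod_cast hpos.1
    positivity
  rw [spectrumGram, div_lt_iff₀ hT, mul_comm v]
  exact IsHermitian.eigenvalues_lt _ hp k

theorem SpectralLimit.tendsto_stieltjes (h : SpectralLimit α w) (hα0 : 0 < α) {v : ℝ}
    (hv : topEdge α < v) :
    Tendsto (fun p : ℕ × ℕ => 1 / (p.1 : ℝ) * ∑ k, (v - spectrumGram w p k)⁻¹) (highLoad α)
      (𝓝 (branch α v / α)) := by
  refine ((h.trace v hv).div highLoad_tendsto_ratio hα0.ne').congr' ?_
  filter_upwards [h.posDef v hv, highLoad_eventually_pos] with p hp hpos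
  have hn : (0 : ℝ) < p.1 := by exact_mod_cast hpos.1
  have hT : (0 : ℝ) < (p.1 : ℝ) + p.2 := by positivity
  rw [Pi.div_apply, IsHermitian.trace_resolvent (isHermitian_gram w p.1 p.2)
    (IsHermitian.eigenvalues_lt _ hp), Finset.sum_div, Finset.mul_sum]
  refine Finset.sum_congr rfl fun k _ => ?_
  have e : ((p.1 : ℝ) + p.2) * v - (isHermitian_gram w p.1 p.2).eigenvalues k
      = ((p.1 : ℝ) + p.2) * (v - spectrumGram w p k) := by
    rw [spectrumGram]; field_simp
  rw [e, mul_inv]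
  field_simp

theorem slopeBound_average {n : ℕ} (μ : Fin n → ℝ) {s : Set ℝ} (hs : ∀ u ∈ s, ∀ k, μ k < u) :
    SlopeBound (fun v => 1 / (n : ℝ) * ∑ k, Real.log (v - μ k))
      (fun v => 1 / (n : ℝ) * ∑ k, (v - μ k)⁻¹) s := by
  intro u hu u' hu' huu
  have e : 1 / (n : ℝ) * ∑ k, Real.log (u' - μ k) - 1 / (n : ℝ) * ∑ k, Real.log (u - μ k)
      = 1 / (n : ℝ) * ∑ k, (Real.log (u' - μ k) - Real.log (u - μ k)) := by
    rw [Finset.sum_sub_distrib, mul_sub]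
  have e2 : ∀ f : Fin n → ℝ,
      (u' - u) * (1 / (n : ℝ) * ∑ k, f k) = 1 / (n : ℝ) * ∑ k, (u' - u) * f k := fun f => by
    rw [mul_left_comm, Finset.mul_sum]
  simp only [e, e2]
  constructor
  · gcongr with k
    exact (log_sub_log_bounds (hs u hu k) huu).1
  · gcongr with k
    exact (log_sub_log_bounds (hs u hu k) huu).2

theorem SpectralLimit.tendsto_log (h : SpectralLimit α w) (hα0 : 0 < α) (hα1 : α < 1) {v : ℝ}
    (hv : topEdge α < v) :
    Tendsto (fun p : ℕ × ℕ => 1 / (p.1 : ℝ) * ∑ k, Real.log (v - spectrumGram w p k)) (highLoad α)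
      (𝓝 (logPotential α v)) := by
  have htop := one_lt_topEdge hα0 hα1
  set l : ℕ × ℕ → ℝ → ℝ := fun p v => 1 / (p.1 : ℝ) * ∑ k, Real.log (v - spectrumGram w p k)
  rw [Metric.tendsto_nhds]
  intro ε hε
  set c := topEdge α + 1 with hc
  -- At `V` both potentials differ from `log V` by at most `ε / 4`, so the limit at `v` follows by
  -- integrating the resolvents from `v` to `V`.
  set V := max (v + 1) (max (2 * c) (8 * c / ε)) with hV
  have hV1 : v < V := (lt_add_one v).trans_le (le_max_left _ _)
  have hV2 : 2 * c ≤ V := (le_max_left _ _).trans (le_max_right _ _)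
  have hV3 : 8 * c / ε ≤ V := (le_max_right _ _).trans (le_max_right _ _)
  have hV0 : 0 < V := by linarith
  have hbd : 2 * c / V ≤ ε / 4 := by
    rw [div_le_iff₀ hV0]
    rw [div_le_iff₀ hε] at hV3
    linarith
  obtain ⟨v', hv1, hv2⟩ := exists_between hv
  have key := tendsto_sub_of_slopeBound (F := highLoad α) (l := l)
    (s := fun p v => 1 / (p.1 : ℝ) * ∑ k, (v - spectrumGram w p k)⁻¹) hV1
    (fun u hu => h.tendsto_stieltjes hα0 (hv.trans_le hu.1))
    (by
      filter_upwards [h.eventually_lt hv1] with p hp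
      exact slopeBound_average _ fun u hu k => (hp k).trans (hv2.trans_le hu.1))
    (fun u hu u' hu' => slopeBound_logPotential hα0 hα1 u (hv.le.trans hu.1) u'
      (hv.le.trans hu'.1))
  have hL := abs_logPotential_sub_le hα0 hα1 (show topEdge α ≤ c by linarith) hV2
  filter_upwards [Metric.tendsto_nhds.1 key (ε / 4) (by positivity),
    h.eventually_lt (show topEdge α < c by linarith), highLoad_eventually_pos] with p h1 h2 hpos
  have hn : (0 : ℝ) < p.1 := by exact_mod_cast hpos.1
  have hlV : |l p V - Real.log V| ≤ 2 * c / V := by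
    have e : l p V - Real.log V
        = 1 / (p.1 : ℝ) * ∑ k, (Real.log (V - spectrumGram w p k) - Real.log V) := by
      simp only [l]
      rw [Finset.sum_sub_distrib, Finset.sum_const, Finset.card_univ, Fintype.card_fin,
        nsmul_eq_mul]
      field_simp
    rw [e, abs_mul, abs_of_pos (by positivity : (0 : ℝ) < 1 / p.1)]
    calc 1 / (p.1 : ℝ) * |∑ k, (Real.log (V - spectrumGram w p k) - Real.log V)|
        ≤ 1 / (p.1 : ℝ) * ∑ _k : Fin p.1, 2 * c / V := by
          gcongr
          refine (Finset.abs_sum_le_sum_abs _ _).trans (Finset.sum_le_sum fun k _ => ?_)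
          exact abs_log_sub_le (spectrumGram_nonneg w p k) (h2 k).le (by linarith) hV2
      _ = 2 * c / V := by
          rw [Finset.sum_const, Finset.card_univ, Fintype.card_fin, nsmul_eq_mul]
          field_simp
  rw [Real.dist_eq] at h1 ⊢
  rw [abs_lt] at h1 ⊢
  rw [abs_le] at hlV hL
  constructor <;> linarith [h1.1, h1.2, hlV.1, hlV.2, hL.1, hL.2]

theorem SpectralLimit.spectralFamily (h : SpectralLimit α w) (hα0 : 0 < α) (hα1 : α < 1) :
    SpectralFamily (highLoad α) Prod.fst (spectrumGram w) (topEdge α) (logPotential α) where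
  tendsto_card := highLoad_tendsto_fst
  nonneg := spectrumGram_nonneg w
  edge_nonneg := by linarith [one_lt_topEdge hα0 hα1]
  lt _ hv := h.eventually_lt hv
  log _ hv := h.tendsto_log hα0 hα1 hv

/-- The largest eigenvalue does not stay below the edge. -/
theorem SpectralLimit.eventually_exists_le (h : SpectralLimit α w) (hα0 : 0 < α) (hα1 : α < 1)
    {u : ℝ} (hu : u < topEdge α) : ∀ᶠ p in highLoad α, ∃ k, u ≤ spectrumGram w p k := by
  by_contra hc
  have hf : ∃ᶠ p in highLoad α, ∀ k, spectrumGram w p k < u := by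
    refine (not_eventually.1 hc).mono fun p hp => ?_
    push Not at hp
    exact hp
  set d := topEdge α - u with hd
  have hd0 : 0 < d := sub_pos.2 hu
  -- A spectrum below `u` has a resolvent with Lipschitz constant `d⁻²` beyond the edge. If this
  -- recurs along the filter, the limit inherits it, against the square-root singularity.
  refine not_branch_lipschitz hα0 hα1 (C := α * (d⁻¹ * d⁻¹)) (by positivity) fun v v' hv hvv => ?_
  have ht := (h.tendsto_stieltjes hα0 hv).sub (h.tendsto_stieltjes hα0 (hv.trans hvv))
  have hle : branch α v / α - branch α v' / α ≤ d⁻¹ * d⁻¹ * (v' - v) := by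
    refine le_of_tendsto_of_frequently ht ?_
    refine (hf.and_eventually highLoad_eventually_pos).mono fun p ⟨hp, hpos⟩ => ?_
    have hn : (0 : ℝ) < p.1 := by exact_mod_cast hpos.1
    rw [← mul_sub, ← Finset.sum_sub_distrib]
    calc 1 / (p.1 : ℝ) * ∑ k, ((v - spectrumGram w p k)⁻¹ - (v' - spectrumGram w p k)⁻¹)
        ≤ 1 / (p.1 : ℝ) * ∑ _k : Fin p.1, d⁻¹ * d⁻¹ * (v' - v) := by
          gcongr with k
          have h1 : d ≤ v - spectrumGram w p k := by linarith [hp k]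
          have h2 : d ≤ v' - spectrumGram w p k := by linarith
          have h3 : 0 < v - spectrumGram w p k := by linarith
          have h4 : 0 < v' - spectrumGram w p k := by linarith
          have e : (v - spectrumGram w p k)⁻¹ - (v' - spectrumGram w p k)⁻¹
              = (v - spectrumGram w p k)⁻¹ * (v' - spectrumGram w p k)⁻¹ * (v' - v) := by
            field_simp
            ring
          rw [e]
          have : 0 ≤ v' - v := by linarith
          gcongr
      _ = d⁻¹ * d⁻¹ * (v' - v) := by
          rw [Finset.sum_const, Finset.card_univ, Fintype.card_fin, nsmul_eq_mul]
          field_simp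
  rw [← sub_div, div_le_iff₀ hα0] at hle
  linarith

end

end Hopfield

end

noncomputable section

namespace Hopfield

/-! ### The variational problem -/

section
variable {α β R : ℝ}

/-- The functional that is minimised, in terms of the spectral parameter `v = 2 q / β`. -/
def spectralValue (α β R v : ℝ) : ℝ :=
  β / 2 * v * R ^ 2 - 1 / 2 * Real.log β - 1 / 2 * logPotential α v - Real.log R - 1 / 2

theorem continuousOn_spectralValue (hα0 : 0 < α) (hα1 : α < 1) :
    ContinuousOn (spectralValue α β R) (Ici (topEdge α)) := by
  have := continuousOn_logPotential hα0 hα1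
  unfold spectralValue
  fun_prop

theorem exists_forall_spectralValue_le (hα0 : 0 < α) (hα1 : α < 1) (hβ : 0 < β) (hR : 0 < R) :
    ∃ v₁, topEdge α ≤ v₁ ∧ ∀ v, topEdge α ≤ v → spectralValue α β R v₁ ≤ spectralValue α β R v := by
  have htop := one_lt_topEdge hα0 hα1
  set a := β * R ^ 2 / 2 with ha
  have ha0 : 0 < a := by positivity
  -- Using `logPotential α v ≤ log v` and `log (a v) ≤ a v - 1`, the logarithm consumes only half of
  -- the linear term. The minimum may therefore be sought on a compact interval.
  have hgrow : ∀ v, topEdge α ≤ v → a / 2 * v + (1 / 2 * Real.log a - 1 / 2 * Real.log β - Real.log R)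
      ≤ spectralValue α β R v := by
    intro v hv
    have hv0 : 0 < v := by linarith
    have h1 := logPotential_le_log hα0 hα1 hv
    have h2 := Real.log_le_sub_one_of_pos (mul_pos ha0 hv0)
    rw [Real.log_mul ha0.ne' hv0.ne'] at h2
    rw [spectralValue]
    have e : β / 2 * v * R ^ 2 = a * v := by rw [ha]; ring
    rw [e]
    linarith
  set b := 1 / 2 * Real.log a - 1 / 2 * Real.log β - Real.log R with hb
  set V := max (topEdge α) ((spectralValue α β R (topEdge α) - b) / (a / 2)) with hV
  obtain ⟨v₁, hv₁, hmin⟩ := isCompact_Icc.exists_isMinOn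
    (nonempty_Icc.2 (le_max_left (topEdge α) ((spectralValue α β R (topEdge α) - b) / (a / 2))))
    ((continuousOn_spectralValue (β := β) (R := R) hα0 hα1).mono fun x hx => hx.1)
  refine ⟨v₁, hv₁.1, fun v hv => ?_⟩
  by_cases hvV : v ≤ V
  · exact hmin ⟨hv, hvV⟩
  · push Not at hvV
    have h1 : spectralValue α β R v₁ ≤ spectralValue α β R (topEdge α) :=
      hmin ⟨le_rfl, le_max_left _ _⟩
    have h2 : (spectralValue α β R (topEdge α) - b) / (a / 2) ≤ v :=
      (le_max_right _ _).trans hvV.le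
    rw [div_le_iff₀ (by positivity)] at h2
    linarith [hgrow v hv]

theorem mem_feasible_iff (hα1 : α < 1) (hβ : 0 < β) {q : ℝ} :
    q ∈ feasible α β ↔ topEdge α ≤ 2 * q / β := by
  rw [le_div_iff₀ hβ, topEdge_eq hα1, feasible, mem_ofPred_eq,
    show (1 - α) * lamPlus α * β = β * (1 - α) * lamPlus α by ring]

theorem variational_eq_spectralValue (hα0 : 0 < α) (hα1 : α < 1) (hβ : 0 < β) {q : ℝ}
    (hq : q ∈ feasible α β) : variational α β R q = spectralValue α β R (2 * q / β) := by
  rw [variational_eq hα0 hα1 R hβ hq, spectralValue]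
  field_simp
  ring

theorem isLeast_variational (hα0 : 0 < α) (hα1 : α < 1) (hβ : 0 < β) {v₁ : ℝ}
    (hv₁ : topEdge α ≤ v₁)
    (hmin : ∀ v, topEdge α ≤ v → spectralValue α β R v₁ ≤ spectralValue α β R v) :
    IsLeast (variational α β R '' feasible α β) (spectralValue α β R v₁) := by
  have e : 2 * (β * v₁ / 2) / β = v₁ := by field_simp
  have hq : β * v₁ / 2 ∈ feasible α β := by rwa [mem_feasible_iff hα1 hβ, e]
  constructor
  · exact ⟨_, hq, by rw [variational_eq_spectralValue hα0 hα1 hβ hq, e]⟩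
  · rintro _ ⟨q, hq', rfl⟩
    rw [variational_eq_spectralValue hα0 hα1 hβ hq']
    exact hmin _ ((mem_feasible_iff hα1 hβ).1 hq')

/-- The normalised logarithm of the spherical integral converges to the minimum. -/
theorem SpectralLimit.tendsto_log_cone {w : ℕ → ℕ → ℝ} (h : SpectralLimit α w) (hα0 : 0 < α)
    (hα1 : α < 1) (hβ : 0 < β) (hR : 0 < R) {v₁ : ℝ} (hv₁ : topEdge α ≤ v₁)
    (hmin : ∀ v, topEdge α ≤ v → spectralValue α β R v₁ ≤ spectralValue α β R v) :
    Tendsto (fun p : ℕ × ℕ => 1 / (p.1 : ℝ) * Real.log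
      (coneIntegral β (R * √p.1) (spectrumGram w p)
        / coneIntegral β (R * √p.1) (0 : Fin p.1 → ℝ))) (highLoad α)
      (𝓝 (spectralValue α β R v₁)) := by
  refine (h.spectralFamily hα0 hα1).tendsto_log_div hβ hR
    (fun u hu => h.eventually_exists_le hα0 hα1 hu) (fun ε hε => ?_) fun ε hε => ?_
  -- The minimiser may be the edge itself, where the Gaussian bound is unavailable; nearby larger
  -- `v` are used instead.
  · have hc : ContinuousWithinAt (spectralValue α β R) (Ioi v₁) v₁ :=
      (continuousOn_spectralValue hα0 hα1 v₁ hv₁).mono fun x hx => hv₁.trans (le_of_lt hx)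
    obtain ⟨v, hv, hv2⟩ := ((hc.eventually_lt_const (lt_add_of_pos_right _ hε)).and
      self_mem_nhdsWithin).exists
    exact ⟨v, hv₁.trans_lt hv2, hv⟩
  -- The lower bound at `v` falls short of `spectralValue α β R v`, hence of the minimum, by at most
  -- half of `(v - topEdge α) (β R² - branch α v / α) < 2 ε`.
  · obtain ⟨v, hv, hK, hs⟩ := exists_nearly_saturated hα0 hα1
      (show 0 < β * R ^ 2 by positivity) (show 0 < 2 * ε by positivity)
    have e : β * (branch α v / α / β) = branch α v / α := by field_simp
    refine ⟨v, hv, branch α v / α / β, ?_, ?_, ?_⟩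
    · rw [div_lt_iff₀ hβ, mul_comm]
      exact hK
    · rw [e]
      exact hasDerivAt_logPotential hα0 hα1 hv
    · have hm := hmin v hv.le
      have e2 : β / 2 * (topEdge α * (R ^ 2 - branch α v / α / β) + v * (branch α v / α / β))
          = β / 2 * v * R ^ 2 - 1 / 2 * ((v - topEdge α) * (β * R ^ 2 - branch α v / α)) := by
        field_simp
        ring
      rw [e2]
      rw [spectralValue.eq_1 α β R v] at hm
      linarith

end

/-! ### Energies on the sphere -/

theorem sq_sum_eq {n : ℕ} (a : Fin n → ℝ) :
    (∑ i, a i) ^ 2 = ∑ i, a i ^ 2 + 2 * ∑ k, ∑ i ∈ Finset.Iio k, a i * a k := by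
  have h1 : ∀ k, ∑ i ∈ Finset.Iio k, a i * a k = ∑ i, if i < k then a i * a k else 0 := fun k => by
    rw [← Finset.sum_filter]
    exact Finset.sum_congr (by ext; simp) fun _ _ => rfl
  have h2 : (∑ k, ∑ i, if i < k then a i * a k else 0) = ∑ k, ∑ i, if k < i then a i * a k else 0 := by
    rw [Finset.sum_comm]
    refine Finset.sum_congr rfl fun k _ => Finset.sum_congr rfl fun i _ => ?_
    rw [mul_comm]
  have h3 : ∑ i, a i ^ 2 = ∑ k, ∑ i, if i = k then a i * a k else 0 := by
    simp [sq]
  simp only [h1]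
  rw [two_mul]
  nth_rewrite 2 [h2]
  rw [h3, ← Finset.sum_add_distrib, ← Finset.sum_add_distrib, sq, Finset.sum_mul_sum]
  refine Finset.sum_congr rfl fun k _ => ?_
  rw [← Finset.sum_add_distrib, ← Finset.sum_add_distrib]
  refine Finset.sum_congr rfl fun i _ => ?_
  rcases lt_trichotomy i k with h | h | h
  · simp [h, h.ne, h.not_gt, mul_comm]
  · simp [h]
  · simp [h, h.ne', h.not_gt, mul_comm]

/-! ### From spherical integrals to the two free energies. -/

section
variable {w : ℕ → ℕ → ℝ} {α β R : ℝ}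

theorem neg_mul_energy_eq (w : ℕ → ℕ → ℝ) (β : ℝ) (p : ℕ × ℕ) (x : EuclideanSpace ℝ (Fin p.1)) :
    -β * energy w p.1 p.2 x = β / 2 * ∑ k, spectrumGram w p k
      * (isHermitian_gram w p.1 p.2).eigenvectorBasis.repr x k ^ 2 := by
  have e1 : ∑ k, spectrumGram w p k * (isHermitian_gram w p.1 p.2).eigenvectorBasis.repr x k ^ 2
      = (∑ j : Fin p.2, (∑ i : Fin p.1, w i j * x i) ^ 2) / ((p.1 : ℝ) + p.2) := by
    simp only [spectrumGram, div_mul_eq_mul_div]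
    rw [← Finset.sum_div, ← IsHermitian.quadForm_eq, quadForm_gram, ← Fin.sum_univ_eq_sum_range
      (fun j => (WithLp.ofLp x ⬝ᵥ fun i : Fin p.1 => w i j) ^ 2)]
    simp [dotProduct, mul_comm]
  rw [e1, energy, one_div, mul_inv]
  ring

theorem neg_mul_pairEnergy_eq (w : ℕ → ℕ → ℝ) (β : ℝ) (n N : ℕ) (x : EuclideanSpace ℝ (Fin n)) :
    -β * pairEnergy w n N x = -β * energy w n N x
      - β / 2 * ((∑ i : Fin n, x i ^ 2 * ∑ j ∈ Finset.range N, w i j ^ 2) / ((n : ℝ) + N)) := by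
  have e1 : ∑ i : Fin n, x i ^ 2 * ∑ j ∈ Finset.range N, w i j ^ 2
      = ∑ j : Fin N, ∑ i : Fin n, (w i j * x i) ^ 2 := by
    rw [Finset.sum_comm]
    refine Finset.sum_congr rfl fun i _ => ?_
    rw [← Fin.sum_univ_eq_sum_range (fun j => w i j ^ 2), Finset.mul_sum]
    exact Finset.sum_congr rfl fun j _ => by ring
  have e2 : ∑ j : Fin N, (∑ i : Fin n, w i j * x i) ^ 2
      = ∑ j : Fin N, ∑ i : Fin n, (w i j * x i) ^ 2
        + 2 * ∑ j : Fin N, ∑ k : Fin n, ∑ i ∈ Finset.Iio k,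
          w (i : ℕ) (j : ℕ) * w (k : ℕ) (j : ℕ) * x i * x k := by
    rw [Finset.mul_sum, ← Finset.sum_add_distrib]
    refine Finset.sum_congr rfl fun j _ => ?_
    rw [sq_sum_eq]
    congr 2
    refine Finset.sum_congr rfl fun k _ => Finset.sum_congr rfl fun i _ => ?_
    ring
  rw [e1, pairEnergy, energy, e2, one_div, one_div, mul_inv]
  ring

theorem isFiniteMeasure_sphericalPrior {n : ℕ} (hn : 0 < n) (R : ℝ) :
    IsFiniteMeasure (sphericalPrior n R) := by
  have : Nonempty (Fin n) := ⟨⟨0, hn⟩⟩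
  rw [sphericalPrior]
  refine Measure.smul_finite _ (ENNReal.inv_ne_top.2 ?_)
  rw [Measure.toSphere_apply_univ]
  have := Module.finrank_pos (R := ℝ) (M := EuclideanSpace ℝ (Fin n))
  refine mul_ne_zero (by exact_mod_cast this.ne') (Metric.measure_ball_pos _ _ one_pos).ne'

theorem ae_norm_sphericalPrior (n : ℕ) {R : ℝ} (hR : 0 < R) :
    ∀ᵐ x ∂(sphericalPrior n R), ‖x‖ = R * √n := by
  refine Measure.ae_smul_measure ?_ _
  have hm : Measurable (fun u : Metric.sphere (0 : EuclideanSpace ℝ (Fin n)) 1 =>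
      (R * √(n : ℝ)) • (u : EuclideanSpace ℝ (Fin n))) := by fun_prop
  rw [ae_map_iff hm.aemeasurable (measurableSet_eq_fun measurable_norm measurable_const)]
  refine ae_of_all _ fun u => ?_
  rw [norm_smul, norm_eq_of_mem_sphere, mul_one, Real.norm_of_nonneg (by positivity)]

theorem integrable_sphericalPrior {n : ℕ} (hn : 0 < n) {R : ℝ} (hR : 0 < R)
    {f : EuclideanSpace ℝ (Fin n) → ℝ} (hf : Continuous f) : Integrable f (sphericalPrior n R) := by
  have := isFiniteMeasure_sphericalPrior hn R
  obtain ⟨C, hC⟩ := (isCompact_sphere (0 : EuclideanSpace ℝ (Fin n)) (R * √n)).exists_bound_of_continuousOn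
    hf.continuousOn
  refine Integrable.of_bound hf.aestronglyMeasurable C ?_
  filter_upwards [ae_norm_sphericalPrior n hR] with x hx
  exact hC x (by simpa using hx)

theorem partitionFunction_energy {p : ℕ × ℕ} (hp : 0 < p.1) (hR : 0 < R) (w : ℕ → ℕ → ℝ) (β : ℝ) :
    partitionFunction p.1 β R (energy w p.1 p.2)
      = coneIntegral β (R * √p.1) (spectrumGram w p)
        / coneIntegral β (R * √p.1) (0 : Fin p.1 → ℝ) := by
  rw [partitionFunction]
  simp only [neg_mul_energy_eq]
  exact integral_sphericalPrior_exp hp hR _ fun x => rfl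

theorem SpectralLimit.eventually_partitionFunction_pos (h : SpectralLimit α w) (hα0 : 0 < α)
    (hα1 : α < 1) (hβ : 0 < β) (hR : 0 < R) :
    ∀ᶠ p in highLoad α, 0 < partitionFunction p.1 β R (energy w p.1 p.2) := by
  have htop := one_lt_topEdge hα0 hα1
  filter_upwards [h.eventually_lt (lt_add_one (topEdge α)), highLoad_eventually_pos] with p h1 hpos
  have hn : (0 : ℝ) < p.1 := by exact_mod_cast hpos.1
  rw [partitionFunction_energy hpos.1 hR]
  exact div_pos (coneIntegral_pos (by positivity) hβ (by linarith) h1)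
    (coneIntegral_pos (v := 1) (by positivity) hβ zero_le_one fun _ => one_pos)

theorem SpectralLimit.tendsto_freeEnergy (h : SpectralLimit α w) (hα0 : 0 < α)
    (hα1 : α < 1) (hβ : 0 < β) (hR : 0 < R) {v₁ : ℝ} (hv₁ : topEdge α ≤ v₁)
    (hmin : ∀ v, topEdge α ≤ v → spectralValue α β R v₁ ≤ spectralValue α β R v) :
    Tendsto (fun p : ℕ × ℕ => freeEnergy p.1 p.2 β R (energy w p.1 p.2)) (highLoad α)
      (𝓝 (α * spectralValue α β R v₁)) := by
  refine (highLoad_tendsto_ratio.mul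
    (h.tendsto_log_cone hα0 hα1 hβ hR hv₁ hmin)).congr' ?_
  filter_upwards [highLoad_eventually_pos] with p hpos
  have hn : (0 : ℝ) < p.1 := by exact_mod_cast hpos.1
  rw [freeEnergy, partitionFunction_energy hpos.1 hR]
  field_simp

theorem abs_diagonal_sub_le {n : ℕ} {d : Fin n → ℝ} {T c η : ℝ} (hT : 0 < T)
    (hd : ∀ i, |d i - c * T| ≤ η * T) (x : EuclideanSpace ℝ (Fin n)) :
    |(∑ i, x i ^ 2 * d i) / T - c * ‖x‖ ^ 2| ≤ η * ‖x‖ ^ 2 := by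
  have e : (∑ i, x i ^ 2 * d i) / T - c * ‖x‖ ^ 2 = (∑ i, x i ^ 2 * (d i - c * T)) / T := by
    simp only [mul_sub, Finset.sum_sub_distrib, ← Finset.sum_mul]
    rw [EuclideanSpace.real_norm_sq_eq]
    field_simp
  rw [e, abs_div, abs_of_pos hT, div_le_iff₀ hT, EuclideanSpace.real_norm_sq_eq]
  calc |∑ i, x i ^ 2 * (d i - c * T)| ≤ ∑ i, x i ^ 2 * (η * T) := by
        refine (Finset.abs_sum_le_sum_abs _ _).trans (Finset.sum_le_sum fun i _ => ?_)
        rw [abs_mul, abs_of_nonneg (sq_nonneg _)]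
        gcongr
        exact hd i
    _ = η * (∑ i, x i ^ 2) * T := by
        rw [← Finset.sum_mul]
        ring

theorem continuous_energy (w : ℕ → ℕ → ℝ) (n N : ℕ) : Continuous (energy w n N) := by
  unfold energy
  fun_prop

theorem continuous_pairEnergy (w : ℕ → ℕ → ℝ) (n N : ℕ) : Continuous (pairEnergy w n N) := by
  unfold pairEnergy
  fun_prop

/-- Energies that differ by almost a constant on the sphere have almost the same free energy. -/
theorem abs_log_partitionFunction_sub_le {n : ℕ} (hn : 0 < n) (hR : 0 < R) {c δ : ℝ}
    {H H' : EuclideanSpace ℝ (Fin n) → ℝ} (hH : Continuous H) (hH' : Continuous H')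
    (hpos : 0 < partitionFunction n β R H)
    (hclose : ∀ x, ‖x‖ = R * √n → |(-β * H' x) - (-β * H x) + c| ≤ δ) :
    |Real.log (partitionFunction n β R H') - Real.log (partitionFunction n β R H) + c| ≤ δ := by
  have i1 : Integrable (fun x => Real.exp (-β * H x)) (sphericalPrior n R) :=
    integrable_sphericalPrior hn hR (by fun_prop)
  have i2 : Integrable (fun x => Real.exp (-β * H' x)) (sphericalPrior n R) :=
    integrable_sphericalPrior hn hR (by fun_prop)
  have hlo : Real.exp (-c - δ) * partitionFunction n β R H ≤ partitionFunction n β R H' := by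
    rw [partitionFunction, partitionFunction, ← integral_const_mul]
    refine integral_mono_ae (i1.const_mul _) i2 ?_
    filter_upwards [ae_norm_sphericalPrior n hR] with x hx
    rw [← Real.exp_add, Real.exp_le_exp]
    linarith [(abs_le.1 (hclose x hx)).1]
  have hup : partitionFunction n β R H' ≤ Real.exp (-c + δ) * partitionFunction n β R H := by
    rw [partitionFunction, partitionFunction, ← integral_const_mul]
    refine integral_mono_ae i2 (i1.const_mul _) ?_
    filter_upwards [ae_norm_sphericalPrior n hR] with x hx
    rw [← Real.exp_add, Real.exp_le_exp]
    linarith [(abs_le.1 (hclose x hx)).2]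
  have h1 := Real.log_le_log (mul_pos (Real.exp_pos _) hpos) hlo
  have h2 := Real.log_le_log ((mul_pos (Real.exp_pos _) hpos).trans_le hlo) hup
  rw [Real.log_mul (Real.exp_pos _).ne' hpos.ne', Real.log_exp] at h1 h2
  rw [abs_le]
  constructor <;> linarith

/-- The diagonal part is a weighted sum of the `xᵢ²` with weights uniformly close to `1 - α`, so on
the sphere it equals `(1 - α) R² N₁` up to `η R² N₁`. -/
theorem SpectralLimit.tendsto_freeEnergy_sub (h : SpectralLimit α w) (hα0 : 0 < α)
    (hα1 : α < 1) (hβ : 0 < β) (hR : 0 < R) :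
    Tendsto (fun p : ℕ × ℕ => freeEnergy p.1 p.2 β R (pairEnergy w p.1 p.2)
      - freeEnergy p.1 p.2 β R (energy w p.1 p.2)
      + β / 2 * (1 - α) * R ^ 2 * ((p.1 : ℝ) / ((p.1 : ℝ) + p.2))) (highLoad α) (𝓝 0) := by
  rw [Metric.tendsto_nhds]
  intro ε hε
  set η := ε / (β * R ^ 2) with hη
  have hη0 : 0 < η := by positivity
  filter_upwards [h.diag η hη0, h.eventually_partitionFunction_pos hα0 hα1 hβ hR,
    highLoad_eventually_pos] with p hd hZ hpos
  have hn : (0 : ℝ) < p.1 := by exact_mod_cast hpos.1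
  have hT : (0 : ℝ) < (p.1 : ℝ) + p.2 := by positivity
  have key := abs_log_partitionFunction_sub_le (β := β) (c := β / 2 * ((1 - α) * (R ^ 2 * p.1)))
    (δ := β / 2 * (η * (R ^ 2 * p.1))) hpos.1 hR (continuous_energy w p.1 p.2)
    (continuous_pairEnergy w p.1 p.2) hZ (fun x hx => by
      have h1 := abs_diagonal_sub_le hT (fun i : Fin p.1 => hd i i.2) x
      rw [hx, mul_pow, Real.sq_sqrt hn.le] at h1
      rw [neg_mul_pairEnergy_eq, show ∀ a b c d : ℝ, a - b * c - a + b * d = -(b * (c - d)) by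
        intros; ring, abs_neg, abs_mul, abs_of_pos (by positivity : 0 < β / 2)]
      gcongr)
  rw [Real.dist_eq, sub_zero]
  have e : freeEnergy p.1 p.2 β R (pairEnergy w p.1 p.2)
      - freeEnergy p.1 p.2 β R (energy w p.1 p.2)
      + β / 2 * (1 - α) * R ^ 2 * ((p.1 : ℝ) / ((p.1 : ℝ) + p.2))
      = (Real.log (partitionFunction p.1 β R (pairEnergy w p.1 p.2))
        - Real.log (partitionFunction p.1 β R (energy w p.1 p.2))
        + β / 2 * ((1 - α) * (R ^ 2 * p.1))) / ((p.1 : ℝ) + p.2) := by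
    rw [freeEnergy, freeEnergy]
    field_simp
  rw [e, abs_div, abs_of_pos hT, div_lt_iff₀ hT]
  refine key.trans_lt ?_
  have e2 : β / 2 * (η * (R ^ 2 * p.1)) = ε / 2 * p.1 := by rw [hη]; field_simp
  rw [e2]
  have h3 : (0 : ℝ) ≤ p.2 := Nat.cast_nonneg _
  nlinarith [mul_pos hε hn, mul_nonneg hε.le h3]

theorem SpectralLimit.tendsto_freeEnergy_pair (h : SpectralLimit α w) (hα0 : 0 < α)
    (hα1 : α < 1) (hβ : 0 < β) (hR : 0 < R) {v₁ : ℝ} (hv₁ : topEdge α ≤ v₁)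
    (hmin : ∀ v, topEdge α ≤ v → spectralValue α β R v₁ ≤ spectralValue α β R v) :
    Tendsto (fun p : ℕ × ℕ => freeEnergy p.1 p.2 β R (pairEnergy w p.1 p.2)) (highLoad α)
      (𝓝 (α * (spectralValue α β R v₁ - β * (1 - α) * R ^ 2 / 2))) := by
  have h1 := ((h.tendsto_freeEnergy_sub hα0 hα1 hβ hR).add
    (h.tendsto_freeEnergy hα0 hα1 hβ hR hv₁ hmin)).sub
    (highLoad_tendsto_ratio.const_mul (β / 2 * (1 - α) * R ^ 2))
  rw [show 0 + α * spectralValue α β R v₁ - β / 2 * (1 - α) * R ^ 2 * α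
    = α * (spectralValue α β R v₁ - β * (1 - α) * R ^ 2 / 2) by ring] at h1
  refine h1.congr fun p => ?_
  ring

end

end Hopfield

end

/-! ### Assembly of the spectral limit, the variational problem and the free energies. -/

theorem theorem2 {Ω : Type*} [MeasurableSpace Ω] (P : Measure Ω) [IsProbabilityMeasure P]
    (ξ : ℕ → ℕ → Ω → ℝ)
    (hmeas : ∀ i j, Measurable (ξ i j))
    (hindep : iIndepFun (fun p : ℕ × ℕ => ξ p.1 p.2) P)
    (hident : ∀ i j, IdentDistrib (ξ i j) (ξ 0 0) P P)
    (hmean : ∀ i j, ∫ ω, ξ i j ω ∂P = 0)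
    (hvar : ∀ i j, ∫ ω, ξ i j ω ^ 2 ∂P = 1)
    (hsub : ∃ c : ℝ≥0, ∀ i j, HasSubgaussianMGF (ξ i j) c P)
    (α β R : ℝ) (hα0 : 0 < α) (hα1 : α < 1) (hβ : 0 < β) (hR : 0 < R) :
    (∀ q ∈ Hopfield.feasible α β,
      Integrable (fun l => Real.log (2 * q - β * (1 - α) * l)) (Hopfield.marchenkoPastur α)) ∧
    ∃ m : ℝ, IsLeast (Hopfield.variational α β R '' Hopfield.feasible α β) m ∧
      (∀ᵐ ω ∂P, Tendsto
        (fun p : ℕ × ℕ => Hopfield.freeEnergy p.1 p.2 β R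
          (Hopfield.energy (fun i j => ξ i j ω) p.1 p.2))
        (Hopfield.highLoad α) (𝓝 (α * m))) ∧
      (∀ᵐ ω ∂P, Tendsto
        (fun p : ℕ × ℕ => Hopfield.freeEnergy p.1 p.2 β R
          (Hopfield.pairEnergy (fun i j => ξ i j ω) p.1 p.2))
        (Hopfield.highLoad α) (𝓝 (α * (m - β * (1 - α) * R ^ 2 / 2)))) := by
  obtain ⟨c, hc⟩ := hsub
  obtain ⟨m, hμ⟩ := Hopfield.exists_entryLaw_of_subgaussian (hmeas 0 0) (hmean 0 0) (hvar 0 0) (hc 0 0)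
  have hlim := Hopfield.ae_spectralLimit hmeas hindep hident hμ hα0 hα1
  obtain ⟨v₁, hv₁, hmin⟩ := Hopfield.exists_forall_spectralValue_le hα0 hα1 hβ hR
  refine ⟨fun q hq => (Hopfield.log_affine_marchenkoPastur hα0 hα1
    (mul_pos hβ (sub_pos.2 hα1)) hq).1, _,
    Hopfield.isLeast_variational hα0 hα1 hβ hv₁ hmin, ?_, ?_⟩
  · filter_upwards [hlim] with ω hω
    exact hω.tendsto_freeEnergy hα0 hα1 hβ hR hv₁ hmin
  · filter_upwards [hlim] with ω hω
    exact hω.tendsto_freeEnergy_pair hα0 hα1 hβ hR hv₁ hmin
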